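/- Let $0<\beta<1$ and let $\Omega\subset\mathbb R^2\simeq\mathbb C$ be a bounded simply connected open set with $C^{1,\beta}$ boundary, with outward unit normal $\nu$ and unit tangent $\tau=i\nu$ on $\partial\Omega$. Write $u\wedge v=u_1v_2-u_2v_1$ for $u,v\in\mathbb C$. For $a\in\Omega$ let $\widehat\Phi_a$ be the solution of $$\Delta\widehat\Phi_a=2\pi\delta_a\ \text{in }\Omega,\qquad \widehat\Phi_a=0\ \text{on }\partial\Omega,$$ let $\widehat R_a=\widehat\Phi_a-\log|\cdot-a|$ (a harmonic function in $\Omega$), and put $$\widehat W(a)=\widehat W^\Omega(a)=-\pi\widehat R_a(a).$$ For a $C^1$ map $g:\partial\Omega\to\mathbb S^1$ of degree one let $\Phi_{a,g}$ be the solution of $$\Delta\Phi_{a,g}=2\pi\delta_a\ \text{in }\Omega,\qquad \frac{\partial\Phi_{a,g}}{\partial\nu}=g\wedge\frac{\partial g}{\partial\tau}\ \text{on }\partial\Omega,\qquad \int_{\partial\Omega}\Phi_{a,g}=0,$$ let $R_{a,g}=\Phi_{a,g}-\log|\cdot-a|$, and put $$W(a,g)=\frac12\int_{\partial\Omega}\Phi_{a,g}\Big(g\wedge\frac{\partial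 g}{\partial\tau}\Big)-\pi R_{a,g}(a).$$ (Normal derivatives are understood in the weak sense, through Green's formula.) These are the renormalized energies of one singularity of degree one. The canonical boundary datum $g^{a}:\partial\Omega\to\mathbb S^1$ is the map of degree one, unique up to a multiplicative constant of modulus one, such that $g^a\wedge\partial g^a/\partial\tau=\partial\widehat\Phi_a/\partial\nu$ on $\partial\Omega$. A critical point of a real function that is $C^2$ near it is called nondegenerate if the Hessian matrix at that point is invertible. Let $a_0\in\Omega$ be a nondegenerate critical point of $\widehat W$. Then $a_0$ is a nondegenerate critical point of $W(\cdot,g^{a_0})$ (for every representative $g^{a_0}$), and the Hessian matrices of $\widehat W$ and of $W(\cdot,g^{a_0})$ at $a_0$ have the same determinant. Moreover, for every biholomorphic map $f$ from the unit disc onto $\Omega$ with $f(0)=a_0$, $$\nabla^2(\widehat W\circ f)(0)=\pi M-2\pi I_2,\qquad \nabla^2\big(W(\cdot,g^{a_0})\circ f\big)(0)=\pi M+2\pi I_2,$$ where $M=\begin{pmatrix}\operatorname{Re}z&-\operatorname{Im}z\\-\operatorname{Im}z&-\operatorname{Re}z\end{pmatrix}$ with $z=f^{(3)}(0)/f'(0)$,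 and these two matrices have the same determinant. -/

import Mathlib

open MeasureTheory Set InnerProductSpace
open scoped NNReal

namespace RenormalizedEnergy

/-! The plane `ℝ²` is identified with `ℂ`; the real scalar product is `inner ℝ`.
There is one singularity `a`, of degree one. -/

noncomputable section

/-- The vector product `u ∧ v = u₁ v₂ - u₂ v₁`. -/
def wedge (u v : ℂ) : ℝ := u.re * v.im - u.im * v.re

/-! ### Domains -/

/-- `Ω` has `C^{1,β}` boundary: near each boundary point, in suitable orthonormal coordinates,
`Ω` is the set of points lying strictly above the graph of a `C^{1,β}` function. -/
def HasC1HolderBoundary (β : ℝ≥0) (Ω : Set ℂ) : Prop :=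
  ∀ p ∈ frontier Ω, ∃ (r : ℝ) (c : ℂ) (γ : ℝ → ℝ) (K : ℝ≥0),
    0 < r ∧ ‖c‖ = 1 ∧ ContDiff ℝ 1 γ ∧ HolderWith K β (deriv γ) ∧
      ∀ x ∈ Metric.ball p r, x ∈ Ω ↔ γ (c * (x - p)).re < (c * (x - p)).im

/-- Bounded simply connected planar domains of class `C^{1,β}`. -/
structure IsC1HolderDomain (β : ℝ≥0) (Ω : Set ℂ) : Prop where
  isOpen : IsOpen Ω
  isBounded : Bornology.IsBounded Ω
  isSimplyConnected : IsSimplyConnected Ω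
  boundary : HasC1HolderBoundary β Ω

/-- The arclength measure on `∂Ω`. -/
def arclength (Ω : Set ℂ) : Measure ℂ := (Measure.hausdorffMeasure 1).restrict (frontier Ω)

/-- `ν` is the outward unit normal to `Ω` at the boundary point `p`: seen from `p`, the set `Ω` is
asymptotically the half-plane of all `x` with `⟪x - p, ν⟫ < 0`. -/
def IsOutwardNormal (Ω : Set ℂ) (p ν : ℂ) : Prop :=
  ‖ν‖ = 1 ∧ ∀ ε > 0, ∃ δ > 0, ∀ x : ℂ, ‖x - p‖ < δ →
    (inner ℝ (x - p) ν < -(ε * ‖x - p‖) → x ∈ Ω) ∧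
    (ε * ‖x - p‖ < inner ℝ (x - p) ν → x ∉ Ω)

/-- The outward unit normal `ν(p)`, for `p ∈ ∂Ω`. -/
def outwardNormal (Ω : Set ℂ) (p : ℂ) : ℂ := Classical.epsilon (IsOutwardNormal Ω p)

/-- The unit tangent `τ(p) = i ν(p)`, which orients `∂Ω` counterclockwise. -/
def unitTangent (Ω : Set ℂ) (p : ℂ) : ℂ := Complex.I * outwardNormal Ω p

/-- The tangential derivative `∂g/∂τ` at `p ∈ ∂Ω`, which depends only on `g` on `∂Ω`. -/
def tangentialDeriv (Ω : Set ℂ) (g : ℂ → ℂ) (p : ℂ) : ℂ :=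
  fderivWithin ℝ g (frontier Ω) p (unitTangent Ω p)

/-- The current `g ∧ ∂g/∂τ` on `∂Ω`. -/
def current (Ω : Set ℂ) (g : ℂ → ℂ) (p : ℂ) : ℝ := wedge (g p) (tangentialDeriv Ω g p)

/-- `g` restricts to a `C¹` map from `∂Ω` to the unit circle, of degree one. -/
structure IsBoundaryDatum (Ω : Set ℂ) (g : ℂ → ℂ) : Prop where
  contDiffOn : ContDiffOn ℝ 1 g (frontier Ω)
  norm_eq_one : ∀ p ∈ frontier Ω, ‖g p‖ = 1
  degree_eq_one : (1 / (2 * Real.pi)) * ∫ p, current Ω g p ∂(arclength Ω) = 1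

/-! ### The Dirichlet and Neumann problems with a logarithmic pole -/

/-- The function `Φ = log |· - a| + R` with regular part `R`. When `R` is harmonic in `Ω`,
these are exactly the solutions of `ΔΦ = 2π δ_a` in `Ω`. -/
def withPole (a : ℂ) (R : ℂ → ℝ) (x : ℂ) : ℝ := Real.log ‖x - a‖ + R x

/-- Test functions: continuous on `closure Ω`, of class `C¹` in `Ω`, and in `H¹(Ω)`. -/
structure IsTestFunction (Ω : Set ℂ) (ζ : ℂ → ℝ) : Prop where
  continuousOn : ContinuousOn ζ (closure Ω)
  contDiffOn : ContDiffOn ℝ 1 ζ Ω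
  integrable : IntegrableOn (fun x => ‖gradient ζ x‖ ^ 2) Ω

/-- `∂Φ/∂ν = h` on `∂Ω` for the solution `Φ = log |· - a| + R` of `ΔΦ = 2π δ_a` in `Ω`,
in the weak sense: `∫_Ω ∇Φ · ∇ζ = ∫_{∂Ω} h ζ - 2π ζ(a)` for all test functions `ζ`. -/
structure HasNormalDeriv (Ω : Set ℂ) (a : ℂ) (R h : ℂ → ℝ) : Prop where
  gradient_sq : IntegrableOn (fun x => ‖gradient R x‖ ^ 2) Ω
  integrable : Integrable h (arclength Ω)
  integrable_inner : ∀ ζ : ℂ → ℝ, IsTestFunction Ω ζ →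
    IntegrableOn (fun x => inner ℝ (gradient (withPole a R) x) (gradient ζ x)) Ω
  green : ∀ ζ : ℂ → ℝ, IsTestFunction Ω ζ →
    ∫ x in Ω, inner ℝ (gradient (withPole a R) x) (gradient ζ x)
      = (∫ p, h p * ζ p ∂(arclength Ω)) - 2 * Real.pi * ζ a

/-- `R` is the regular part of the solution of
`ΔΦ = 2π δ_a` in `Ω`, `Φ = 0` on `∂Ω`. -/
structure IsDirichletRegularPart (Ω : Set ℂ) (a : ℂ) (R : ℂ → ℝ) : Prop where
  harmonic : HarmonicOnNhd R Ω
  continuousOn : ContinuousOn R (closure Ω)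
  boundary : ∀ p ∈ frontier Ω, withPole a R p = 0

/-- `R` is the regular part of the solution of
`ΔΦ = 2π δ_a` in `Ω`, `∂Φ/∂ν = h` on `∂Ω`, `∫_{∂Ω} Φ = 0`. -/
structure IsNeumannRegularPart (Ω : Set ℂ) (a : ℂ) (h R : ℂ → ℝ) : Prop where
  harmonic : HarmonicOnNhd R Ω
  continuousOn : ContinuousOn R (closure Ω)
  normalDeriv : HasNormalDeriv Ω a R h
  mean_zero : ∫ p, withPole a R p ∂(arclength Ω) = 0

/-- The regular part `R̂_a` of `Φ̂_a`; it is determined on `closure Ω`. -/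
def hatR (Ω : Set ℂ) (a : ℂ) : ℂ → ℝ := Classical.epsilon (IsDirichletRegularPart Ω a)

/-- The regular part `R_{a,g}` of `Φ_{a,g}`; it is determined on `closure Ω`. -/
def R (Ω : Set ℂ) (a : ℂ) (g : ℂ → ℂ) : ℂ → ℝ :=
  Classical.epsilon (IsNeumannRegularPart Ω a (current Ω g))

/-- `Φ_{a,g} = log |· - a| + R_{a,g}`. -/
def Phi (Ω : Set ℂ) (a : ℂ) (g : ℂ → ℂ) : ℂ → ℝ := withPole a (R Ω a g)

/-! ### Renormalized energies and canonical boundary data -/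

/-- `Ŵ(a) = -π R̂_a(a)`. -/
def hatW (Ω : Set ℂ) (a : ℂ) : ℝ := -Real.pi * hatR Ω a a

/-- `W(a, g) = (1/2) ∫_{∂Ω} Φ_{a,g} (g ∧ ∂g/∂τ) - π R_{a,g}(a)`. -/
def W (Ω : Set ℂ) (a : ℂ) (g : ℂ → ℂ) : ℝ :=
  (1 / 2) * (∫ p, Phi Ω a g p * current Ω g p ∂(arclength Ω)) - Real.pi * R Ω a g a

/-- `g` is a representative of the canonical boundary datum `g^a`, which is unique up to a
multiplicative constant of modulus one: `g` has degree one and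
`g ∧ ∂g/∂τ = ∂Φ̂_a/∂ν` on `∂Ω`. -/
structure IsCanonicalDatum (Ω : Set ℂ) (a : ℂ) (g : ℂ → ℂ) : Prop where
  isBoundaryDatum : IsBoundaryDatum Ω g
  normalDeriv : HasNormalDeriv Ω a (hatR Ω a) (current Ω g)

/-! ### Critical points -/

/-- The Hessian matrix of a real function on `ℂ`, in the real basis `1, i`. -/
def hessian (F : ℂ → ℝ) (z : ℂ) : Matrix (Fin 2) (Fin 2) ℝ :=
  Matrix.of fun i j => fderiv ℝ (fderiv ℝ F) z (![1, Complex.I] i) (![1, Complex.I] j)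

/-- `z` is a nondegenerate critical point of `F`. -/
structure IsNondegenerateCriticalPoint (F : ℂ → ℝ) (z : ℂ) : Prop where
  contDiffAt : ContDiffAt ℝ 2 F z
  critical : fderiv ℝ F z = 0
  nondegenerate : (hessian F z).det ≠ 0

/-- `f` is a conformal representation of `Ω`, that is, a biholomorphic map from the open unit
disc onto `Ω`. -/
structure IsConformalRepresentation (f : ℂ → ℂ) (Ω : Set ℂ) : Prop where
  differentiableOn : DifferentiableOn ℂ f (Metric.ball 0 1)
  bijOn : BijOn f (Metric.ball 0 1) Ω

/-- The matrix of the real linear map sending `ξ` to the complex conjugate of `z ξ`. -/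
def conjMulMatrix (z : ℂ) : Matrix (Fin 2) (Fin 2) ℝ := !![z.re, -z.im; -z.im, -z.re]

end

end RenormalizedEnergy

open Filter Topology Metric ComplexConjugate

namespace RenormalizedEnergy

/-! ### Injective holomorphic functions -/

/-! Let `φ` map `Ω` conformally onto the unit disc, continuously up to the boundary, with `φ a₀ =
0`. The Dirichlet Green function with pole `a` is `log |φ - φ a| - log |1 - conj (φ a) φ|`, so that
`hatW a = -π (log |φ' a| - log (1 - |φ a|²))`. The current of the canonical datum is the normal
derivative of `log |φ|`, formally the pullback of the uniform density on the circle. For that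
density the Neumann function of the disc is the same expression with a plus sign between the
logarithms. Hence `Φ_{a,g} = log |φ - φ a| + log |1 - conj (φ a) φ| + c`; the constant `c` cancels
in the energy, and `W a g = -π (log |φ' a| + log (1 - |φ a|²))`.

The two energies therefore differ by `-2π log (1 - |φ|²)`, whose differential vanishes at `a₀`. In
the coordinate `f = φ⁻¹` one has `hatW ∘ f = π log |f'| + π log (1 - |w|²)`. Criticality at `0`
means `f''(0) = 0`; then `log |f'|` has Hessian `M`, while `log (1 - |w|²)` has Hessian `-2 I`. This
gives `πM - 2πI` and `πM + 2πI`. Since `M` is symmetric and traceless, `det (πM + tI) = t² - π²|z|²`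
does not see the sign of `t`. At a critical point, passing from `a₀` to the coordinate multiplies
Hessian determinants by `|f'(0)|⁴`, so the equality also holds at `a₀`.

The analytic work is to justify the two formulas with weak normal derivatives, without any control
of `φ'` at the boundary. The chart comes from the Riemann mapping theorem (`exists_bijOn_ball`) and
a length-area argument for continuity at the boundary (`exists_tendsto_of_hasC1HolderBoundary`). The
Neumann field with pole `a` and the Dirichlet field with pole `a₀` differ by the pullback of
`poleField`, which is tangential on the circle; Green's formula for it has no boundary term
(`setIntegral_inner_poleField`) and is carried to `Ω` by conformal invariance
(`IsDiscChart.pairing_comp`). Uniqueness in both boundary problems identifies the functions selected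
by `Classical.epsilon` with the explicit ones, which yields `IsDiscChart.hatW_eq` and
`IsDiscChart.W_eq`. -/

/-- An injective holomorphic function is an open map. -/
theorem isOpenMap_of_injOn {U : Set ℂ} (hU : IsOpen U) {f : ℂ → ℂ}
    (hf : DifferentiableOn ℂ f U) (hinj : InjOn f U) {s : Set ℂ} (hs : s ⊆ U) (hso : IsOpen s) :
    IsOpen (f '' s) := by
  rw [isOpen_iff_mem_nhds]
  rintro _ ⟨z, hz, rfl⟩
  have han : AnalyticAt ℂ f z := hf.analyticAt (hU.mem_nhds (hs hz))
  rcases han.eventually_constant_or_nhds_le_map_nhds with h | h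
  · exfalso
    have h1 : ∀ᶠ w in 𝓝[≠] z, f w = f z ∧ w ∈ U :=
      (h.and (hU.mem_nhds (hs hz))).filter_mono nhdsWithin_le_nhds
    obtain ⟨w, ⟨hw1, hw2⟩, hw3⟩ := (h1.and self_mem_nhdsWithin).exists
    exact hw3 (hinj hw2 (hs hz) hw1)
  · exact h (image_mem_map (hso.mem_nhds hz))

theorem continuousAt_invFunOn {U : Set ℂ} (hU : IsOpen U) {f : ℂ → ℂ}
    (hf : DifferentiableOn ℂ f U) (hinj : InjOn f U) {z : ℂ} (hz : z ∈ U) :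
    ContinuousAt (Function.invFunOn f U) (f z) := by
  intro s hs
  rw [hinj.leftInvOn_invFunOn hz] at hs
  obtain ⟨t, ht1, ht2, ht3⟩ := _root_.mem_nhds_iff.1 (inter_mem hs (hU.mem_nhds hz))
  rw [Filter.mem_map]
  refine mem_of_superset
    ((isOpenMap_of_injOn hU hf hinj (ht1.trans inter_subset_right) ht2).mem_nhds ⟨z, ht3, rfl⟩) ?_
  rintro _ ⟨w, hw, rfl⟩
  simpa [hinj.leftInvOn_invFunOn (ht1 hw).2] using (ht1 hw).1

/-- The derivative of an injective holomorphic function does not vanish. -/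
theorem deriv_ne_zero_of_injOn {U : Set ℂ} (hU : IsOpen U) {f : ℂ → ℂ}
    (hf : DifferentiableOn ℂ f U) (hinj : InjOn f U) {z : ℂ} (hz : z ∈ U) : deriv f z ≠ 0 := by
  have han : AnalyticAt ℂ f z := hf.analyticAt (hU.mem_nhds hz)
  -- Zeros of `f'` are isolated: otherwise `f' = 0` on a disc and `f` would be constant there.
  have hisol : ∀ᶠ w in 𝓝[≠] z, deriv f w ≠ 0 := by
    rcases han.deriv.eventually_eq_zero_or_eventually_ne_zero with h | h
    · exfalso
      obtain ⟨r, hr, hb⟩ := Metric.eventually_nhds_iff_ball.1 (h.and (hU.mem_nhds hz))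
      obtain ⟨w, hw, hwz⟩ : ∃ w ∈ ball z r, w ≠ z := by
        have : ∀ᶠ w in 𝓝[≠] z, w ∈ ball z r := nhdsWithin_le_nhds (ball_mem_nhds z hr)
        obtain ⟨w, h1, h2⟩ := (this.and self_mem_nhdsWithin).exists
        exact ⟨w, h1, h2⟩
      refine hwz (hinj (hb w hw).2 hz ?_)
      refine (convex_ball z r).is_const_of_fderivWithin_eq_zero (𝕜 := ℂ)
        (fun x hx => (hf.mono (fun x hx => (hb x hx).2)) x hx) (fun x hx => ?_) hw
        (mem_ball_self hr)
      have hd : HasDerivAt f 0 x := by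
        have := (hf.differentiableAt (hU.mem_nhds (hb x hx).2)).hasDerivAt
        rwa [(hb x hx).1] at this
      rw [fderivWithin_of_isOpen isOpen_ball hx]
      simpa using! hd.hasFDerivAt.fderiv
    · exact h
  obtain ⟨s, hs, hs'⟩ : ∃ s ∈ 𝓝 z, ∀ w ∈ s, w ≠ z → deriv f w ≠ 0 := by
    rw [eventually_nhdsWithin_iff] at hisol
    exact ⟨_, hisol, fun w hw hne => hw hne⟩
  obtain ⟨t, ht1, ht2, ht3⟩ := _root_.mem_nhds_iff.1 (inter_mem hs (hU.mem_nhds hz))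
  set φ := Function.invFunOn f U with hφ
  have htU : t ⊆ U := ht1.trans inter_subset_right
  have hopen := isOpenMap_of_injOn hU hf hinj htU ht2
  -- Away from `f z` the inverse is differentiable because `f' ≠ 0`; at `f z` it is continuous, so
  -- the singularity is removable. The chain rule then forbids `f' z = 0`.
  have hφd : DifferentiableOn ℂ φ (f '' t) := by
    refine (Complex.differentiableOn_compl_singleton_and_continuousAt_iff
      (c := f z) (hopen.mem_nhds ⟨z, ht3, rfl⟩)).1
      ⟨?_, continuousAt_invFunOn hU hf hinj hz⟩
    rintro _ ⟨⟨w, hw, rfl⟩, hne⟩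
    have hwz : w ≠ z := fun h => hne (by simp [h])
    have hL := hinj.leftInvOn_invFunOn (htU hw)
    refine DifferentiableAt.differentiableWithinAt (HasDerivAt.differentiableAt
      (HasDerivAt.of_local_left_inverse (f := f) (f' := deriv f w)
        (continuousAt_invFunOn hU hf hinj (htU hw)) ?_ (hs' w (ht1 hw).1 hwz) ?_))
    · rw [hφ, hL]
      exact (hf.differentiableAt (hU.mem_nhds (htU hw))).hasDerivAt
    · filter_upwards [hopen.mem_nhds ⟨w, hw, rfl⟩]
      rintro _ ⟨x, hx, rfl⟩
      rw [hφ, hinj.leftInvOn_invFunOn (htU hx)]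
  have h1 : HasDerivAt φ (deriv φ (f z)) (f z) :=
    (hφd.differentiableAt (hopen.mem_nhds ⟨z, ht3, rfl⟩)).hasDerivAt
  have h2 := h1.comp z (hf.differentiableAt (hU.mem_nhds hz)).hasDerivAt
  have h3 : HasDerivAt (φ ∘ f) 1 z := by
    refine (hasDerivAt_id z).congr_of_eventuallyEq ?_
    filter_upwards [hU.mem_nhds hz] with x hx
    exact hinj.leftInvOn_invFunOn hx
  intro h0
  have := h2.unique h3
  simp [h0] at this

theorem hasDerivAt_invFunOn {U : Set ℂ} (hU : IsOpen U) {f : ℂ → ℂ}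
    (hf : DifferentiableOn ℂ f U) (hinj : InjOn f U) {z : ℂ} (hz : z ∈ U) :
    HasDerivAt (Function.invFunOn f U) (deriv f z)⁻¹ (f z) := by
  have hL := hinj.leftInvOn_invFunOn hz
  refine HasDerivAt.of_local_left_inverse (f := f) (continuousAt_invFunOn hU hf hinj hz) ?_
    (deriv_ne_zero_of_injOn hU hf hinj hz) ?_
  · rw [hL]
    exact (hf.differentiableAt (hU.mem_nhds hz)).hasDerivAt
  · filter_upwards [(isOpenMap_of_injOn hU hf hinj subset_rfl hU).mem_nhds ⟨z, hz, rfl⟩]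
    rintro _ ⟨x, hx, rfl⟩
    rw [hinj.leftInvOn_invFunOn hx]

/-! ### The Riemann mapping theorem -/

/-- **Montel's theorem**, along a nonprincipal ultrafilter. -/
theorem exists_tendstoLocallyUniformlyOn {U : Set ℂ} (hU : IsOpen U) (F : ℕ → ℂ → ℂ)
    (hF : ∀ n, DifferentiableOn ℂ (F n) U) (hb : ∀ n, MapsTo (F n) U (closedBall 0 1)) :
    ∃ f : ℂ → ℂ, TendstoLocallyUniformlyOn F f (hyperfilter ℕ : Filter ℕ) U := by
  -- An ultrafilter converges at every point by compactness of the closed disc, so no diagonal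
  -- extraction is needed.
  have hlim : ∀ z ∈ U, ∃ w, Tendsto (fun n => F n z) (hyperfilter ℕ : Filter ℕ) (𝓝 w) := by
    intro z hz
    obtain ⟨w, -, hw⟩ := (isCompact_closedBall (0 : ℂ) 1).ultrafilter_le_nhds
      ((hyperfilter ℕ).map (fun n => F n z))
      (by
        rw [le_principal_iff]
        exact Filter.mem_map.2 (Filter.univ_mem' fun n => hb n hz))
    exact ⟨w, hw⟩
  choose! f hf using hlim
  refine ⟨f, ?_⟩
  rw [Metric.tendstoLocallyUniformlyOn_iff]
  intro ε hε z hz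
  obtain ⟨r, hr, hrU⟩ := Metric.isOpen_iff.1 hU z hz
  -- Equicontinuity from the Schwarz lemma: on the disc of radius `r` the values stay within
  -- distance `2` of the value at the centre.
  have hlip : ∀ n, ∀ w ∈ ball z r, dist (F n w) (F n z) ≤ 2 / r * dist w z := by
    intro n w hw
    refine Complex.dist_le_div_mul_dist_of_mapsTo_ball ((hF n).mono hrU) ?_ hw
    intro x hx
    have h1 := hb n (hrU hx)
    have h2 := hb n hz
    rw [mem_closedBall] at h1 h2 ⊢
    have := dist_triangle_right (F n x) (F n z) 0
    linarith
  have hlipf : ∀ w ∈ ball z r, dist (f w) (f z) ≤ 2 / r * dist w z := fun w hw =>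
    le_of_tendsto ((hf w (hrU hw)).dist (hf z hz)) (Eventually.of_forall fun n => hlip n w hw)
  -- With this radius each of the two Lipschitz terms costs `ε / 4`, and convergence at the single
  -- point `z` costs another `ε / 4`.
  set δ := min r (ε * r / 8) with hδ
  have hδ0 : 0 < δ := by positivity
  refine ⟨ball z δ, mem_nhdsWithin_of_mem_nhds (ball_mem_nhds z hδ0), ?_⟩
  have h3 : ∀ᶠ n in (hyperfilter ℕ : Filter ℕ), dist (F n z) (f z) < ε / 4 :=
    (Metric.tendsto_nhds.1 (hf z hz)) _ (by positivity)
  filter_upwards [h3] with n hn w hw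
  have hwr : w ∈ ball z r := ball_subset_ball (min_le_left _ _) hw
  have h4 : 2 / r * dist w z ≤ ε / 4 := by
    have : dist w z ≤ ε * r / 8 := (mem_ball.1 hw).le.trans (min_le_right _ _)
    calc 2 / r * dist w z ≤ 2 / r * (ε * r / 8) := by gcongr
      _ = ε / 4 := by field_simp; norm_num
  have h5 := hlip n w hwr
  have h6 := hlipf w hwr
  have h7 := dist_triangle4 (f w) (f z) (F n z) (F n w)
  rw [dist_comm (f z), dist_comm (F n z) (F n w)] at h7
  linarith

/-- **Hurwitz's theorem**: a nonconstant locally uniform limit of injective holomorphic functions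
is injective. -/
theorem injOn_of_tendstoLocallyUniformlyOn {U : Set ℂ} (hU : IsOpen U) (hc : IsPreconnected U)
    {l : Filter ℕ} [l.NeBot] {F : ℕ → ℂ → ℂ} {f : ℂ → ℂ}
    (hF : ∀ n, DifferentiableOn ℂ (F n) U) (hinj : ∀ n, InjOn (F n) U)
    (hlim : TendstoLocallyUniformlyOn F f l U) (hne : ∃ z ∈ U, deriv f z ≠ 0) : InjOn f U := by
  intro a ha b hb hab
  by_contra hne'
  have hf : DifferentiableOn ℂ f U := hlim.differentiableOn (Eventually.of_forall hF) hU
  -- By the identity theorem, failure would make `f` constant on `U`, against the nonzero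
  -- derivative.
  have hisol : ∀ᶠ z in 𝓝[≠] a, f z ≠ f a := by
    rcases (hf.analyticAt (hU.mem_nhds ha)).eventually_eq_or_eventually_ne
      (analyticAt_const (v := f a)) with h | h
    · exfalso
      have hEq := (hf.analyticOnNhd hU).eqOn_of_preconnected_of_eventuallyEq
        (g := fun _ => f a) analyticOnNhd_const hc ha h
      obtain ⟨z, hz, hz'⟩ := hne
      refine hz' ?_
      rw [(Filter.eventuallyEq_of_mem (hU.mem_nhds hz) hEq).deriv_eq]
      simp
    · exact h
  have hmem : ∀ᶠ z in 𝓝 a, z ∈ U ∧ z ≠ b ∧ (z ≠ a → f z ≠ f a) :=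
    (hU.eventually_mem ha).and ((isOpen_ne.eventually_mem hne').and (eventually_nhdsWithin_iff.1 hisol))
  obtain ⟨r, hr, hball⟩ := (nhds_basis_closedBall.eventually_iff).1 hmem
  have hsub : closedBall a r ⊆ U := fun z hz => (hball hz).1
  have hKc : ContinuousOn (fun z => ‖f z - f a‖) (sphere a r) :=
    ((hf.continuousOn.mono (sphere_subset_closedBall.trans hsub)).sub continuousOn_const).norm
  obtain ⟨ε, hε, hεb⟩ : ∃ ε > 0, ∀ z ∈ sphere a r, ε ≤ ‖f z - f a‖ := by
    obtain ⟨z, hz, hz'⟩ := (isCompact_sphere a r).exists_isMinOn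
      (NormedSpace.sphere_nonempty.2 hr.le) hKc
    refine ⟨‖f z - f a‖, ?_, fun w hw => hz' hw⟩
    rw [gt_iff_lt, norm_pos_iff, sub_ne_zero]
    refine (hball (sphere_subset_closedBall hz)).2.2 ?_
    rintro rfl
    simp at hz
    exact hr.ne hz
  have hunif := (tendstoLocallyUniformlyOn_iff_forall_isCompact hU).1 hlim _ hsub
    (isCompact_closedBall a r)
  rw [Metric.tendstoUniformlyOn_iff] at hunif
  have hptb : ∀ᶠ n in l, dist (F n b) (f b) < ε / 12 :=
    (Metric.tendsto_nhds.1 (hlim.tendsto_at hb)) _ (by positivity)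
  obtain ⟨n, hn1, hn2⟩ := ((hunif (ε / 12) (by positivity)).and hptb).exists
  have haC : a ∈ closedBall a r := mem_closedBall_self hr.le
  have hna := hn1 a haC
  have hsph : ∀ z ∈ sphere a r, ε / 3 ≤ ‖F n z - F n a‖ := by
    intro z hz
    have h1 := hn1 z (sphere_subset_closedBall hz)
    have h2 := hεb z hz
    rw [← dist_eq_norm] at h2 ⊢
    have h3 := dist_triangle4 (f z) (F n z) (F n a) (f a)
    rw [dist_comm (F n a) (f a)] at h3
    linarith
  have hfreq : ∃ᶠ z in 𝓝 a, F n z ≠ F n a := by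
    have : ∀ᶠ z in 𝓝[≠] a, z ∈ U ∧ z ≠ a :=
      ((hU.eventually_mem ha).filter_mono nhdsWithin_le_nhds).and self_mem_nhdsWithin
    exact (this.frequently.filter_mono nhdsWithin_le_nhds).mono
      fun z hz h => hz.2 (hinj n hz.1 ha h)
  -- Quantitative open mapping: `F n` covers the disc of radius `ε / 6` about `F n a`. As `f a = f
  -- b`, the two errors `ε / 12` put `F n b` in that disc, so `F n` takes this value again in a
  -- closed disc that omits `b`.
  have hcov := (((hF n).mono hsub).diffContOnCl_ball subset_rfl).ball_subset_image_closedBall hr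
    hsph hfreq
  have hbm : F n b ∈ ball (F n a) (ε / 3 / 2) := by
    rw [mem_ball]
    have h3 := dist_triangle_right (F n b) (F n a) (f b)
    rw [dist_comm (F n a), ← hab] at h3
    rw [← hab] at hn2
    linarith
  obtain ⟨z, hz, hzb⟩ := hcov hbm
  exact (hball hz).2.1 (hinj n (hball hz).1 hb hzb)

/-- The Möbius transformation of the unit disc that sends `w` to `0`. -/
noncomputable def mobius (w z : ℂ) : ℂ := (z - w) / (1 - conj w * z)

theorem one_sub_conj_mul_ne_zero {w z : ℂ} (hw : ‖w‖ < 1) (hz : ‖z‖ ≤ 1) :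
    1 - conj w * z ≠ 0 := by
  intro h
  have h1 : ‖conj w * z‖ = 1 := by
    rw [← sub_eq_zero.1 h]
    simp
  rw [norm_mul, Complex.norm_conj] at h1
  nlinarith [norm_nonneg w, norm_nonneg z]

/-- This identity serves twice: it keeps Möbius maps inside the disc, and on the unit circle it
equates `|z - w|` with `|1 - conj w z|`, which is what makes the boundary values of the Green
functions explicit. -/
theorem norm_sq_one_sub_conj_mul_sub (w z : ℂ) :
    ‖1 - conj w * z‖ ^ 2 - ‖z - w‖ ^ 2 = (1 - ‖w‖ ^ 2) * (1 - ‖z‖ ^ 2) := by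
  simp only [Complex.sq_norm, Complex.normSq_apply]
  simp
  ring

theorem norm_mobius_lt_one {w z : ℂ} (hw : ‖w‖ < 1) (hz : ‖z‖ < 1) : ‖mobius w z‖ < 1 := by
  have h0 : 0 < ‖1 - conj w * z‖ := norm_pos_iff.2 (one_sub_conj_mul_ne_zero hw hz.le)
  rw [mobius, norm_div, div_lt_one h0]
  have h1 := norm_sq_one_sub_conj_mul_sub w z
  have h2 : 0 < (1 - ‖w‖ ^ 2) * (1 - ‖z‖ ^ 2) := by
    apply mul_pos <;> nlinarith [norm_nonneg w, norm_nonneg z]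
  exact lt_of_pow_lt_pow_left₀ 2 h0.le (by linarith)

theorem mobius_self (w : ℂ) : mobius w w = 0 := by simp [mobius]

theorem mobius_injOn {w : ℂ} (hw : ‖w‖ < 1) : InjOn (mobius w) (ball 0 1) := by
  intro x hx y hy hxy
  rw [mem_ball_zero_iff] at hx hy
  have h1 := one_sub_conj_mul_ne_zero hw hx.le
  have h2 := one_sub_conj_mul_ne_zero hw hy.le
  have h3 : (1 : ℂ) - conj w * w ≠ 0 := one_sub_conj_mul_ne_zero hw hw.le
  rw [mobius, mobius, div_eq_div_iff h1 h2] at hxy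
  have : (1 - conj w * w) * (x - y) = 0 := by linear_combination hxy
  exact sub_eq_zero.1 ((mul_eq_zero.1 this).resolve_left h3)

theorem hasDerivAt_mobius {w z : ℂ} (hw : ‖w‖ < 1) (hz : ‖z‖ < 1) :
    HasDerivAt (mobius w) ((1 - conj w * w) / (1 - conj w * z) ^ 2) z := by
  have h1 := one_sub_conj_mul_ne_zero hw hz.le
  have h2 : HasDerivAt (fun z : ℂ => z - w) 1 z := (hasDerivAt_id z).sub_const w
  have h3 : HasDerivAt (fun z : ℂ => 1 - conj w * z) (-(conj w * 1)) z :=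
    ((hasDerivAt_id z).const_mul (conj w)).const_sub 1
  convert! h2.div h3 h1 using 1
  ring

/-- The difference quotient of `k = ρ²` factors as that of `ρ` times `ρ y + ρ z`, and the last
factor tends to `2 ρ z ≠ 0`. -/
theorem hasDerivAt_of_sq_eq {ρ k : ℂ → ℂ} {z k' : ℂ} (hρc : ContinuousAt ρ z)
    (hρ : ∀ x, ρ x ^ 2 = k x) (hk : HasDerivAt k k' z) (h0 : ρ z ≠ 0) :
    HasDerivAt ρ (k' / (2 * ρ z)) z := by
  rw [hasDerivAt_iff_tendsto_slope] at hk ⊢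
  have hsum : Tendsto (fun y => ρ y + ρ z) (𝓝[≠] z) (𝓝 (2 * ρ z)) := by
    rw [two_mul]
    exact (hρc.tendsto.mono_left nhdsWithin_le_nhds).add_const _
  have h2 : (2 : ℂ) * ρ z ≠ 0 := mul_ne_zero two_ne_zero h0
  refine (hk.div hsum h2).congr' ?_
  filter_upwards [hsum.eventually_ne h2] with y hy
  simp only [slope_def_field, Pi.div_apply, ← hρ]
  rw [sq_sub_sq, mul_div_assoc, mul_comm, mul_div_assoc, div_self hy, mul_one]

/-- Normalized univalent maps into the unit disc. -/
structure IsUnivalentToDisc (U : Set ℂ) (a : ℂ) (F : ℂ → ℂ) : Prop where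
  differentiableOn : DifferentiableOn ℂ F U
  mapsTo : MapsTo F U (ball 0 1)
  injOn : InjOn F U
  map_base : F a = 0

theorem IsUnivalentToDisc.mobius_comp {U : Set ℂ} {F : ℂ → ℂ} {a : ℂ} (ha : a ∈ U)
    (hd : DifferentiableOn ℂ F U) (hm : MapsTo F U (ball 0 1)) (hi : InjOn F U) :
    IsUnivalentToDisc U a (mobius (F a) ∘ F) := by
  have hFa : ‖F a‖ < 1 := mem_ball_zero_iff.1 (hm ha)
  refine ⟨?_, ?_, ?_, ?_⟩
  · intro z hz
    exact (hasDerivAt_mobius hFa (mem_ball_zero_iff.1 (hm hz))).differentiableAt.comp_differentiableWithinAt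
      z (hd z hz)
  · intro z hz
    rw [mem_ball_zero_iff]
    exact norm_mobius_lt_one hFa (mem_ball_zero_iff.1 (hm hz))
  · exact (mobius_injOn hFa).comp hi hm
  · simp [mobius_self]

/-- Koebe's square root trick. Moving the omitted value `w` to `0` gives a nonvanishing function;
its square root is still injective, and recentring it multiplies `|F' a|` by `(1 + s²) / (2s) > 1`,
where `s² = |w|`. -/
theorem IsUnivalentToDisc.exists_norm_deriv_lt {U : Set ℂ} (hU : IsOpen U)
    (hUc : IsSimplyConnected U) {F : ℂ → ℂ} {a : ℂ} (ha : a ∈ U) (hF : IsUnivalentToDisc U a F)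
    {w : ℂ} (hw : ‖w‖ < 1) (hwF : w ∉ F '' U) :
    ∃ G, IsUnivalentToDisc U a G ∧ ‖deriv F a‖ < ‖deriv G a‖ := by
  have hnorm : ∀ z ∈ U, ‖F z‖ < 1 := fun z hz => mem_ball_zero_iff.1 (hF.mapsTo hz)
  set k : ℂ → ℂ := mobius w ∘ F with hk
  have hkd : DifferentiableOn ℂ k U := fun z hz =>
    (hasDerivAt_mobius hw (hnorm z hz)).differentiableAt.comp_differentiableWithinAt z
      (hF.differentiableOn z hz)
  have hk0 : ∀ z ∈ U, k z ≠ 0 := by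
    intro z hz h
    rw [hk, Function.comp_apply, mobius, div_eq_zero_iff] at h
    rcases h with h | h
    · exact hwF ⟨z, hz, sub_eq_zero.1 h⟩
    · exact one_sub_conj_mul_ne_zero hw (hnorm z hz).le h
  obtain ⟨ρ, hρc, hρ⟩ := Complex.exists_continuousOn_pow_eq hUc hU hkd.continuousOn
    (by rintro ⟨z, hz, h⟩; exact hk0 z hz h) two_ne_zero
  have hρ0 : ∀ z ∈ U, ρ z ≠ 0 := fun z hz h => hk0 z hz (by rw [← hρ, h]; simp)
  have hρlt : ∀ z ∈ U, ‖ρ z‖ < 1 := by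
    intro z hz
    have h1 : ‖ρ z‖ ^ 2 < 1 := by
      rw [← norm_pow, hρ]
      exact norm_mobius_lt_one hw (hnorm z hz)
    nlinarith [norm_nonneg (ρ z)]
  have hρd : ∀ z ∈ U, HasDerivAt ρ (deriv k z / (2 * ρ z)) z := by
    intro z hz
    exact hasDerivAt_of_sq_eq (hρc.continuousAt (hU.mem_nhds hz)) hρ
      (hkd.differentiableAt (hU.mem_nhds hz)).hasDerivAt (hρ0 z hz)
  have hρi : InjOn ρ U := by
    intro x hx y hy hxy
    refine hF.injOn hx hy (mobius_injOn hw (hF.mapsTo hx) (hF.mapsTo hy) ?_)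
    change k x = k y
    rw [← hρ, ← hρ, hxy]
  refine ⟨_, IsUnivalentToDisc.mobius_comp ha
    (fun z hz => (hρd z hz).differentiableAt.differentiableWithinAt)
    (fun z hz => mem_ball_zero_iff.2 (hρlt z hz)) hρi, ?_⟩
  have hFd := (hF.differentiableOn.differentiableAt (hU.mem_nhds ha)).hasDerivAt
  have hkda : HasDerivAt k ((1 - conj w * w) * deriv F a) a := by
    have := (hasDerivAt_mobius hw (hnorm a ha)).comp a hFd
    simpa [hF.map_base] using this
  have hG := (hasDerivAt_mobius (hρlt a ha) (hρlt a ha)).comp a (hρd a ha)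
  rw [hG.deriv, hkda.deriv]
  have hF' : 0 < ‖deriv F a‖ :=
    norm_pos_iff.2 (deriv_ne_zero_of_injOn hU hF.differentiableOn hF.injOn ha)
  set s := ‖ρ a‖ with hs
  have hs0 : 0 < s := norm_pos_iff.2 (hρ0 a ha)
  have hs1 : s < 1 := hρlt a ha
  have hws : ‖w‖ = s ^ 2 := by
    rw [hs, ← norm_pow, hρ]
    simp [hk, mobius, hF.map_base]
  have e1 : ∀ x : ℂ, ‖x‖ < 1 → ‖1 - conj x * x‖ = 1 - ‖x‖ ^ 2 := by
    intro x hx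
    have : (1 : ℂ) - conj x * x = ((1 - ‖x‖ ^ 2 : ℝ) : ℂ) := by
      rw [Complex.conj_mul']; push_cast; rfl
    rw [this, Complex.norm_real, Real.norm_of_nonneg]
    nlinarith [norm_nonneg x]
  rw [norm_mul, norm_div, norm_div, norm_mul, norm_mul, norm_pow, e1 _ (hρlt a ha), e1 _ hw, hws,
    ← hs]
  have h2 : ‖(2 : ℂ)‖ = 2 := by simp
  rw [h2]
  have hpos : 0 < 1 - s ^ 2 := by nlinarith
  have : (1 - s ^ 2) / (1 - s ^ 2) ^ 2 * ((1 - (s ^ 2) ^ 2) * ‖deriv F a‖ / (2 * s))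
      = (1 + s ^ 2) / (2 * s) * ‖deriv F a‖ := by
    field_simp
    ring
  rw [this]
  have h3 : 1 < (1 + s ^ 2) / (2 * s) := by
    rw [lt_div_iff₀ (by positivity)]
    nlinarith [sq_nonneg (1 - s), mul_pos (sub_pos.2 hs1) (sub_pos.2 hs1)]
  nlinarith

/-- A branch `ρ` of `√(z - p)` never takes both a value and its opposite. Its image contains a disc
about `ρ a`, hence avoids the opposite disc about `-ρ a`, and inversion in that disc bounds it. -/
theorem IsUnivalentToDisc.exists_of_isSimplyConnected {U : Set ℂ} (hU : IsOpen U)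
    (hUc : IsSimplyConnected U) (hne : U ≠ univ) {a : ℂ} (ha : a ∈ U) :
    ∃ F, IsUnivalentToDisc U a F := by
  obtain ⟨p, hp⟩ := (ne_univ_iff_exists_notMem U).1 hne
  obtain ⟨ρ, hρc, hρ⟩ := Complex.exists_continuousOn_pow_eq hUc hU
    (g := fun z => z - p) (by fun_prop)
    (by rintro ⟨z, hz, h⟩; exact hp (by rwa [← sub_eq_zero.1 h])) two_ne_zero
  have hρ0 : ∀ z ∈ U, ρ z ≠ 0 := by
    intro z hz h
    have := hρ z
    rw [h] at this
    exact hp (by rwa [← sub_eq_zero.1 (by simpa using this.symm : z - p = 0)])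
  have hρd : DifferentiableOn ℂ ρ U := fun z hz =>
    (hasDerivAt_of_sq_eq (hρc.continuousAt (hU.mem_nhds hz)) hρ
      ((hasDerivAt_id z).sub_const p) (hρ0 z hz)).differentiableAt.differentiableWithinAt
  have hinv : ∀ x y, ρ x ^ 2 = ρ y ^ 2 → x = y := by
    intro x y h
    rw [hρ, hρ] at h
    simpa using h
  have hρi : InjOn ρ U := fun x _ y _ hxy => hinv x y (by rw [hxy])
  obtain ⟨r, hr, hb⟩ := Metric.isOpen_iff.1
    (isOpenMap_of_injOn hU hρd hρi subset_rfl hU) (ρ a) ⟨a, ha, rfl⟩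
  have hfar : ∀ z ∈ U, r ≤ ‖ρ z + ρ a‖ := by
    intro z hz
    by_contra! h
    obtain ⟨y, hy, hyz⟩ := hb (show -ρ z ∈ ball (ρ a) r by
      rwa [mem_ball, dist_eq_norm, ← norm_neg, neg_sub, sub_neg_eq_add, add_comm])
    obtain rfl : y = z := hinv y z (by rw [hyz]; ring)
    exact hρ0 y hy (by linear_combination hyz / 2)
  have hne0 : ∀ z ∈ U, ρ z + ρ a ≠ 0 := fun z hz => norm_pos_iff.1 (hr.trans_le (hfar z hz))
  refine ⟨_, IsUnivalentToDisc.mobius_comp (F := fun z => (r / 2 : ℂ) / (ρ z + ρ a)) ha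
    (fun z hz => ?_) (fun z hz => ?_) (fun x hx y hy hxy => ?_)⟩
  · exact (differentiableWithinAt_const _).div ((hρd z hz).add_const _) (hne0 z hz)
  · have h2 : ‖(r / 2 : ℂ)‖ = r / 2 := by
      rw [norm_div, Complex.norm_real, Real.norm_of_nonneg hr.le]; simp
    rw [mem_ball_zero_iff, norm_div, h2, div_lt_one (hr.trans_le (hfar z hz))]
    linarith [hfar z hz]
  · have hr' : (r : ℂ) ≠ 0 := by exact_mod_cast hr.ne'
    have h1 := hne0 x hx
    have h2 := hne0 y hy
    rw [div_eq_div_iff h1 h2] at hxy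
    refine hρi hx hy ?_
    have := mul_left_cancel₀ (div_ne_zero hr' two_ne_zero) hxy
    linear_combination -this

/-- The **Riemann mapping theorem**. -/
theorem exists_bijOn_ball {U : Set ℂ} (hU : IsOpen U) (hUc : IsSimplyConnected U)
    (hne : U ≠ univ) {a : ℂ} (ha : a ∈ U) :
    ∃ F : ℂ → ℂ, DifferentiableOn ℂ F U ∧ BijOn F U (ball 0 1) ∧ F a = 0 := by
  have hconn : IsPreconnected U := hUc.isPathConnected.isConnected.isPreconnected
  obtain ⟨r, hr, hrU⟩ := Metric.isOpen_iff.1 hU a ha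
  obtain ⟨F₀, hF₀⟩ := IsUnivalentToDisc.exists_of_isSimplyConnected hU hUc hne ha
  -- The Riemann map is sought as a maximizer of `|F' a|`. The Schwarz lemma bounds these numbers by
  -- `1 / r`.
  set S : Set ℝ := (fun F : ℂ → ℂ => ‖deriv F a‖) '' {F | IsUnivalentToDisc U a F} with hS
  have hSne : S.Nonempty := ⟨_, F₀, hF₀, rfl⟩
  have hSb : BddAbove S := by
    refine ⟨1 / r, ?_⟩
    rintro _ ⟨F, hF, rfl⟩
    refine Complex.norm_deriv_le_div_of_mapsTo_ball (hF.differentiableOn.mono hrU) ?_ hr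
    rw [hF.map_base]
    exact (hF.mapsTo.mono_left hrU).mono_right ball_subset_closedBall
  obtain ⟨u, -, hu, huS⟩ := exists_seq_tendsto_sSup hSne hSb
  choose F hF hFu using huS
  obtain ⟨f, hf⟩ := exists_tendstoLocallyUniformlyOn hU F (fun n => (hF n).differentiableOn)
    (fun n => (hF n).mapsTo.mono_right ball_subset_closedBall)
  have hdF : ∀ᶠ n in (hyperfilter ℕ : Filter ℕ), DifferentiableOn ℂ (F n) U :=
    Eventually.of_forall fun n => (hF n).differentiableOn
  have hfd : DifferentiableOn ℂ f U := hf.differentiableOn hdF hU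
  have hle : (hyperfilter ℕ : Filter ℕ) ≤ atTop := Nat.hyperfilter_le_atTop
  have hderiv : ‖deriv f a‖ = sSup S := by
    refine tendsto_nhds_unique ((hf.deriv hdF hU).tendsto_at ha).norm ?_
    refine (hu.mono_left hle).congr fun n => ?_
    exact (hFu n).symm
  have hpos : 0 < ‖deriv f a‖ := by
    rw [hderiv]
    exact lt_of_lt_of_le (norm_pos_iff.2
      (deriv_ne_zero_of_injOn hU hF₀.differentiableOn hF₀.injOn ha)) (le_csSup hSb ⟨_, hF₀, rfl⟩)
  have hinj : InjOn f U := injOn_of_tendstoLocallyUniformlyOn hU hconn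
    (fun n => (hF n).differentiableOn) (fun n => (hF n).injOn) hf ⟨a, ha, norm_pos_iff.1 hpos⟩
  have hfa : f a = 0 := by
    refine tendsto_nhds_unique (hf.tendsto_at ha) ?_
    simp [(hF _).map_base]
  -- A limit only lands in the closed disc, but its image is open, hence contained in the interior.
  have hmaps : MapsTo f U (ball 0 1) := by
    have hcl : f '' U ⊆ closedBall 0 1 := by
      rintro _ ⟨z, hz, rfl⟩
      exact isClosed_closedBall.mem_of_tendsto (hf.tendsto_at hz)
        (Eventually.of_forall fun n => ball_subset_closedBall ((hF n).mapsTo hz))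
    have := interior_maximal hcl (isOpenMap_of_injOn hU hfd hinj subset_rfl hU)
    rw [interior_closedBall _ one_ne_zero] at this
    exact fun z hz => this ⟨z, hz, rfl⟩
  have huniv : IsUnivalentToDisc U a f := ⟨hfd, hmaps, hinj, hfa⟩
  refine ⟨f, hfd, ⟨hmaps, hinj, ?_⟩, hfa⟩
  -- An omitted value would allow a strictly larger derivative than the maximum.
  intro w hw
  by_contra hwF
  obtain ⟨G, hG, hlt⟩ := huniv.exists_norm_deriv_lt hU hUc ha (mem_ball_zero_iff.1 hw) hwF
  rw [hderiv] at hlt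
  exact hlt.not_ge (le_csSup hSb ⟨_, hG, rfl⟩)

/-! ### Boundary extension of conformal maps -/

theorem det_clm_complex (T : ℂ →L[ℝ] ℂ) :
    T.det = (T 1).re * (T Complex.I).im - (T Complex.I).re * (T 1).im := by
  rw [ContinuousLinearMap.det, ← LinearMap.det_toMatrix Complex.basisOneI, Matrix.det_fin_two]
  simp [LinearMap.toMatrix_apply, Complex.basisOneI]

/-- The map that straightens the graph of `γ`, in coordinates centred at `p`. -/
noncomputable def graphChart (p c : ℂ) (γ : ℝ → ℝ) (w : ℂ) : ℂ :=
  p + conj c * (w + γ w.re * Complex.I)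

/-- The inverse of `graphChart`. -/
noncomputable def graphChartInv (p c : ℂ) (γ : ℝ → ℝ) (x : ℂ) : ℂ :=
  c * (x - p) - γ (c * (x - p)).re * Complex.I

theorem mul_conj_of_norm_eq_one {c : ℂ} (hc : ‖c‖ = 1) : c * conj c = 1 := by
  rw [Complex.mul_conj']; simp [hc]

theorem graphChartInv_graphChart {p c : ℂ} (hc : ‖c‖ = 1) (γ : ℝ → ℝ) (w : ℂ) :
    graphChartInv p c γ (graphChart p c γ w) = w := by
  have h : c * (graphChart p c γ w - p) = w + γ w.re * Complex.I := by
    rw [graphChart, add_sub_cancel_left, ← mul_assoc, mul_conj_of_norm_eq_one hc, one_mul]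
  rw [graphChartInv, h]
  simp

theorem graphChart_graphChartInv {p c : ℂ} (hc : ‖c‖ = 1) (γ : ℝ → ℝ) (x : ℂ) :
    graphChart p c γ (graphChartInv p c γ x) = x := by
  have h : (graphChartInv p c γ x).re = (c * (x - p)).re := by simp [graphChartInv]
  rw [graphChart, h, graphChartInv, sub_add_cancel, ← mul_assoc, mul_comm (conj c),
    mul_conj_of_norm_eq_one hc, one_mul]
  ring

theorem continuous_graphChart (p c : ℂ) {γ : ℝ → ℝ} (hγ : Continuous γ) :
    Continuous (graphChart p c γ) := by
  unfold graphChart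
  fun_prop

theorem continuous_graphChartInv (p c : ℂ) {γ : ℝ → ℝ} (hγ : Continuous γ) :
    Continuous (graphChartInv p c γ) := by
  unfold graphChartInv
  fun_prop

/-- The derivative of `graphChart`. -/
noncomputable def graphChartDeriv (c : ℂ) (γ : ℝ → ℝ) (w : ℂ) : ℂ →L[ℝ] ℂ :=
  conj c • (ContinuousLinearMap.id ℝ ℂ +
    Complex.reCLM.smulRight (((deriv γ w.re : ℝ) : ℂ) * Complex.I))

theorem hasFDerivAt_graphChart (p c : ℂ) {γ : ℝ → ℝ} (hγ : Differentiable ℝ γ) (w : ℂ) :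
    HasFDerivAt (graphChart p c γ) (graphChartDeriv c γ w) w := by
  have h1 : HasFDerivAt (fun w : ℂ => γ w.re) ((deriv γ w.re) • Complex.reCLM) w :=
    (hγ w.re).hasDerivAt.comp_hasFDerivAt w Complex.reCLM.hasFDerivAt
  have h2 : HasFDerivAt (fun w : ℂ => (γ w.re : ℂ))
      (Complex.ofRealCLM.comp ((deriv γ w.re) • Complex.reCLM)) w :=
    Complex.ofRealCLM.hasFDerivAt.comp w h1
  have h3 := ((hasFDerivAt_id w).add (h2.mul_const Complex.I)).const_mul (conj c)
  convert! h3.const_add p using 1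
  ext v
  simp only [graphChartDeriv, smul_apply, add_apply,
    ContinuousLinearMap.coe_id', id_eq, ContinuousLinearMap.smulRight_apply, Complex.reCLM_apply,
    Complex.real_smul, smul_eq_mul, ContinuousLinearMap.comp_apply, Complex.ofRealCLM_apply,
    Complex.ofReal_mul]
  ring

theorem graphChartDeriv_apply (c : ℂ) (γ : ℝ → ℝ) (w v : ℂ) :
    graphChartDeriv c γ w v = conj c * (v + v.re * ((deriv γ w.re : ℝ) * Complex.I)) := by
  simp [graphChartDeriv, mul_add]

theorem norm_graphChartDeriv_apply_le {c : ℂ} (hc : ‖c‖ = 1) {γ : ℝ → ℝ} {w : ℂ} {L : ℝ}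
    (hL : |deriv γ w.re| ≤ L) (v : ℂ) : ‖graphChartDeriv c γ w v‖ ≤ (1 + L) * ‖v‖ := by
  rw [graphChartDeriv_apply, norm_mul, Complex.norm_conj, hc, one_mul]
  refine (norm_add_le _ _).trans ?_
  have h1 : ‖(v.re : ℂ) * ((deriv γ w.re : ℝ) * Complex.I)‖ ≤ ‖v‖ * L := by
    rw [norm_mul, norm_mul, Complex.norm_I, mul_one, Complex.norm_real, Complex.norm_real]
    gcongr
    · exact Complex.abs_re_le_norm v
    · exact hL
  linarith

/-- Length-area principle: if the Dirichlet-type integral of `A` over a half-disc is finite, then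
there are arbitrarily small half-circles on which the length integral of `A` is small. -/
theorem exists_lintegral_arc_lt {A : ℂ → ℝ} (hA : Measurable A) (hA0 : ∀ w, 0 ≤ A w) {t₀ : ℝ}
    (ht₀ : 0 < t₀)
    (hfin : ∫⁻ w in {w : ℂ | ‖w‖ < t₀ ∧ 0 < w.im}, ENNReal.ofReal (A w ^ 2) < ⊤)
    {δ : ℝ} (hδ : 0 < δ) :
    ∃ r ∈ Ioo 0 t₀, ∫⁻ θ in Ioo 0 Real.pi,
      ENNReal.ofReal (A (Complex.polarCoord.symm (r, θ))) < ENNReal.ofReal (δ / r) := by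
  by_contra! hcon
  set H : Set ℂ := {w : ℂ | ‖w‖ < t₀ ∧ 0 < w.im} with hH
  have hHm : MeasurableSet H :=
    ((isOpen_lt continuous_norm continuous_const).inter
      (isOpen_lt continuous_const Complex.continuous_im)).measurableSet
  have hpm : Measurable (fun q : ℝ × ℝ => Complex.polarCoord.symm q) := by
    have : (fun q : ℝ × ℝ => Complex.polarCoord.symm q)
        = fun q : ℝ × ℝ => (q.1 : ℂ) * (Real.cos q.2 + Real.sin q.2 * Complex.I) := by
      ext q
      exact Complex.polarCoord_symm_apply q
    rw [this]
    fun_prop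
  have hBm : Measurable (fun q : ℝ × ℝ => ENNReal.ofReal q.1 *
      ENNReal.ofReal (A (Complex.polarCoord.symm q) ^ 2)) := by
    refine Measurable.mul measurable_fst.ennreal_ofReal ?_
    exact ((hA.comp hpm).pow_const 2).ennreal_ofReal
  have hpolar : ∫⁻ q in Ioo 0 t₀ ×ˢ Ioo 0 Real.pi, ENNReal.ofReal q.1 *
      ENNReal.ofReal (A (Complex.polarCoord.symm q) ^ 2)
      ≤ ∫⁻ w in H, ENNReal.ofReal (A w ^ 2) := by
    rw [← lintegral_indicator hHm, ← Complex.lintegral_comp_polarCoord_symm]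
    have hsub : Ioo 0 t₀ ×ˢ Ioo 0 Real.pi ⊆ polarCoord.target := by
      rintro ⟨r, θ⟩ ⟨hr, hθ⟩
      exact ⟨hr.1, by linarith [hθ.1, Real.pi_pos], hθ.2⟩
    refine le_trans ?_ (lintegral_mono_set hsub)
    refine setLIntegral_mono' (measurableSet_Ioo.prod measurableSet_Ioo) ?_
    rintro ⟨r, θ⟩ ⟨hr, hθ⟩
    have hmem : Complex.polarCoord.symm (r, θ) ∈ H := by
      refine ⟨?_, ?_⟩
      · rw [Complex.norm_polarCoord_symm]
        simpa [abs_of_pos hr.1] using hr.2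
      · rw [Complex.polarCoord_symm_apply]
        have := mul_pos hr.1 (Real.sin_pos_of_pos_of_lt_pi hθ.1 hθ.2)
        simpa [-Complex.ofReal_sin, -Complex.ofReal_cos] using this
    rw [indicator_of_mem hmem]
    simp
  rw [Measure.volume_eq_prod, ← Measure.prod_restrict,
    lintegral_prod _ hBm.aemeasurable] at hpolar
  -- Cauchy–Schwarz on a half-circle of angular length `π`: length at least `δ / r` forces `∫ A² dθ
  -- ≥ δ² / (π r²)`. With the polar Jacobian this is a multiple of `1 / r`, not integrable at `0`.
  have hlow : ∀ r ∈ Ioo 0 t₀, ENNReal.ofReal (δ ^ 2 / Real.pi * r⁻¹) ≤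
      ∫⁻ θ in Ioo 0 Real.pi, ENNReal.ofReal r *
        ENNReal.ofReal (A (Complex.polarCoord.symm (r, θ)) ^ 2) := by
    intro r hr
    have hm : Measurable (fun θ : ℝ => A (Complex.polarCoord.symm (r, θ))) :=
      hA.comp (hpm.comp (by fun_prop))
    rw [lintegral_const_mul _ (hm.pow_const 2).ennreal_ofReal]
    have hcs := ENNReal.lintegral_mul_le_Lp_mul_Lq (volume.restrict (Ioo 0 Real.pi))
      Real.HolderConjugate.two_two hm.ennreal_ofReal.aemeasurable
      (aemeasurable_const (b := (1 : ENNReal)))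
    have h1 := hcon r hr
    set E := ∫⁻ θ in Ioo 0 Real.pi, ENNReal.ofReal (A (Complex.polarCoord.symm (r, θ)) ^ 2) with hE
    have hEe : ∫⁻ θ in Ioo 0 Real.pi, ENNReal.ofReal (A (Complex.polarCoord.symm (r, θ))) ^ (2 : ℝ)
        = E := by
      refine lintegral_congr fun θ => ?_
      rw [ENNReal.rpow_two, ENNReal.ofReal_pow (hA0 _)]
    simp only [Pi.mul_apply, mul_one, ENNReal.one_rpow, lintegral_const,
      Measure.restrict_apply_univ, Real.volume_Ioo, sub_zero, one_mul] at hcs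
    rw [hEe] at hcs
    have h2 := h1.trans hcs
    have h3 : ENNReal.ofReal (δ / r) ^ 2 ≤ E * ENNReal.ofReal Real.pi := by
      calc ENNReal.ofReal (δ / r) ^ 2 ≤ (E ^ (1 / 2 : ℝ) * ENNReal.ofReal Real.pi ^ (1 / 2 : ℝ)) ^ 2 := by
            gcongr
        _ = E * ENNReal.ofReal Real.pi := by
            rw [mul_pow, ← ENNReal.rpow_natCast, ← ENNReal.rpow_natCast, ← ENNReal.rpow_mul,
              ← ENNReal.rpow_mul]
            norm_num
    have hr0 := hr.1
    have hpi := Real.pi_pos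
    have h4 : ENNReal.ofReal (δ ^ 2 / Real.pi * r⁻¹)
        = ENNReal.ofReal r * (ENNReal.ofReal (δ / r) ^ 2 * ENNReal.ofReal (Real.pi⁻¹)) := by
      rw [← ENNReal.ofReal_pow (by positivity), ← ENNReal.ofReal_mul (by positivity),
        ← ENNReal.ofReal_mul hr0.le]
      congr 1
      field_simp
    rw [h4]
    gcongr
    calc ENNReal.ofReal (δ / r) ^ 2 * ENNReal.ofReal (Real.pi⁻¹)
        ≤ E * ENNReal.ofReal Real.pi * ENNReal.ofReal (Real.pi⁻¹) := by gcongr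
      _ = E := by
        rw [mul_assoc, ← ENNReal.ofReal_mul hpi.le, mul_inv_cancel₀ hpi.ne']
        simp
  have hlt : ∫⁻ r in Ioo 0 t₀, ENNReal.ofReal (δ ^ 2 / Real.pi * r⁻¹) < ⊤ :=
    lt_of_le_of_lt ((setLIntegral_mono' measurableSet_Ioo hlow).trans hpolar) hfin
  have hint : IntegrableOn (fun r : ℝ => δ ^ 2 / Real.pi * r⁻¹) (Ioo 0 t₀) := by
    refine ⟨by fun_prop, ?_⟩
    rw [hasFiniteIntegral_iff_ofReal]
    · exact hlt
    · filter_upwards [self_mem_ae_restrict measurableSet_Ioo] with r hr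
      have := hr.1
      have := Real.pi_pos
      simp only [Pi.zero_apply]
      positivity
  have hc0 : δ ^ 2 / Real.pi ≠ 0 := by
    have := Real.pi_pos
    positivity
  have hint2 : IntegrableOn (fun r : ℝ => r ^ (-1 : ℝ)) (Ioo 0 t₀) := by
    refine (hint.const_mul (δ ^ 2 / Real.pi)⁻¹).congr ?_
    refine Eventually.of_forall fun r => ?_
    simp only
    rw [Real.rpow_neg_one, ← mul_assoc, inv_mul_cancel₀ hc0, one_mul]
  rw [intervalIntegral.integrableOn_Ioo_rpow_iff ht₀] at hint2
  exact lt_irrefl _ hint2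

theorem isOpen_halfDisc (t : ℝ) : IsOpen {w : ℂ | ‖w‖ < t ∧ 0 < w.im} :=
  (isOpen_lt continuous_norm continuous_const).inter
    (isOpen_lt continuous_const Complex.continuous_im)

theorem polarCoord_symm_eq_circleMap (r θ : ℝ) :
    Complex.polarCoord.symm (r, θ) = circleMap 0 r θ := by
  rw [Complex.polarCoord_symm_apply, circleMap, zero_add, Complex.exp_mul_I]
  simp

theorem circleMap_mem_halfDisc {t r θ : ℝ} (hr : r ∈ Ioo 0 t) (hθ : θ ∈ Ioo 0 Real.pi) :
    circleMap 0 r θ ∈ {w : ℂ | ‖w‖ < t ∧ 0 < w.im} := by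
  refine ⟨by simpa [abs_of_pos hr.1] using hr.2, ?_⟩
  have h : (circleMap 0 r θ).im = r * Real.sin θ := by
    simp [circleMap, Complex.exp_ofReal_mul_I_im]
  rw [h]
  exact mul_pos hr.1 (Real.sin_pos_of_pos_of_lt_pi hθ.1 hθ.2)

theorem exists_circleMap_eq {w : ℂ} (hw : 0 < w.im) :
    ∃ θ ∈ Ioo 0 Real.pi, circleMap 0 ‖w‖ θ = w := by
  refine ⟨w.arg, ⟨?_, ?_⟩, ?_⟩
  · refine lt_of_le_of_ne (Complex.arg_nonneg_iff.2 hw.le) fun h => ?_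
    exact hw.ne' (Complex.arg_eq_zero_iff.1 h.symm).2
  · refine lt_of_le_of_ne (Complex.arg_le_pi w) fun h => ?_
    exact hw.ne' (Complex.arg_eq_pi_iff.1 h).2
  · simp [circleMap]

/-- A `C¹` map on a half-disc with finite weighted area has small oscillation on some
half-circle. -/
theorem exists_arc_oscillation_le {G : ℂ → ℂ} {A : ℂ → ℝ} (hA : Measurable A) (hA0 : ∀ w, 0 ≤ A w)
    {t₀ C : ℝ} (ht₀ : 0 < t₀) (hC : 0 < C)
    (hfin : ∫⁻ w in {w : ℂ | ‖w‖ < t₀ ∧ 0 < w.im}, ENNReal.ofReal (A w ^ 2) < ⊤)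
    (hG : ContDiffOn ℝ 1 G {w : ℂ | ‖w‖ < t₀ ∧ 0 < w.im})
    (hb : ∀ w ∈ {w : ℂ | ‖w‖ < t₀ ∧ 0 < w.im}, ∀ v, ‖fderiv ℝ G w v‖ ≤ C * A w * ‖v‖)
    {ε : ℝ} (hε : 0 < ε) :
    ∃ r ∈ Ioo 0 t₀, ∀ w₁ w₂ : ℂ, ‖w₁‖ = r → ‖w₂‖ = r → 0 < w₁.im → 0 < w₂.im →
      ‖G w₂ - G w₁‖ ≤ ε := by
  -- The speed along the half-circle is at most `C · A · r`, so the threshold `(ε / C) / r` for the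
  -- angular integral gives total length at most `ε`.
  obtain ⟨r, hr, hlt⟩ := exists_lintegral_arc_lt hA hA0 ht₀ hfin (div_pos hε hC)
  refine ⟨r, hr, ?_⟩
  have key : ∀ θ₁ ∈ Ioo 0 Real.pi, ∀ θ₂ ∈ Ioo 0 Real.pi, θ₁ ≤ θ₂ →
      ‖G (circleMap 0 r θ₂) - G (circleMap 0 r θ₁)‖ ≤ ε := by
    intro θ₁ h₁ θ₂ h₂ hle
    have hsub : Icc θ₁ θ₂ ⊆ Ioo 0 Real.pi := fun θ hθ => ⟨h₁.1.trans_le hθ.1, hθ.2.trans_lt h₂.2⟩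
    set η' : ℝ → ℂ := fun θ => fderiv ℝ G (circleMap 0 r θ) (circleMap 0 r θ * Complex.I) with hη'
    have hderiv : ∀ θ ∈ uIcc θ₁ θ₂, HasDerivAt (fun θ => G (circleMap 0 r θ)) (η' θ) θ := by
      intro θ hθ
      rw [uIcc_of_le hle] at hθ
      have hm := circleMap_mem_halfDisc hr (hsub hθ)
      have hd := (hG.differentiableOn one_ne_zero).differentiableAt
        ((isOpen_halfDisc t₀).mem_nhds hm)
      exact hd.hasFDerivAt.comp_hasDerivAt θ (hasDerivAt_circleMap 0 r θ)
    have hcont : ContinuousOn η' (uIcc θ₁ θ₂) := by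
      rw [uIcc_of_le hle]
      have h1 : ContinuousOn (fderiv ℝ G) {w : ℂ | ‖w‖ < t₀ ∧ 0 < w.im} :=
        hG.continuousOn_fderiv_of_isOpen (isOpen_halfDisc t₀) le_rfl
      have h2 : ContinuousOn (fun θ => fderiv ℝ G (circleMap 0 r θ)) (Icc θ₁ θ₂) :=
        h1.comp (continuous_circleMap 0 r).continuousOn
          fun θ hθ => circleMap_mem_halfDisc hr (hsub hθ)
      exact h2.clm_apply ((continuous_circleMap 0 r).mul continuous_const).continuousOn
    rw [← intervalIntegral.integral_eq_sub_of_hasDerivAt hderiv hcont.intervalIntegrable,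
      intervalIntegral.integral_of_le hle]
    have hle2 : ‖∫ θ in Ioc θ₁ θ₂, η' θ‖ₑ ≤ ENNReal.ofReal ε := by
      refine (enorm_integral_le_lintegral_enorm _).trans ?_
      calc ∫⁻ θ in Ioc θ₁ θ₂, ‖η' θ‖ₑ
          ≤ ∫⁻ θ in Ioc θ₁ θ₂, ENNReal.ofReal (C * r) *
              ENNReal.ofReal (A (Complex.polarCoord.symm (r, θ))) := by
            refine setLIntegral_mono' measurableSet_Ioc fun θ hθ => ?_
            rw [polarCoord_symm_eq_circleMap, ← ofReal_norm,
              ← ENNReal.ofReal_mul (mul_pos hC hr.1).le]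
            refine ENNReal.ofReal_le_ofReal ?_
            refine (hb _ (circleMap_mem_halfDisc hr (hsub ⟨hθ.1.le, hθ.2⟩)) _).trans ?_
            rw [norm_mul, Complex.norm_I, norm_circleMap_zero, abs_of_pos hr.1]
            linarith
        _ ≤ ∫⁻ θ in Ioo 0 Real.pi, ENNReal.ofReal (C * r) *
              ENNReal.ofReal (A (Complex.polarCoord.symm (r, θ))) :=
            lintegral_mono_set (Ioc_subset_Icc_self.trans hsub)
        _ = ENNReal.ofReal (C * r) * ∫⁻ θ in Ioo 0 Real.pi,
              ENNReal.ofReal (A (Complex.polarCoord.symm (r, θ))) :=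
            lintegral_const_mul' _ _ ENNReal.ofReal_ne_top
        _ ≤ ENNReal.ofReal (C * r) * ENNReal.ofReal (ε / C / r) := by gcongr
        _ = ENNReal.ofReal ε := by
            have := hr.1
            rw [← ENNReal.ofReal_mul (by positivity)]
            congr 1
            field_simp
    rwa [← ofReal_norm, ENNReal.ofReal_le_ofReal_iff hε.le] at hle2
  intro w₁ w₂ h₁ h₂ hi₁ hi₂
  obtain ⟨θ₁, hθ₁, e₁⟩ := exists_circleMap_eq hi₁
  obtain ⟨θ₂, hθ₂, e₂⟩ := exists_circleMap_eq hi₂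
  rw [h₁] at e₁
  rw [h₂] at e₂
  rw [← e₁, ← e₂]
  rcases le_total θ₁ θ₂ with h | h
  · exact key θ₁ hθ₁ θ₂ hθ₂ h
  · rw [norm_sub_rev]
    exact key θ₂ hθ₂ θ₁ hθ₁ h

/-- `|φ| → 1` at the boundary, for a conformal map `φ` onto the disc. -/
theorem tendsto_norm_one_of_bijOn {Ω : Set ℂ} (hΩ : IsOpen Ω) {φ : ℂ → ℂ}
    (hd : DifferentiableOn ℂ φ Ω) (hb : BijOn φ Ω (ball 0 1)) {p : ℂ} (hp : p ∉ Ω) :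
    Tendsto (fun x => ‖φ x‖) (𝓝[Ω] p) (𝓝 1) := by
  have hcont : ContinuousOn (Function.invFunOn φ Ω) (ball 0 1) := by
    rw [← hb.image_eq]
    rintro _ ⟨x, hx, rfl⟩
    exact (continuousAt_invFunOn hΩ hd hb.injOn hx).continuousWithinAt
  rw [tendsto_order]
  refine ⟨fun s hs => ?_, fun s hs => ?_⟩
  -- The points of `Ω` with `|φ| ≤ s` form a compact subset of `Ω`, so a neighbourhood of `p` misses
  -- them.
  · set K := Function.invFunOn φ Ω '' closedBall 0 s with hK
    have hsub : closedBall (0 : ℂ) s ⊆ ball 0 1 := closedBall_subset_ball hs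
    have hKc : IsCompact K := (isCompact_closedBall 0 s).image_of_continuousOn (hcont.mono hsub)
    have hpK : p ∉ K := by
      rintro ⟨w, hw, rfl⟩
      exact hp (hb.surjOn.mapsTo_invFunOn (hsub hw))
    filter_upwards [mem_nhdsWithin_of_mem_nhds (hKc.isClosed.isOpen_compl.mem_nhds hpK),
      self_mem_nhdsWithin] with x hx hxΩ
    by_contra! h
    exact hx ⟨φ x, by simpa using h, hb.injOn.leftInvOn_invFunOn hxΩ⟩
  · filter_upwards [self_mem_nhdsWithin] with x hx
    exact (mem_ball_zero_iff.1 (hb.mapsTo hx)).trans hs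

theorem hasFDerivAt_comp_graphChart {Ω : Set ℂ} (hΩ : IsOpen Ω) {φ : ℂ → ℂ}
    (hd : DifferentiableOn ℂ φ Ω) (p c : ℂ) {γ : ℝ → ℝ} (hγ : Differentiable ℝ γ) {w : ℂ}
    (hw : graphChart p c γ w ∈ Ω) :
    HasFDerivAt (φ ∘ graphChart p c γ)
      (deriv φ (graphChart p c γ w) • graphChartDeriv c γ w) w := by
  have h1 := ((hd.differentiableAt (hΩ.mem_nhds hw)).hasDerivAt.hasFDerivAt.restrictScalars ℝ).comp w
    (hasFDerivAt_graphChart p c hγ w)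
  convert! h1 using 1
  ext v
  simp [mul_comm]

/-- A point of `φ(N)`, where `N` is cut off from `φ⁻¹(0)` by a cross-cut with small image, is close
to the boundary point at which the image of the cross-cut is located. -/
theorem norm_sub_sq_le_of_crosscut {Ω : Set ℂ} {φ : ℂ → ℂ} (hΩ : IsOpen Ω)
    (hd : DifferentiableOn ℂ φ Ω) (hb : BijOn φ Ω (ball 0 1)) {N : ℂ → ℝ} (hN : Continuous N)
    {r ε : ℝ} (hε : ε < 1 / 2) {q : ℂ} (hq : 1 - ε < ‖q‖)
    (harc : ∀ x ∈ Ω, N x = r → ‖φ x - q‖ ≤ ε)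
    (hbase : ∀ x ∈ Ω, φ x = 0 → r < N x) {x : ℂ} (hx : x ∈ Ω) (hxN : N x < r) :
    ‖φ x - q / ‖q‖‖ ^ 2 ≤ 4 * ε := by
  set f := Function.invFunOn φ Ω with hf
  have hcont : ContinuousOn f (ball 0 1) := by
    rw [← hb.image_eq]
    rintro _ ⟨x, hx, rfl⟩
    exact (continuousAt_invFunOn hΩ hd hb.injOn hx).continuousWithinAt
  have hfm : MapsTo f (ball 0 1) Ω := hb.surjOn.mapsTo_invFunOn
  have hφf : ∀ w ∈ ball (0 : ℂ) 1, φ (f w) = w := fun w hw => hb.surjOn.rightInvOn_invFunOn hw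
  have hq0 : 0 < ‖q‖ := by linarith
  have hqc : (‖q‖ : ℂ) ≠ 0 := by exact_mod_cast hq0.ne'
  set u : ℂ := q / ‖q‖ with hu
  have hun : ‖u‖ = 1 := by
    rw [hu, norm_div, Complex.norm_real, norm_norm, div_self hq0.ne']
  have hqu : (q * conj u).re = ‖q‖ := by
    have : q * conj u = ((‖q‖ : ℝ) : ℂ) := by
      rw [hu, map_div₀, Complex.conj_ofReal, ← mul_div_assoc, Complex.mul_conj', sq,
        mul_div_assoc, div_self hqc, mul_one]
    rw [this, Complex.ofReal_re]
  -- The disc with a cap around `u = q/|q|` removed. The image of the cross-cut, lying within `ε` of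
  -- `q`, does not meet it; being convex and containing `0`, it stays on the side of the base point.
  set K : Set ℂ := ball 0 1 ∩ {w : ℂ | (w * conj u).re < ‖q‖ - ε} with hK
  have hKconv : Convex ℝ K := by
    refine (convex_ball 0 1).inter ?_
    have : IsLinearMap ℝ (fun w : ℂ => (w * conj u).re) :=
      ⟨fun x y => by simp [add_mul], fun a x => by simp; ring⟩
    exact convex_halfSpace_lt this _
  have h0K : (0 : ℂ) ∈ K := ⟨mem_ball_self one_pos, by simp; linarith⟩
  have hpre : IsPreconnected ((fun w => N (f w)) '' K) :=
    hKconv.isPreconnected.image _ (hN.comp_continuousOn (hcont.mono inter_subset_left))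
  have hKr : ∀ w ∈ K, r < N (f w) := by
    intro w hw
    by_contra! hle
    have h0 : r < N (f 0) := hbase _ (hfm (mem_ball_self one_pos)) (hφf _ (mem_ball_self one_pos))
    obtain ⟨w', hw', hw'r⟩ := hpre.ordConnected.out ⟨w, hw, rfl⟩ ⟨0, h0K, rfl⟩ ⟨hle, h0.le⟩
    have h1 := harc (f w') (hfm hw'.1) hw'r
    rw [hφf w' hw'.1] at h1
    have h2 : ((q - w') * conj u).re ≤ ε := by
      refine (Complex.re_le_norm _).trans ?_
      rw [norm_mul, Complex.norm_conj, hun, mul_one, norm_sub_rev]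
      exact h1
    rw [sub_mul, Complex.sub_re, hqu] at h2
    have := hw'.2
    simp only [mem_ofPred_eq] at this
    linarith
  have hxK : φ x ∉ K := by
    intro h
    have := hKr _ h
    rw [hf, hb.injOn.leftInvOn_invFunOn hx] at this
    linarith
  have hφx := hb.mapsTo hx
  have hre : ‖q‖ - ε ≤ (φ x * conj u).re := by
    by_contra! h
    exact hxK ⟨hφx, h⟩
  have hn : ‖φ x‖ < 1 := mem_ball_zero_iff.1 hφx
  -- With `|φ x| < 1` and `Re (φ x · conj u) ≥ |q| - ε > 1 - 2ε` the expansion is at most `2 - 2(1 -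
  -- 2ε) = 4ε`.
  have hexp : ‖φ x - u‖ ^ 2 = ‖φ x‖ ^ 2 + ‖u‖ ^ 2 - 2 * (φ x * conj u).re := by
    simp only [Complex.sq_norm]
    rw [Complex.normSq_sub]
  rw [hexp, hun]
  nlinarith [norm_nonneg (φ x)]

/-- Length-area argument. After straightening the boundary, the weighted Dirichlet integral near `p`
is the area of a subset of the disc, so some small half-circles have short images. Their ends
approach `∂Ω`, so the images come near the unit circle, and each cross-cut confines the values of
`φ` close to `p`. This is the Cauchy criterion at `p`. -/
theorem exists_tendsto_of_hasC1HolderBoundary {β : ℝ≥0} {Ω : Set ℂ} (hΩ : IsOpen Ω)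
    (hB : HasC1HolderBoundary β Ω) {φ : ℂ → ℂ}
    (hd : DifferentiableOn ℂ φ Ω) (hb : BijOn φ Ω (ball 0 1)) {p : ℂ} (hp : p ∈ frontier Ω) :
    ∃ y, Tendsto φ (𝓝[Ω] p) (𝓝 y) := by
  have hpΩ : p ∉ Ω := fun h => by
    rw [hΩ.frontier_eq] at hp
    exact hp.2 h
  obtain ⟨r, c, γ, -, hr, hc, hγ, -, hgraph⟩ := hB p hp
  have hγc : Continuous γ := hγ.continuous
  have hγd : Differentiable ℝ γ := hγ.differentiable one_ne_zero
  set Ψ := graphChart p c γ with hΨ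
  set Θ := graphChartInv p c γ with hΘ
  have hΨΘ : ∀ x, Ψ (Θ x) = x := graphChart_graphChartInv hc γ
  have hΘΨ : ∀ x, Θ (Ψ x) = x := graphChartInv_graphChart hc γ
  have hΨc : Continuous Ψ := continuous_graphChart p c hγc
  have hΘc : Continuous Θ := continuous_graphChartInv p c hγc
  have hcoord : ∀ w, c * (Ψ w - p) = w + γ w.re * Complex.I := fun w => by
    rw [hΨ, graphChart, add_sub_cancel_left, ← mul_assoc, mul_conj_of_norm_eq_one hc, one_mul]
  have hΨmem : ∀ w, Ψ w ∈ ball p r → (Ψ w ∈ Ω ↔ 0 < w.im) := by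
    intro w hw
    rw [hgraph _ hw, hcoord]
    simp
  have hpcl : p ∈ closure Ω := frontier_subset_closure hp
  -- If `γ 0 < 0` then `p` would lie in `Ω`; if `γ 0 > 0` a neighbourhood of `p` would miss `Ω`.
  have hγ0 : γ 0 = 0 := by
    have h1 : 0 ≤ γ 0 := by
      by_contra! h
      refine hpΩ ((hgraph p (mem_ball_self hr)).2 ?_)
      simpa using h
    refine le_antisymm ?_ h1
    by_contra! h
    have h2 : ∀ᶠ x in 𝓝 p, (c * (x - p)).im < γ (c * (x - p)).re := by
      refine ContinuousAt.eventually_lt (by fun_prop) (by fun_prop) (by simpa using h)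
    obtain ⟨x, hx1, hx2⟩ := ((mem_closure_iff_frequently.1 hpcl).and_eventually
      (h2.and (ball_mem_nhds p hr))).exists
    exact ((hgraph x hx2.2).1 hx1).not_gt hx2.1
  have hΨ0 : Ψ 0 = p := by simp [hΨ, graphChart, hγ0]
  have hΘp : Θ p = 0 := by rw [← hΨ0, hΘΨ]
  obtain ⟨a, haΩ, ha⟩ := hb.surjOn (mem_ball_self one_pos)
  have hΘa : 0 < ‖Θ a‖ := by
    rw [norm_pos_iff]
    intro h
    refine hpΩ ?_
    rw [← hΨ0, ← h, hΨΘ]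
    exact haΩ
  obtain ⟨t₁, ht₁, hball⟩ : ∃ t > 0, ∀ w ∈ ball (0 : ℂ) t, Ψ w ∈ ball p r := by
    have h1 : Ψ ⁻¹' ball p r ∈ 𝓝 0 :=
      hΨc.continuousAt.preimage_mem_nhds (by rw [hΨ0]; exact ball_mem_nhds p hr)
    exact Metric.mem_nhds_iff.1 h1
  obtain ⟨L, hL⟩ : ∃ L, ∀ s ∈ Icc (-1 : ℝ) 1, |deriv γ s| ≤ L := by
    obtain ⟨L, hL⟩ := isCompact_Icc.exists_bound_of_continuousOn
      ((hγ.continuous_deriv le_rfl).continuousOn (s := Icc (-1 : ℝ) 1))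
    exact ⟨L, hL⟩
  have hL0 : 0 ≤ L := (abs_nonneg _).trans (hL 0 (by simp))
  -- Small enough to stay in the chart, to use the bound `L` on `γ'` over `[-1, 1]`, and to leave
  -- the preimage `a` of `0` outside every half-circle.
  set t₀ := min t₁ (min 1 ‖Θ a‖) with ht₀
  have ht₀0 : 0 < t₀ := by positivity
  have hΨΩ : ∀ w ∈ {w : ℂ | ‖w‖ < t₀ ∧ 0 < w.im}, Ψ w ∈ Ω := fun w hw =>
    (hΨmem w (hball w (by simpa using hw.1.trans_le (min_le_left _ _)))).2 hw.2
  set A : ℂ → ℝ := fun w => ‖deriv φ (Ψ w)‖ with hA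
  have hGd : ∀ w ∈ {w : ℂ | ‖w‖ < t₀ ∧ 0 < w.im}, HasFDerivAt (φ ∘ Ψ)
      (deriv φ (Ψ w) • graphChartDeriv c γ w) w := fun w hw =>
    hasFDerivAt_comp_graphChart hΩ hd p c hγd (hΨΩ w hw)
  -- The straightening map preserves area, so the Jacobian of `φ ∘ Ψ` is exactly `A²` and the
  -- integral is the area of an injective image inside the unit disc.
  have hfin : ∫⁻ w in {w : ℂ | ‖w‖ < t₀ ∧ 0 < w.im}, ENNReal.ofReal (A w ^ 2) < ⊤ := by
    have hinj : InjOn (φ ∘ Ψ) {w : ℂ | ‖w‖ < t₀ ∧ 0 < w.im} := by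
      intro x hx y hy hxy
      rw [← hΘΨ x, ← hΘΨ y, hb.injOn (hΨΩ x hx) (hΨΩ y hy) hxy]
    have h1 := lintegral_abs_det_fderiv_eq_addHaar_image volume (isOpen_halfDisc t₀).measurableSet
      (fun w hw => (hGd w hw).hasFDerivWithinAt) hinj
    have h2 : ∀ w, |(deriv φ (Ψ w) • graphChartDeriv c γ w).det| = A w ^ 2 := by
      intro w
      have h3 : (deriv φ (Ψ w) • graphChartDeriv c γ w).det = A w ^ 2 * ‖c‖ ^ 2 := by
        rw [det_clm_complex]
        simp only [smul_apply, graphChartDeriv_apply, hA, Complex.sq_norm,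
          Complex.normSq_apply]
        simp
        ring
      rw [h3, hc, one_pow, mul_one, abs_of_nonneg (by positivity)]
    simp_rw [h2] at h1
    rw [h1]
    refine (measure_mono ?_).trans_lt (measure_ball_lt_top (x := (0 : ℂ)) (r := 1))
    rintro _ ⟨w, hw, rfl⟩
    exact hb.mapsTo (hΨΩ w hw)
  have hGC : ContDiffOn ℝ 1 (φ ∘ Ψ) {w : ℂ | ‖w‖ < t₀ ∧ 0 < w.im} := by
    have h1 : ContDiffOn ℝ 1 φ Ω := (hd.contDiffOn hΩ).restrict_scalars ℝ
    refine h1.comp (ContDiff.contDiffOn ?_) hΨΩ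
    have h2 : ContDiff ℝ 1 (fun w : ℂ => ((γ w.re : ℝ) : ℂ)) :=
      Complex.ofRealCLM.contDiff.comp (hγ.comp Complex.reCLM.contDiff)
    exact contDiff_const.add (contDiff_const.mul (contDiff_id.add (h2.mul contDiff_const)))
  have hGb : ∀ w ∈ {w : ℂ | ‖w‖ < t₀ ∧ 0 < w.im}, ∀ v,
      ‖fderiv ℝ (φ ∘ Ψ) w v‖ ≤ (1 + L) * A w * ‖v‖ := by
    intro w hw v
    rw [(hGd w hw).fderiv, smul_apply, norm_smul]
    have h1 : |w.re| ≤ 1 :=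
      (Complex.abs_re_le_norm w).trans (hw.1.le.trans ((min_le_right _ _).trans (min_le_left _ _)))
    have h2 := norm_graphChartDeriv_apply_le hc (γ := γ) (w := w) (hL _ (abs_le.1 h1)) v
    calc ‖deriv φ (Ψ w)‖ * ‖graphChartDeriv c γ w v‖ ≤ A w * ((1 + L) * ‖v‖) := by gcongr
      _ = (1 + L) * A w * ‖v‖ := by ring
  have hAm : Measurable A := ((measurable_deriv φ).comp hΨc.measurable).norm
  have hosc : ∀ ε > 0, ε < 1 / 2 → ∃ u, ∀ᶠ x in 𝓝[Ω] p, ‖φ x - u‖ ^ 2 ≤ 4 * ε := by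
    intro ε hε hε2
    obtain ⟨s, hs, hsarc⟩ := exists_arc_oscillation_le hAm (fun w => norm_nonneg _) ht₀0
      (by linarith : 0 < 1 + L) hfin hGC hGb hε
    have hst1 : s < t₁ := hs.2.trans_le (min_le_left _ _)
    have hsball : ∀ w : ℂ, ‖w‖ = s → Ψ w ∈ ball p r := fun w hw => hball w (by simpa [hw])
    -- an endpoint of the half-circle is a boundary point of `Ω`
    have hend : Ψ s ∉ Ω := by
      rw [hΨmem _ (hsball s (by simp [abs_of_pos hs.1]))]
      simp
    have hpos : ∀ᶠ θ in 𝓝[>] (0 : ℝ), θ ∈ Ioo 0 Real.pi :=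
      Ioo_mem_nhdsGT Real.pi_pos
    have htend : Tendsto (fun θ => Ψ (circleMap 0 s θ)) (𝓝[>] (0 : ℝ)) (𝓝[Ω] (Ψ s)) := by
      refine tendsto_nhdsWithin_iff.2 ⟨?_, ?_⟩
      · have h1 : Continuous (fun θ => Ψ (circleMap 0 s θ)) := hΨc.comp (continuous_circleMap 0 s)
        exact (by simpa [circleMap] using h1.tendsto 0 : Tendsto _ _ _).mono_left nhdsWithin_le_nhds
      · filter_upwards [hpos] with θ hθ
        exact hΨΩ _ (circleMap_mem_halfDisc hs hθ)
    obtain ⟨θ, hθ1, hθ2⟩ := (hpos.and (((tendsto_norm_one_of_bijOn hΩ hd hb hend).comp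
      htend).eventually_const_lt (by linarith : 1 - ε < 1))).exists
    set w₁ := circleMap 0 s θ with hw₁
    have hw₁n : ‖w₁‖ = s := by simp [hw₁, abs_of_pos hs.1]
    have hw₁i : 0 < w₁.im := (circleMap_mem_halfDisc hs hθ1).2
    refine ⟨φ (Ψ w₁) / ‖φ (Ψ w₁)‖, ?_⟩
    have hnear : ∀ᶠ x in 𝓝[Ω] p, ‖Θ x‖ < s := by
      refine nhdsWithin_le_nhds ?_
      refine (hΘc.norm.tendsto p).eventually_lt_const ?_
      simpa [hΘp] using hs.1
    filter_upwards [hnear, self_mem_nhdsWithin] with x hx hxΩ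
    refine norm_sub_sq_le_of_crosscut hΩ hd hb (N := fun x => ‖Θ x‖) (r := s) hΘc.norm hε2 hθ2
      ?_ ?_ hxΩ hx
    · intro y hy hyr
      have h1 : 0 < (Θ y).im := by
        rw [← hΨmem _ (hsball _ hyr), hΨΘ]
        exact hy
      have h2 := hsarc w₁ (Θ y) hw₁n hyr hw₁i h1
      simpa [hΨΘ] using h2
    · intro y hy hy0
      obtain rfl : y = a := hb.injOn hy haΩ (by rw [hy0, ha])
      exact hs.2.trans_le ((min_le_right _ _).trans (min_le_right _ _))
  have hne : (𝓝[Ω] p).NeBot := mem_closure_iff_nhdsWithin_neBot.1 hpcl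
  refine cauchy_map_iff_exists_tendsto.1 (Metric.cauchy_iff.2 ⟨inferInstance, fun η hη => ?_⟩)
  -- Then `4ε ≤ (η / 4)²`, so the values lie within `η / 4` of `u`; the second bound keeps `ε` below
  -- `1 / 2`.
  set ε := min (η ^ 2 / 64) (1 / 4) with hε
  obtain ⟨u, hu⟩ := hosc ε (by positivity) (by
    have : ε ≤ 1 / 4 := min_le_right _ _
    linarith)
  refine ⟨φ '' {x | ‖φ x - u‖ ^ 2 ≤ 4 * ε}, image_mem_map hu, ?_⟩
  rintro _ ⟨x, hx, rfl⟩ _ ⟨y, hy, rfl⟩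
  have hkey : ∀ z, ‖φ z - u‖ ^ 2 ≤ 4 * ε → ‖φ z - u‖ ≤ η / 4 := by
    intro z hz
    have h1 : ε ≤ η ^ 2 / 64 := min_le_left _ _
    refine abs_le_of_sq_le_sq' ?_ (by positivity) |>.2
    nlinarith
  have h1 := hkey x hx
  have h2 := hkey y hy
  have h3 := dist_triangle_right (φ x) (φ y) u
  rw [dist_eq_norm (φ x) u, dist_eq_norm (φ y) u] at h3
  linarith

/-- A conformal map of a `C^{1,β}` domain onto the disc extends continuously to the boundary, with
values of modulus one there. -/
theorem exists_continuousOn_closure_extension {β : ℝ≥0} {Ω : Set ℂ} (hΩ : IsOpen Ω)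
    (hB : HasC1HolderBoundary β Ω) {φ : ℂ → ℂ}
    (hd : DifferentiableOn ℂ φ Ω) (hb : BijOn φ Ω (ball 0 1)) :
    ∃ φb : ℂ → ℂ, EqOn φb φ Ω ∧ ContinuousOn φb (closure Ω) ∧ ∀ p ∈ frontier Ω, ‖φb p‖ = 1 := by
  have hlim : ∀ p ∈ closure Ω, ∃ y, Tendsto φ (𝓝[Ω] p) (𝓝 y) := by
    intro p hp
    by_cases hpΩ : p ∈ Ω
    · exact ⟨φ p, (hd.continuousOn p hpΩ)⟩
    · exact exists_tendsto_of_hasC1HolderBoundary hΩ hB hd hb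
        (by rw [hΩ.frontier_eq]; exact ⟨hp, hpΩ⟩)
  refine ⟨extendFrom Ω φ, fun x hx => ?_, continuousOn_extendFrom subset_rfl hlim, fun p hp => ?_⟩
  · exact extendFrom_eq (subset_closure hx) (hd.continuousOn x hx)
  · have hpcl : p ∈ closure Ω := frontier_subset_closure hp
    have hne : (𝓝[Ω] p).NeBot := mem_closure_iff_nhdsWithin_neBot.1 hpcl
    rw [hΩ.frontier_eq] at hp
    exact tendsto_nhds_unique (tendsto_extendFrom (hlim p hpcl)).norm
      (tendsto_norm_one_of_bijOn hΩ hd hb hp.2)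

/-! ### The arclength measure -/

/-- A boundary point is neither above the graph (`Ω` is open) nor below it (it is a limit of points
of `Ω`), so the boundary piece lies in a Lipschitz image of a compact interval. -/
theorem hausdorffMeasure_frontier_inter_lt_top {Ω : Set ℂ} (hΩ : IsOpen Ω) {p c : ℂ} {r : ℝ}
    (hc : ‖c‖ = 1) {γ : ℝ → ℝ} (hγ : ContDiff ℝ 1 γ)
    (hgraph : ∀ x ∈ ball p r, x ∈ Ω ↔ γ (c * (x - p)).re < (c * (x - p)).im) :
    Measure.hausdorffMeasure 1 (frontier Ω ∩ ball p r) < ⊤ := by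
  set σ : ℝ → ℂ := fun s => graphChart p c γ s with hσ
  have hsub : frontier Ω ∩ ball p r ⊆ σ '' Icc (-r) r := by
    rintro x ⟨hx, hxb⟩
    rw [hΩ.frontier_eq] at hx
    have hle : (c * (x - p)).im ≤ γ (c * (x - p)).re := by
      by_contra! h
      exact hx.2 ((hgraph x hxb).2 h)
    have hge : γ (c * (x - p)).re ≤ (c * (x - p)).im := by
      by_contra! h
      have hγc := hγ.continuous
      have h2 : ∀ᶠ y in 𝓝 x, (c * (y - p)).im < γ (c * (y - p)).re :=
        ContinuousAt.eventually_lt (by fun_prop) (by fun_prop) h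
      obtain ⟨y, hy1, hy2⟩ := ((mem_closure_iff_frequently.1 hx.1).and_eventually
        (h2.and (isOpen_ball.mem_nhds hxb))).exists
      exact ((hgraph y hy2.2).1 hy1).not_gt hy2.1
    refine ⟨(c * (x - p)).re, ?_, ?_⟩
    · rw [mem_Icc, ← abs_le]
      refine (Complex.abs_re_le_norm _).trans ?_
      rw [norm_mul, hc, one_mul, ← dist_eq_norm]
      exact (mem_ball.1 hxb).le
    · have h : graphChartInv p c γ x = ((c * (x - p)).re : ℂ) := by
        have h' := le_antisymm hle hge
        rw [graphChartInv, ← h', sub_eq_iff_eq_add]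
        exact (Complex.re_add_im _).symm
      change graphChart p c γ ((c * (x - p)).re : ℂ) = x
      rw [← h, graphChart_graphChartInv hc]
  have hσd : ContDiff ℝ 1 σ := by
    have h2 : ContDiff ℝ 1 (fun s : ℝ => (γ s : ℂ)) := Complex.ofRealCLM.contDiff.comp hγ
    have h3 : ContDiff ℝ 1 (fun s : ℝ => (s : ℂ)) := Complex.ofRealCLM.contDiff
    have h4 : σ = fun s : ℝ => p + conj c * ((s : ℂ) + (γ s : ℂ) * Complex.I) := by
      ext s
      simp [hσ, graphChart]
    rw [h4]
    exact contDiff_const.add (contDiff_const.mul (h3.add (h2.mul contDiff_const)))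
  obtain ⟨K, hK⟩ := hσd.contDiffOn.exists_lipschitzOnWith one_ne_zero (convex_Icc (-r) r) isCompact_Icc
  refine (measure_mono hsub).trans_lt ((hK.hausdorffMeasure_image_le zero_le_one).trans_lt ?_)
  rw [hausdorffMeasure_real]
  exact ENNReal.mul_lt_top (by simp) (by simp [Real.volume_Icc])

theorem isFiniteMeasure_arclength {β : ℝ≥0} {Ω : Set ℂ} (hΩ : IsC1HolderDomain β Ω) :
    IsFiniteMeasure (arclength Ω) := by
  refine ⟨?_⟩
  rw [arclength, Measure.restrict_apply_univ]
  have hcpt : IsCompact (frontier Ω) :=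
    hΩ.isBounded.isCompact_closure.of_isClosed_subset isClosed_frontier frontier_subset_closure
  refine hcpt.measure_lt_top_of_nhdsWithin fun p hp => ?_
  obtain ⟨r, c, γ, -, hr, hc, hγ, -, hgraph⟩ := hΩ.boundary p hp
  exact ⟨frontier Ω ∩ ball p r, inter_mem_nhdsWithin _ (ball_mem_nhds p hr),
    hausdorffMeasure_frontier_inter_lt_top hΩ.isOpen hc hγ hgraph⟩

/-! ### Gradients and the fundamental solution of the Laplacian -/

theorem inner_eq_re_conj_mul (u v : ℂ) : inner ℝ u v = (conj u * v).re := by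
  rw [Complex.inner, mul_comm]

/-- The gradient of `log |F|`, for `F` holomorphic. -/
theorem hasGradientAt_log_norm {F : ℂ → ℂ} {F' w : ℂ} (hF : HasDerivAt F F' w) (h0 : F w ≠ 0) :
    HasGradientAt (fun z => Real.log ‖F z‖) (conj (F' / F w)) w := by
  rw [hasGradientAt_iff_hasFDerivAt]
  -- Dividing by `F w` puts the value at `1`, inside the domain of the principal logarithm, and
  -- changes the real part only by a constant.
  have h1 : HasDerivAt (fun z => Complex.log (F z / F w)) (F' / F w) w := by
    have h2 : F w / F w ∈ Complex.slitPlane := by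
      rw [div_self h0]
      exact Complex.one_mem_slitPlane
    have h3 := (hF.div_const (F w)).clog h2
    rwa [div_self h0, div_one] at h3
  have h4 := Complex.reCLM.hasFDerivAt.comp w (h1.hasFDerivAt.restrictScalars ℝ)
  have h5 : (fun z => Real.log ‖F z‖) =ᶠ[𝓝 w]
      fun z => (Complex.reCLM ∘ fun z => Complex.log (F z / F w)) z + Real.log ‖F w‖ := by
    filter_upwards [hF.continuousAt.eventually_ne h0] with z hz
    simp only [Function.comp_apply, Complex.reCLM_apply, Complex.log_re, norm_div]
    rw [Real.log_div (norm_ne_zero_iff.2 hz) (norm_ne_zero_iff.2 h0)]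
    ring
  refine HasFDerivAt.congr_of_eventuallyEq ?_ h5
  convert! h4.add_const (Real.log ‖F w‖) using 1
  ext v
  simp

theorem measurable_gradient (ψ : ℂ → ℝ) : Measurable (gradient ψ) :=
  (toDual ℝ ℂ).symm.continuous.measurable.comp (measurable_fderiv ℝ ψ)

theorem continuousOn_gradient {ψ : ℂ → ℝ} {Ω : Set ℂ} (hΩ : IsOpen Ω) (hψ : ContDiffOn ℝ 1 ψ Ω) :
    ContinuousOn (gradient ψ) Ω :=
  (toDual ℝ ℂ).symm.continuous.comp_continuousOn (hψ.continuousOn_fderiv_of_isOpen hΩ le_rfl)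

/-- `1/|x|` is locally integrable in the plane. -/
theorem integrableOn_norm_inv_ball (b : ℂ) (r : ℝ) :
    IntegrableOn (fun w : ℂ => ‖w - b‖⁻¹) (ball b r) := by
  have h0 : IntegrableOn (fun w : ℂ => ‖w‖⁻¹) (ball 0 r) := by
    rw [integrableOn_fun_norm_addHaar volume (f := fun y : ℝ => y⁻¹)]
    refine (integrableOn_const (C := (1 : ℝ)) (by simp)).congr_fun (fun y hy => ?_)
      measurableSet_Ioo
    have := hy.1.ne'
    simp [this]
  have h1 : (fun w : ℂ => w - b) ⁻¹' ball 0 r = ball b r := by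
    ext w
    simp [dist_eq_norm]
  have h2 := (measurePreserving_sub_right (volume : Measure ℂ) b).integrableOn_comp_preimage
    (f := fun w : ℂ => ‖w‖⁻¹) (s := ball 0 r) (measurableEmbedding_subRight b)
  rw [h1] at h2
  exact h2.2 h0

/-- The field `∇ log |· - b|` paired with an `L²` gradient is integrable. -/
theorem integrableOn_inner_inv_gradient {Ω : Set ℂ} (hΩ : IsOpen Ω) (hbd : Bornology.IsBounded Ω)
    {ψ : ℂ → ℝ} (hψ : ContDiffOn ℝ 1 ψ Ω)
    (hint : IntegrableOn (fun x => ‖gradient ψ x‖ ^ 2) Ω) {b : ℂ} (hb : b ∉ frontier Ω) :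
    IntegrableOn (fun w => inner ℝ (conj ((w - b)⁻¹)) (gradient ψ w)) Ω := by
  have hfin : volume Ω < ⊤ := hbd.measure_lt_top
  have hmeas : Measurable (fun w => inner ℝ (conj ((w - b)⁻¹)) (gradient ψ w)) := by
    have := measurable_gradient ψ
    have h2 : Measurable fun w : ℂ => conj ((w - b)⁻¹) :=
      Complex.continuous_conj.measurable.comp ((measurable_id.sub_const b).inv)
    exact h2.inner this
  have hle : ∀ w, ‖inner ℝ (conj ((w - b)⁻¹)) (gradient ψ w)‖ ≤ ‖w - b‖⁻¹ * ‖gradient ψ w‖ := by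
    intro w
    refine (norm_inner_le_norm _ _).trans_eq ?_
    rw [Complex.norm_conj, norm_inv]
  have hgrad : IntegrableOn (fun x => ‖gradient ψ x‖) Ω := by
    have h1 : IntegrableOn (fun x => 1 + ‖gradient ψ x‖ ^ 2) Ω :=
      (integrableOn_const (hs := hfin.ne)).add hint
    refine h1.mono' (measurable_gradient ψ).norm.aestronglyMeasurable
      (Eventually.of_forall fun x => ?_)
    rw [norm_norm]
    nlinarith [sq_nonneg (‖gradient ψ x‖ - 1)]
  -- As `b` is off the boundary, either `∇ψ` is bounded near `b`, and local integrability of `1/|x|`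
  -- suffices, or `Ω` stays away from `b`. Elsewhere the field is at most `1/ρ`.
  obtain ⟨ρ, hρ, hρb⟩ : ∃ ρ > 0, closedBall b ρ ⊆ Ω ∨ Disjoint (ball b ρ) Ω := by
    by_cases hbΩ : b ∈ Ω
    · obtain ⟨ρ, hρ, h⟩ := nhds_basis_closedBall.mem_iff.1 (hΩ.mem_nhds hbΩ)
      exact ⟨ρ, hρ, Or.inl h⟩
    · have : b ∉ closure Ω := fun h => hb (by rw [hΩ.frontier_eq]; exact ⟨h, hbΩ⟩)
      obtain ⟨ρ, hρ, h⟩ := Metric.isOpen_iff.1 isClosed_closure.isOpen_compl b this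
      exact ⟨ρ, hρ, Or.inr (disjoint_left.2 fun x hx hxΩ => h hx (subset_closure hxΩ))⟩
  have hfar : IntegrableOn (fun w => inner ℝ (conj ((w - b)⁻¹)) (gradient ψ w)) (Ω \ ball b ρ) := by
    refine ((hgrad.mono_set sdiff_subset).const_mul ρ⁻¹).mono' hmeas.aestronglyMeasurable ?_
    filter_upwards [self_mem_ae_restrict (hΩ.measurableSet.diff measurableSet_ball)] with w hw
    refine (hle w).trans ?_
    have h1 : ρ ≤ ‖w - b‖ := by
      have := hw.2
      rwa [mem_ball, dist_eq_norm, not_lt] at this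
    gcongr
  rcases hρb with h | h
  · obtain ⟨C, hC⟩ := (isCompact_closedBall b ρ).exists_bound_of_continuousOn
      ((continuousOn_gradient hΩ hψ).mono h)
    have hnear : IntegrableOn (fun w => inner ℝ (conj ((w - b)⁻¹)) (gradient ψ w)) (ball b ρ) := by
      refine ((integrableOn_norm_inv_ball b ρ).mul_const C).mono' hmeas.aestronglyMeasurable ?_
      filter_upwards [self_mem_ae_restrict measurableSet_ball] with w hw
      refine (hle w).trans ?_
      have := hC w (ball_subset_closedBall hw)
      gcongr
    refine (hnear.union hfar).mono_set fun x hx => ?_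
    by_cases hxb : x ∈ ball b ρ
    · exact Or.inl hxb
    · exact Or.inr ⟨hx, hxb⟩
  · rwa [sdiff_eq_left.2 h.symm] at hfar

/-- `Δ log |· - b| = 2π δ_b` in the sense of distributions. -/
theorem integral_inner_inv_gradient {ψ : ℂ → ℝ} (hψ : ContDiff ℝ 1 ψ) (hs : HasCompactSupport ψ)
    (b : ℂ) :
    ∫ w, inner ℝ (conj ((w - b)⁻¹)) (gradient ψ w) = -(2 * Real.pi * ψ b) := by
  wlog hb : b = 0 generalizing ψ b
  · have h1 := this (ψ := fun w => ψ (w + b)) (hψ.comp (contDiff_id.add contDiff_const))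
      (hs.comp_homeomorph (Homeomorph.addRight b)) 0 rfl
    rw [zero_add] at h1
    rw [← h1, ← integral_add_right_eq_self _ b]
    congr 1
    ext w
    have h2 : gradient (fun w => ψ (w + b)) w = gradient ψ (w + b) := by
      rw [gradient, gradient, fderiv_comp_add_right]
    rw [h2]
    simp
  subst hb
  have hd : ∀ x, HasFDerivAt ψ (fderiv ℝ ψ x) x := fun x =>
    (hψ.differentiable one_ne_zero x).hasFDerivAt
  have hcd : Continuous (fderiv ℝ ψ) := hψ.continuous_fderiv one_ne_zero
  set e : ℝ → ℂ := fun θ => Complex.exp (θ * Complex.I) with he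
  have hec : Continuous e := by fun_prop
  have hen : ∀ θ, ‖e θ‖ = 1 := fun θ => Complex.norm_exp_ofReal_mul_I θ
  have hpol : ∀ q : ℝ × ℝ, Complex.polarCoord.symm q = q.1 * e q.2 := by
    rintro ⟨r, θ⟩
    rw [polarCoord_symm_eq_circleMap, circleMap, zero_add]
  set G : ℝ × ℝ → ℝ := fun q => fderiv ℝ ψ (q.1 * e q.2) (e q.2) with hG
  have hGc : Continuous G := by
    refine (hcd.comp ?_).clm_apply (hec.comp continuous_snd)
    exact (Complex.continuous_ofReal.comp continuous_fst).mul (hec.comp continuous_snd)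
  rw [← Complex.integral_comp_polarCoord_symm]
  -- The polar Jacobian cancels the singularity and leaves the radial derivative of `ψ`, which
  -- integrates to `-ψ 0` along each ray.
  have hstep : ∫ q in polarCoord.target, q.1 • inner ℝ (conj ((Complex.polarCoord.symm q - 0)⁻¹))
      (gradient ψ (Complex.polarCoord.symm q)) = ∫ q in Ioi 0 ×ˢ Ioo (-Real.pi) Real.pi, G q := by
    refine setIntegral_congr_fun (measurableSet_Ioi.prod measurableSet_Ioo) ?_
    rintro ⟨r, θ⟩ ⟨hr, -⟩
    have hr : 0 < r := hr
    have hrc : (r : ℂ) ≠ 0 := by exact_mod_cast hr.ne'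
    simp only [hpol, sub_zero, hG]
    rw [real_inner_comm, inner_gradient_left, smul_eq_mul, ← smul_eq_mul, ← map_smul]
    congr 1
    have h1 : e θ * conj (e θ) = 1 := mul_conj_of_norm_eq_one (hen θ)
    have h2 : e θ ≠ 0 := norm_ne_zero_iff.1 (by rw [hen]; exact one_ne_zero)
    have h3 : conj (e θ) ≠ 0 := by simpa using h2
    rw [map_inv₀, map_mul, Complex.conj_ofReal, Complex.real_smul]
    field_simp
    rw [mul_comm, h1]
  rw [hstep]
  obtain ⟨R, hR⟩ : ∃ R, tsupport ψ ⊆ closedBall 0 R := hs.isCompact.isBounded.subset_closedBall 0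
  have hG0 : ∀ q : ℝ × ℝ, R < q.1 → G q = 0 := by
    intro q hq
    have : (q.1 * e q.2 : ℂ) ∉ tsupport ψ := by
      intro h
      have h1 := hR h
      rw [mem_closedBall_zero_iff, norm_mul, hen, mul_one, Complex.norm_real] at h1
      exact absurd (le_abs_self q.1) (by rw [← Real.norm_eq_abs]; linarith)
    have h2 : fderiv ℝ ψ (q.1 * e q.2) = 0 := by
      by_contra h
      exact this (support_fderiv_subset ℝ h)
    simp [hG, h2]
  have hGi : IntegrableOn G (Ioi 0 ×ˢ Ioo (-Real.pi) Real.pi) := by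
    have h1 : IntegrableOn G (Icc 0 R ×ˢ Icc (-Real.pi) Real.pi) :=
      hGc.continuousOn.integrableOn_compact (isCompact_Icc.prod isCompact_Icc)
    refine h1.of_forall_sdiff_eq_zero (measurableSet_Ioi.prod measurableSet_Ioo) ?_
    rintro ⟨r, θ⟩ ⟨⟨hr, hθ⟩, hn⟩
    refine hG0 _ ?_
    by_contra! hle
    exact hn ⟨⟨(show (0 : ℝ) < r from hr).le, hle⟩, Ioo_subset_Icc_self hθ⟩
  rw [Measure.volume_eq_prod] at hGi ⊢
  rw [← Measure.prod_restrict, integral_prod_symm _ (by rwa [Measure.prod_restrict])]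
  have hin : ∀ θ : ℝ, ∫ r in Ioi 0, G (r, θ) = -ψ 0 := by
    intro θ
    have h1 : ContDiff ℝ 1 (fun r : ℝ => ψ (r * e θ)) :=
      hψ.comp (Complex.ofRealCLM.contDiff.mul contDiff_const)
    have h2 : HasCompactSupport (fun r : ℝ => ψ (r * e θ)) := by
      refine HasCompactSupport.intro (isCompact_Icc (a := -R) (b := R)) fun r hr => ?_
      by_contra h
      have h3 := hR (subset_tsupport _ h)
      rw [mem_closedBall_zero_iff, norm_mul, hen, mul_one, Complex.norm_real, Real.norm_eq_abs,
        abs_le] at h3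
      exact hr h3
    have h4 := h2.integral_Ioi_deriv_eq h1 0
    simp only [Complex.ofReal_zero, zero_mul] at h4
    rw [← h4]
    congr 1
    ext r
    have h5 : HasDerivAt (fun r : ℝ => (r : ℂ) * e θ) (e θ) r := by
      simpa using (Complex.ofRealCLM.hasDerivAt (x := r)).mul_const (e θ)
    exact ((hd _).comp_hasDerivAt r h5).deriv.symm
  simp only [hin, integral_const, measureReal_restrict_apply_univ, Real.volume_real_Ioo]
  rw [max_eq_left (by linarith [Real.pi_pos]), smul_eq_mul]
  ring

/-! ### Green's formula on the disc -/

/-- The complex derivative of `log (w - α) + log (1 - ᾱ w) - log w`. -/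
noncomputable def poleField (α w : ℂ) : ℂ :=
  (w - α)⁻¹ - conj α * (1 - conj α * w)⁻¹ - w⁻¹

/-- This term of `poleField` is, up to sign, the logarithmic field with pole at the reflected point
`1 / conj α`, which lies outside the closed disc. -/
theorem conj_mul_inv_eq {α : ℂ} (hα : α ≠ 0) (w : ℂ) :
    conj α * (1 - conj α * w)⁻¹ = -(w - (conj α)⁻¹)⁻¹ := by
  have h : conj α ≠ 0 := by simpa using hα
  have h1 : 1 - conj α * w = -(conj α * (w - (conj α)⁻¹)) := by
    rw [mul_sub, mul_inv_cancel₀ h]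
    ring
  rw [h1, inv_neg, mul_inv, mul_neg, mul_inv_cancel_left₀ h]

theorem inv_conj_notMem_frontier {α : ℂ} (hα : ‖α‖ < 1) :
    (conj α)⁻¹ ∉ frontier (ball (0 : ℂ) 1) := by
  rw [frontier_ball _ one_ne_zero, mem_sphere_zero_iff_norm, norm_inv, Complex.norm_conj]
  intro h
  rw [inv_eq_one] at h
  exact hα.ne h

theorem notMem_frontier_ball {α : ℂ} (hα : ‖α‖ < 1) : α ∉ frontier (ball (0 : ℂ) 1) := by
  rw [frontier_ball _ one_ne_zero, mem_sphere_zero_iff_norm]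
  exact hα.ne

theorem inner_poleField (α w v : ℂ) :
    inner ℝ (conj (poleField α w)) v = inner ℝ (conj ((w - α)⁻¹)) v
      - inner ℝ (conj (conj α * (1 - conj α * w)⁻¹)) v - inner ℝ (conj ((w - 0)⁻¹)) v := by
  rw [poleField, map_sub, map_sub, inner_sub_left, inner_sub_left, sub_zero]

theorem integrableOn_inner_conj_mul_inv {α : ℂ} (hα : ‖α‖ < 1) {η : ℂ → ℝ}
    (hη : ContDiffOn ℝ 1 η (ball 0 1))
    (hint : IntegrableOn (fun x => ‖gradient η x‖ ^ 2) (ball 0 1)) :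
    IntegrableOn (fun w => inner ℝ (conj (conj α * (1 - conj α * w)⁻¹)) (gradient η w))
      (ball 0 1) := by
  rcases eq_or_ne α 0 with rfl | h0
  · simp
  · have := (integrableOn_inner_inv_gradient isOpen_ball isBounded_ball hη hint
      (inv_conj_notMem_frontier hα)).neg
    refine this.congr_fun (fun w _ => ?_) measurableSet_ball
    simp [conj_mul_inv_eq h0]

theorem integrableOn_inner_poleField {α : ℂ} (hα : ‖α‖ < 1) {η : ℂ → ℝ}
    (hη : ContDiffOn ℝ 1 η (ball 0 1))
    (hint : IntegrableOn (fun x => ‖gradient η x‖ ^ 2) (ball 0 1)) :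
    IntegrableOn (fun w => inner ℝ (conj (poleField α w)) (gradient η w)) (ball 0 1) := by
  simp only [inner_poleField]
  exact ((integrableOn_inner_inv_gradient isOpen_ball isBounded_ball hη hint
    (notMem_frontier_ball hα)).sub (integrableOn_inner_conj_mul_inv hα hη hint)).sub
    (integrableOn_inner_inv_gradient isOpen_ball isBounded_ball hη hint
    (notMem_frontier_ball (by simp)))

theorem setIntegral_inner_inv_gradient {ψ : ℂ → ℝ} (hψ : ContDiff ℝ 1 ψ)
    (hs : tsupport ψ ⊆ ball 0 1) (b : ℂ) :
    ∫ w in ball 0 1, inner ℝ (conj ((w - b)⁻¹)) (gradient ψ w) = -(2 * Real.pi * ψ b) := by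
  have hcs : HasCompactSupport ψ :=
    (isCompact_closedBall (0 : ℂ) 1).of_isClosed_subset (isClosed_tsupport ψ)
      (hs.trans ball_subset_closedBall)
  rw [← integral_inner_inv_gradient hψ hcs b]
  refine setIntegral_eq_integral_of_forall_compl_eq_zero fun x hx => ?_
  have : fderiv ℝ ψ x = 0 := by
    by_contra h
    exact hx (hs (support_fderiv_subset ℝ h))
  simp [gradient, this]

/-- Only the poles `α` and `0` lie in the disc; at the reflected pole `ψ` vanishes. -/
theorem setIntegral_inner_poleField_of_tsupport_subset {α : ℂ} (hα : ‖α‖ < 1) {ψ : ℂ → ℝ}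
    (hψ : ContDiff ℝ 1 ψ) (hs : tsupport ψ ⊆ ball 0 1) :
    ∫ w in ball 0 1, inner ℝ (conj (poleField α w)) (gradient ψ w)
      = 2 * Real.pi * (ψ 0 - ψ α) := by
  have hint : IntegrableOn (fun x => ‖gradient ψ x‖ ^ 2) (ball 0 1) := by
    have h1 : Continuous (fun x => ‖gradient ψ x‖ ^ 2) :=
      ((continuousOn_univ.1 (continuousOn_gradient isOpen_univ hψ.contDiffOn)).norm).pow 2
    exact (h1.continuousOn.integrableOn_compact (isCompact_closedBall 0 1)).mono_set
      ball_subset_closedBall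
  have h1 := integrableOn_inner_inv_gradient isOpen_ball isBounded_ball hψ.contDiffOn hint
    (notMem_frontier_ball hα)
  have h2 := integrableOn_inner_conj_mul_inv hα hψ.contDiffOn hint
  have h3 := integrableOn_inner_inv_gradient isOpen_ball isBounded_ball hψ.contDiffOn hint
    (notMem_frontier_ball (α := 0) (by simp))
  have h4 : ∫ w in ball 0 1, inner ℝ (conj (conj α * (1 - conj α * w)⁻¹)) (gradient ψ w) = 0 := by
    rcases eq_or_ne α 0 with rfl | h0
    · simp
    · have h5 := setIntegral_inner_inv_gradient hψ hs ((conj α)⁻¹)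
      have h6 : ψ ((conj α)⁻¹) = 0 := by
        by_contra h
        have := hs (subset_tsupport ψ h)
        rw [mem_ball_zero_iff, norm_inv, Complex.norm_conj, inv_lt_one₀ (norm_pos_iff.2 h0)] at this
        exact this.not_gt hα
      simp only [conj_mul_inv_eq h0, map_neg, inner_neg_left, integral_neg, h5, h6]
      simp
  simp only [inner_poleField]
  rw [integral_sub (by exact h1.sub h2) h3, integral_sub h1 h2, h4, setIntegral_inner_inv_gradient hψ hs,
    setIntegral_inner_inv_gradient hψ hs]
  ring

/-- The field `∇ (log |· - α| + log |1 - ᾱ ·| - log |·|)` is tangential on the unit circle. -/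
theorem abs_re_mul_poleField_le {α w : ℂ} (hα : ‖α‖ < 1) (hw : ‖w‖ < 1)
    (hw2 : (1 + ‖α‖) / 2 ≤ ‖w‖) :
    |(w * poleField α w).re| ≤ 2 / (1 - ‖α‖) ^ 2 * (1 - ‖w‖ ^ 2) := by
  have hα0 := norm_nonneg α
  have hw0 : w ≠ 0 := norm_pos_iff.1 (by linarith)
  have hwα : (1 - ‖α‖) / 2 ≤ ‖w - α‖ := by
    have := norm_sub_norm_le w α
    linarith
  have hwα0 : w - α ≠ 0 := norm_pos_iff.1 (by linarith)
  have h1 : 1 - conj α * w ≠ 0 := one_sub_conj_mul_ne_zero hα hw.le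
  have h2 : 1 - α * conj w ≠ 0 := by
    intro h
    apply h1
    have := congrArg conj h
    simpa using this
  -- Only the real part of `w · poleField α w` matters, so this term may be conjugated. The two
  -- terms then combine with the factor `1 - w · conj w`, and the lower bounds `(1 - |α|)/2` and `1
  -- - |α|` on the denominators give the constant.
  have h3 : (conj α * w * (1 - conj α * w)⁻¹).re = (α * conj w * (1 - α * conj w)⁻¹).re := by
    rw [← Complex.conj_re]
    simp
  have h4 : (w * poleField α w).re
      = (α * (1 - w * conj w) * ((w - α)⁻¹ * (1 - α * conj w)⁻¹)).re := by
    have h5 : w * poleField α w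
        = α * (w - α)⁻¹ - conj α * w * (1 - conj α * w)⁻¹ := by
      rw [poleField]
      field_simp
      ring
    rw [h5, Complex.sub_re, h3, ← Complex.sub_re]
    congr 1
    field_simp
    ring
  rw [h4]
  refine (Complex.abs_re_le_norm _).trans ?_
  have h5 : ‖1 - w * conj w‖ = 1 - ‖w‖ ^ 2 := by
    have : (1 : ℂ) - w * conj w = ((1 - ‖w‖ ^ 2 : ℝ) : ℂ) := by
      rw [Complex.mul_conj']
      push_cast
      rfl
    rw [this, Complex.norm_real, Real.norm_of_nonneg]
    nlinarith [norm_nonneg w]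
  have h6 : 1 - ‖α‖ ≤ ‖1 - α * conj w‖ := by
    have h7 := norm_sub_norm_le (1 : ℂ) (α * conj w)
    rw [norm_one, norm_mul, Complex.norm_conj] at h7
    nlinarith
  have h7 : 0 ≤ 1 - ‖w‖ ^ 2 := by nlinarith [norm_nonneg w]
  have h8 : 0 < 1 - ‖α‖ := by linarith
  rw [norm_mul, norm_mul, norm_mul, norm_inv, norm_inv, h5]
  calc ‖α‖ * (1 - ‖w‖ ^ 2) * (‖w - α‖⁻¹ * ‖1 - α * conj w‖⁻¹)
      ≤ 1 * (1 - ‖w‖ ^ 2) * (((1 - ‖α‖) / 2)⁻¹ * (1 - ‖α‖)⁻¹) := by gcongr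
    _ = 2 / (1 - ‖α‖) ^ 2 * (1 - ‖w‖ ^ 2) := by field_simp

theorem deriv_smoothTransition_eq_zero {x : ℝ} (hx : x < 0 ∨ 1 < x) :
    deriv Real.smoothTransition x = 0 := by
  rcases hx with hx | hx
  · have : Real.smoothTransition =ᶠ[𝓝 x] fun _ => 0 := by
      filter_upwards [Iio_mem_nhds hx] with y hy
      exact Real.smoothTransition.zero_of_nonpos (mem_Iio.1 hy).le
    rw [this.deriv_eq, deriv_const]
  · have : Real.smoothTransition =ᶠ[𝓝 x] fun _ => 1 := by
      filter_upwards [Ioi_mem_nhds hx] with y hy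
      exact Real.smoothTransition.one_of_one_le (mem_Ioi.1 hy).le
    rw [this.deriv_eq, deriv_const]

theorem exists_abs_deriv_smoothTransition_le :
    ∃ B, 0 ≤ B ∧ ∀ x, |deriv Real.smoothTransition x| ≤ B := by
  have hc : Continuous (deriv Real.smoothTransition) :=
    (Real.smoothTransition.contDiff (n := 1)).continuous_deriv le_rfl
  obtain ⟨B, hB⟩ := isCompact_Icc.exists_bound_of_continuousOn (hc.continuousOn (s := Icc (0 : ℝ) 1))
  have hB0 : 0 ≤ B := (norm_nonneg _).trans (hB 0 (by simp))
  refine ⟨B, hB0, fun x => ?_⟩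
  by_cases hx : x ∈ Icc (0 : ℝ) 1
  · exact hB x hx
  · rw [deriv_smoothTransition_eq_zero, abs_zero]
    · exact hB0
    · simp only [mem_Icc, not_and_or, not_le] at hx
      exact hx

/-- A radial cutoff function on the unit disc. -/
noncomputable def discCutoff (n : ℕ) (w : ℂ) : ℝ := Real.smoothTransition (n * (1 - ‖w‖ ^ 2) - 1)

theorem contDiff_discCutoff (n : ℕ) : ContDiff ℝ 1 (discCutoff n) := by
  have h : ContDiff ℝ 1 (fun w : ℂ => (n : ℝ) * (1 - ‖w‖ ^ 2) - 1) :=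
    (contDiff_const.mul (contDiff_const.sub (contDiff_norm_sq ℝ))).sub contDiff_const
  exact (Real.smoothTransition.contDiff (n := 1)).comp h

theorem fderiv_discCutoff (n : ℕ) (w v : ℂ) :
    fderiv ℝ (discCutoff n) w v
      = deriv Real.smoothTransition (n * (1 - ‖w‖ ^ 2) - 1) * (-(2 * n) * inner ℝ w v) := by
  have h1 : HasFDerivAt (fun w : ℂ => (n : ℝ) * (1 - ‖w‖ ^ 2) - 1)
      ((n : ℝ) • -(2 • innerSL ℝ w) : ℂ →L[ℝ] ℝ) w :=
    (((hasStrictFDerivAt_norm_sq w).hasFDerivAt.const_sub 1).const_mul (n : ℝ)).sub_const 1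
  have h2 : HasDerivAt Real.smoothTransition
      (deriv Real.smoothTransition (n * (1 - ‖w‖ ^ 2) - 1)) (n * (1 - ‖w‖ ^ 2) - 1) :=
    ((Real.smoothTransition.contDiff (n := 1)).differentiable one_ne_zero _).hasDerivAt
  have h3 := h2.comp_hasFDerivAt w h1
  rw [show discCutoff n = Real.smoothTransition ∘ fun w : ℂ => (n : ℝ) * (1 - ‖w‖ ^ 2) - 1 from rfl,
    h3.fderiv]
  simp only [smul_apply, neg_apply, innerSL_apply_apply, smul_eq_mul, nsmul_eq_mul,
    Nat.cast_ofNat]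
  ring

theorem eventually_lt_mul_one_sub {w : ℂ} (hw : ‖w‖ < 1) :
    ∀ᶠ n : ℕ in atTop, 2 < (n : ℝ) * (1 - ‖w‖ ^ 2) := by
  have h : 0 < 1 - ‖w‖ ^ 2 := by nlinarith [norm_nonneg w]
  exact (tendsto_natCast_atTop_atTop.atTop_mul_const h).eventually_gt_atTop 2

/-- The cutoff vanishes off a compact subset of the disc, so nothing is asked of `η` at or beyond
the circle. -/
theorem contDiff_discCutoff_mul (n : ℕ) {η : ℂ → ℝ} (hη : ContDiffOn ℝ 1 η (ball 0 1)) :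
    ContDiff ℝ 1 (fun w => discCutoff n w * η w) ∧
      tsupport (fun w => discCutoff n w * η w) ⊆ ball 0 1 := by
  have hS : IsClosed {w : ℂ | 1 ≤ (n : ℝ) * (1 - ‖w‖ ^ 2)} :=
    isClosed_le continuous_const (by fun_prop)
  have hz : ∀ w : ℂ, (n : ℝ) * (1 - ‖w‖ ^ 2) < 1 → discCutoff n w = 0 := fun w hw =>
    Real.smoothTransition.zero_of_nonpos (by linarith)
  have hball : {w : ℂ | 1 ≤ (n : ℝ) * (1 - ‖w‖ ^ 2)} ⊆ ball 0 1 := by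
    intro w hw
    rw [mem_ball_zero_iff]
    by_contra! h
    have h1 : (n : ℝ) * (1 - ‖w‖ ^ 2) ≤ 0 :=
      mul_nonpos_of_nonneg_of_nonpos (by positivity) (by nlinarith)
    have h2 : 1 ≤ (n : ℝ) * (1 - ‖w‖ ^ 2) := hw
    linarith
  refine ⟨?_, ?_⟩
  · rw [contDiff_iff_contDiffAt]
    intro w
    by_cases hw : w ∈ ball (0 : ℂ) 1
    · exact (contDiff_discCutoff n).contDiffAt.mul (hη.contDiffAt (isOpen_ball.mem_nhds hw))
    · have h1 : (fun w => discCutoff n w * η w) =ᶠ[𝓝 w] fun _ => 0 := by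
        filter_upwards [hS.isOpen_compl.mem_nhds fun h => hw (hball h)] with x hx
        rw [hz x (not_le.1 hx), zero_mul]
      exact contDiffAt_const.congr_of_eventuallyEq h1
  · refine (closure_minimal (fun w hw => ?_) hS).trans hball
    by_contra h
    exact hw (by simp [hz w (not_le.1 h)])

/-- Green's formula for the Neumann function of the disc minus its Dirichlet Green function at the
origin. -/
theorem setIntegral_inner_poleField {α : ℂ} (hα : ‖α‖ < 1) {η : ℂ → ℝ}
    (hη : ContDiffOn ℝ 1 η (ball 0 1))
    (hint : IntegrableOn (fun x => ‖gradient η x‖ ^ 2) (ball 0 1)) {M : ℝ}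
    (hM : ∀ w ∈ ball (0 : ℂ) 1, |η w| ≤ M) :
    ∫ w in ball 0 1, inner ℝ (conj (poleField α w)) (gradient η w)
      = 2 * Real.pi * (η 0 - η α) := by
  obtain ⟨B, hB0, hB⟩ := exists_abs_deriv_smoothTransition_le
  have hM0 : 0 ≤ M := (abs_nonneg _).trans (hM 0 (mem_ball_self one_pos))
  have hα0 := norm_nonneg α
  have hα1 : 0 < 1 - ‖α‖ := by linarith
  set I : ℂ → ℝ := fun w => inner ℝ (conj (poleField α w)) (gradient η w) with hI
  have hIint : IntegrableOn I (ball 0 1) := integrableOn_inner_poleField hα hη hint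
  set J : ℕ → ℂ → ℝ := fun n w =>
    inner ℝ (conj (poleField α w)) (gradient (fun w => discCutoff n w * η w) w) with hJ
  have hJeq : ∀ n, ∫ w in ball 0 1, J n w
      = 2 * Real.pi * (discCutoff n 0 * η 0 - discCutoff n α * η α) := fun n =>
    setIntegral_inner_poleField_of_tsupport_subset hα (contDiff_discCutoff_mul n hη).1
      (contDiff_discCutoff_mul n hη).2
  have hone : ∀ w : ℂ, ‖w‖ < 1 → ∀ᶠ n in atTop, discCutoff n w = 1 := by
    intro w hw
    filter_upwards [eventually_lt_mul_one_sub hw] with n hn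
    exact Real.smoothTransition.one_of_one_le (by linarith)
  -- The cutoff is radial, so its gradient sees only the radial component of the field. It has size
  -- `n` where `1 - |w|²` is of order `1/n`, and the radial component there is `O(1/n)`: the error
  -- term stays bounded and vanishes pointwise.
  have hJform : ∀ n, ∀ w ∈ ball (0 : ℂ) 1, J n w = discCutoff n w * I w
      + η w * (deriv Real.smoothTransition (n * (1 - ‖w‖ ^ 2) - 1)
          * (-(2 * n) * (w * poleField α w).re)) := by
    intro n w hw
    have h1 : HasFDerivAt η (fderiv ℝ η w) w :=
      ((hη.contDiffAt (isOpen_ball.mem_nhds hw)).differentiableAt one_ne_zero).hasFDerivAt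
    have h2 : HasFDerivAt (discCutoff n) (fderiv ℝ (discCutoff n) w) w :=
      ((contDiff_discCutoff n).differentiable one_ne_zero w).hasFDerivAt
    simp only [hJ, hI]
    rw [real_inner_comm, inner_gradient_left, real_inner_comm, inner_gradient_left,
      (show HasFDerivAt (fun w => discCutoff n w * η w) _ w from h2.mul h1).fderiv]
    simp only [add_apply, smul_apply, smul_eq_mul]
    rw [fderiv_discCutoff, inner_eq_re_conj_mul, ← map_mul, Complex.conj_re]
  have hlimJ : Tendsto (fun n => ∫ w in ball 0 1, J n w) atTop (𝓝 (∫ w in ball 0 1, I w)) := by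
    -- From `N` on, the layer where the cutoff varies lies in `|w| ≥ (1 + |α|)/2`, where the
    -- tangency estimate applies.
    obtain ⟨N, hN⟩ := (eventually_atTop.1 (eventually_lt_mul_one_sub
      (w := (((1 + ‖α‖) / 2 : ℝ) : ℂ)) (by
        rw [Complex.norm_real, Real.norm_of_nonneg (by positivity)]
        linarith)))
    refine tendsto_integral_filter_of_dominated_convergence
      (fun w => |I w| + M * (8 * B / (1 - ‖α‖) ^ 2)) (Eventually.of_forall fun n => ?_) ?_ ?_ ?_
    · have h1 : Measurable fun w => conj (poleField α w) := by
        refine Complex.continuous_conj.measurable.comp ?_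
        unfold poleField
        fun_prop
      exact (h1.inner (measurable_gradient _)).aestronglyMeasurable
    · filter_upwards [eventually_ge_atTop N, eventually_gt_atTop 0] with n hn hn0
      filter_upwards [self_mem_ae_restrict measurableSet_ball] with w hw
      have hw1 : ‖w‖ < 1 := mem_ball_zero_iff.1 hw
      have hnpos : (0 : ℝ) < n := by exact_mod_cast hn0
      rw [hJform n w hw]
      refine (norm_add_le _ _).trans (add_le_add ?_ ?_)
      · rw [norm_mul, Real.norm_eq_abs, Real.norm_eq_abs]
        have h1 : |discCutoff n w| ≤ 1 := by
          rw [abs_of_nonneg (show 0 ≤ discCutoff n w from Real.smoothTransition.nonneg _)]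
          exact Real.smoothTransition.le_one _
        exact mul_le_of_le_one_left (abs_nonneg _) h1
      · rw [norm_mul, Real.norm_eq_abs, Real.norm_eq_abs]
        refine mul_le_mul (hM w hw) ?_ (abs_nonneg _) hM0
        by_cases hcase : (n : ℝ) * (1 - ‖w‖ ^ 2) - 1 ≤ 1
        · have h2 : (1 + ‖α‖) / 2 ≤ ‖w‖ := by
            have h3 := hN n hn
            rw [Complex.norm_real, Real.norm_of_nonneg (by positivity)] at h3
            by_contra! h4
            have h5 : ‖w‖ ^ 2 < ((1 + ‖α‖) / 2) ^ 2 := by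
              have := norm_nonneg w
              gcongr
            nlinarith
          have h3 := abs_re_mul_poleField_le hα hw1 h2
          rw [abs_mul, abs_mul, abs_neg, abs_of_nonneg (by positivity : (0 : ℝ) ≤ 2 * n)]
          calc |deriv Real.smoothTransition (n * (1 - ‖w‖ ^ 2) - 1)|
                * (2 * n * |(w * poleField α w).re|)
              ≤ B * (2 * n * (2 / (1 - ‖α‖) ^ 2 * (1 - ‖w‖ ^ 2))) := by
                gcongr
                exact hB _
            _ = 4 * B / (1 - ‖α‖) ^ 2 * (n * (1 - ‖w‖ ^ 2)) := by ring
            _ ≤ 4 * B / (1 - ‖α‖) ^ 2 * 2 := by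
                gcongr
                linarith
            _ = 8 * B / (1 - ‖α‖) ^ 2 := by ring
        · rw [deriv_smoothTransition_eq_zero (Or.inr (not_le.1 hcase)), zero_mul, abs_zero]
          positivity
    · exact hIint.abs.add (integrableOn_const (hs := measure_ball_lt_top.ne))
    · filter_upwards [self_mem_ae_restrict measurableSet_ball] with w hw
      have hw1 : ‖w‖ < 1 := mem_ball_zero_iff.1 hw
      refine tendsto_const_nhds.congr' ?_
      filter_upwards [hone w hw1, eventually_lt_mul_one_sub hw1] with n h1 h2
      rw [hJform n w hw, h1, deriv_smoothTransition_eq_zero (Or.inr (by linarith))]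
      ring
  refine tendsto_nhds_unique hlimJ (tendsto_const_nhds.congr' ?_)
  filter_upwards [hone 0 (by simp), hone α hα] with n h1 h2
  rw [hJeq, h1, h2, one_mul, one_mul]

theorem integral_circleMap_of_differentiableOn {k : ℂ → ℂ} (hk : DifferentiableOn ℂ k (ball 0 1))
    {r : ℝ} (hr : r ∈ Ioo 0 1) :
    ∫ θ in Ioo (-Real.pi) Real.pi, k (circleMap 0 r θ) = 2 * Real.pi * k 0 := by
  have h1 : HarmonicOnNhd k (closedBall 0 |r|) := fun x hx =>
    (hk.analyticAt (isOpen_ball.mem_nhds (closedBall_subset_ball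
      (by rw [abs_of_pos hr.1]; exact hr.2) hx))).harmonicAt
  have h2 := h1.circleAverage_eq
  rw [Real.circleAverage] at h2
  have h3 : Function.Periodic (fun θ => k (circleMap 0 r θ)) (2 * Real.pi) := fun θ => by
    simp only [periodic_circleMap 0 r θ]
  have h4 := h3.intervalIntegral_add_eq (-Real.pi) 0
  rw [zero_add, show -Real.pi + 2 * Real.pi = Real.pi by ring,
    intervalIntegral.integral_of_le (by linarith [Real.pi_pos]), integral_Ioc_eq_integral_Ioo] at h4
  rw [h4, ← h2, Complex.real_smul]
  have : (Real.pi : ℂ) ≠ 0 := by exact_mod_cast Real.pi_ne_zero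
  push_cast
  field_simp

/-- The gradient of `log |·|` is orthogonal in the disc to gradients of harmonic functions. -/
theorem setIntegral_inner_inv_conj {K : ℂ → ℂ} (hK : DifferentiableOn ℂ K (ball 0 1)) {C : ℝ}
    (hC : ∀ w ∈ ball (0 : ℂ) 1, ‖K w‖ ≤ C) :
    ∫ w in ball 0 1, inner ℝ (conj (w⁻¹)) (conj (K w)) = 0 := by
  rw [← integral_indicator measurableSet_ball, ← Complex.integral_comp_polarCoord_symm]
  set e : ℝ → ℂ := fun θ => Complex.exp (θ * Complex.I) with he
  have hec : Continuous e := by fun_prop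
  have hen : ∀ θ, ‖e θ‖ = 1 := fun θ => Complex.norm_exp_ofReal_mul_I θ
  have hpol : ∀ q : ℝ × ℝ, Complex.polarCoord.symm q = q.1 * e q.2 := by
    rintro ⟨r, θ⟩
    rw [polarCoord_symm_eq_circleMap, circleMap, zero_add]
  have hsub : Ioo (0 : ℝ) 1 ×ˢ Ioo (-Real.pi) Real.pi ⊆ polarCoord.target :=
    prod_mono (fun r hr => hr.1) subset_rfl
  have hmS : MeasurableSet (Ioo (0 : ℝ) 1 ×ˢ Ioo (-Real.pi) Real.pi) :=
    measurableSet_Ioo.prod measurableSet_Ioo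
  have hmem : ∀ q ∈ Ioo (0 : ℝ) 1 ×ˢ Ioo (-Real.pi) Real.pi, (q.1 * e q.2 : ℂ) ∈ ball (0 : ℂ) 1 := by
    rintro ⟨r, θ⟩ ⟨hr, -⟩
    rw [mem_ball_zero_iff, norm_mul, hen, mul_one, Complex.norm_real, Real.norm_of_nonneg hr.1.le]
    exact hr.2
  -- In polar coordinates the integrand is the real part of `e^{iθ} K`, a multiple on each circle of
  -- `w K(w)`, whose mean is its value `0` at the centre.
  set G : ℝ × ℝ → ℂ := fun q => e q.2 * K (q.1 * e q.2) with hG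
  rw [setIntegral_eq_of_subset_of_forall_sdiff_eq_zero polarCoord.open_target.measurableSet hsub]
  · rw [setIntegral_congr_fun (g := fun q => (G q).re) hmS]
    · have hGi : IntegrableOn G (Ioo (0 : ℝ) 1 ×ˢ Ioo (-Real.pi) Real.pi) := by
        refine IntegrableOn.of_bound ?_ ?_ C ?_
        · rw [Measure.volume_eq_prod, Measure.prod_prod]
          exact ENNReal.mul_lt_top (by simp) (by simp)
        · refine ContinuousOn.aestronglyMeasurable ?_ hmS
          refine (hec.comp continuous_snd).continuousOn.mul ?_
          refine hK.continuousOn.comp (Continuous.continuousOn ?_) hmem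
          exact (Complex.continuous_ofReal.comp continuous_fst).mul (hec.comp continuous_snd)
        · filter_upwards [self_mem_ae_restrict hmS] with q hq
          rw [hG, norm_mul, hen, one_mul]
          exact hC _ (hmem q hq)
      have h0 : ∫ q in Ioo (0 : ℝ) 1 ×ˢ Ioo (-Real.pi) Real.pi, G q = 0 := by
        rw [Measure.volume_eq_prod] at hGi ⊢
        rw [setIntegral_prod _ hGi]
        refine setIntegral_eq_zero_of_forall_eq_zero fun r hr => ?_
        have hrc : (r : ℂ) ≠ 0 := by exact_mod_cast hr.1.ne'
        have h1 := integral_circleMap_of_differentiableOn (k := fun w => w * K w)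
          (differentiableOn_id.mul hK) hr
        simp only [zero_mul, mul_zero] at h1
        have h2 : ∀ θ : ℝ, G (r, θ) = (r : ℂ)⁻¹ * (circleMap 0 r θ * K (circleMap 0 r θ)) := by
          intro θ
          simp only [hG, circleMap, zero_add, he]
          field_simp
        simp only [h2, integral_const_mul, h1, mul_zero]
      have h1 := integral_re hGi
      simp only [RCLike.re_eq_complex_re] at h1
      rw [h1, h0, Complex.zero_re]
    · rintro ⟨r, θ⟩ hq
      have hrc : (r : ℂ) ≠ 0 := by exact_mod_cast hq.1.1.ne'
      simp only [hpol]
      rw [indicator_of_mem (hmem _ hq), inner_eq_re_conj_mul, smul_eq_mul, ← Complex.re_ofReal_mul]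
      rw [← Complex.conj_re]
      congr 1
      have h1 : e θ * conj (e θ) = 1 := mul_conj_of_norm_eq_one (hen θ)
      have h2 : e θ ≠ 0 := norm_ne_zero_iff.1 (by rw [hen]; exact one_ne_zero)
      have h3 : conj (e θ) = (e θ)⁻¹ := eq_inv_of_mul_eq_one_right h1
      simp only [hG, map_mul, Complex.conj_ofReal, map_inv₀, Complex.conj_conj, h3]
      field_simp
  · rintro ⟨r, θ⟩ ⟨hq, hn⟩
    rw [indicator_of_notMem, smul_zero]
    intro h
    rw [hpol, mem_ball_zero_iff, norm_mul, hen, mul_one, Complex.norm_real] at h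
    exact hn ⟨⟨hq.1, (le_abs_self r).trans_lt h⟩, hq.2⟩

/-! ### The Dirichlet problem through a conformal chart -/

/-- A conformal map of `Ω` onto the unit disc, extended continuously to the boundary. -/
structure IsDiscChart (Ω : Set ℂ) (φ : ℂ → ℂ) : Prop where
  isOpen : IsOpen Ω
  isBounded : Bornology.IsBounded Ω
  differentiableOn : DifferentiableOn ℂ φ Ω
  bijOn : BijOn φ Ω (ball 0 1)
  continuousOn : ContinuousOn φ (closure Ω)
  norm_eq_one : ∀ p ∈ frontier Ω, ‖φ p‖ = 1

theorem exists_isDiscChart {β : ℝ≥0} {Ω : Set ℂ} (hΩ : IsC1HolderDomain β Ω) {φ₀ : ℂ → ℂ}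
    (hd : DifferentiableOn ℂ φ₀ Ω) (hb : BijOn φ₀ Ω (ball 0 1)) :
    ∃ φ, IsDiscChart Ω φ ∧ EqOn φ φ₀ Ω := by
  obtain ⟨φ, h1, h2, h3⟩ := exists_continuousOn_closure_extension hΩ.isOpen hΩ.boundary hd hb
  exact ⟨φ, ⟨hΩ.isOpen, hΩ.isBounded, hd.congr h1, hb.congr h1.symm, h2, h3⟩, h1⟩

/-- The regular part of a Green type function with pole `a`; the Dirichlet case is `s = -1`, the
Neumann case is `s = 1`. -/
noncomputable def regularPart (φ : ℂ → ℂ) (a : ℂ) (s c : ℝ) (x : ℂ) : ℝ :=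
  Real.log ‖dslope φ a x‖ + s * Real.log ‖1 - conj (φ a) * φ x‖ + c

namespace IsDiscChart

variable {Ω : Set ℂ} {φ : ℂ → ℂ}

theorem norm_lt_one (h : IsDiscChart Ω φ) {x : ℂ} (hx : x ∈ Ω) : ‖φ x‖ < 1 :=
  mem_ball_zero_iff.1 (h.bijOn.mapsTo hx)

theorem norm_le_one (h : IsDiscChart Ω φ) {x : ℂ} (hx : x ∈ closure Ω) : ‖φ x‖ ≤ 1 := by
  by_cases hxΩ : x ∈ Ω
  · exact (h.norm_lt_one hxΩ).le
  · exact (h.norm_eq_one x (by rw [h.isOpen.frontier_eq]; exact ⟨hx, hxΩ⟩)).le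

theorem hasDerivAt (h : IsDiscChart Ω φ) {x : ℂ} (hx : x ∈ Ω) : HasDerivAt φ (deriv φ x) x :=
  (h.differentiableOn.differentiableAt (h.isOpen.mem_nhds hx)).hasDerivAt

theorem deriv_ne_zero (h : IsDiscChart Ω φ) {x : ℂ} (hx : x ∈ Ω) : deriv φ x ≠ 0 :=
  deriv_ne_zero_of_injOn h.isOpen h.differentiableOn h.bijOn.injOn hx

theorem map_ne (h : IsDiscChart Ω φ) {a x : ℂ} (ha : a ∈ Ω) (hx : x ∈ closure Ω) (hne : x ≠ a) :
    φ x ≠ φ a := by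
  by_cases hxΩ : x ∈ Ω
  · exact fun he => hne (h.bijOn.injOn hxΩ ha he)
  · intro he
    have h1 := h.norm_eq_one x (by rw [h.isOpen.frontier_eq]; exact ⟨hx, hxΩ⟩)
    rw [he] at h1
    exact (h.norm_lt_one ha).ne h1

theorem dslope_ne_zero (h : IsDiscChart Ω φ) {a x : ℂ} (ha : a ∈ Ω) (hx : x ∈ closure Ω) :
    dslope φ a x ≠ 0 := by
  rcases eq_or_ne x a with rfl | hne
  · rw [dslope_same]
    exact h.deriv_ne_zero ha
  · rw [dslope_of_ne _ hne, slope_def_field]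
    exact div_ne_zero (sub_ne_zero.2 (h.map_ne ha hx hne)) (sub_ne_zero.2 hne)

theorem one_sub_ne_zero (h : IsDiscChart Ω φ) {a x : ℂ} (ha : a ∈ Ω) (hx : x ∈ closure Ω) :
    1 - conj (φ a) * φ x ≠ 0 :=
  one_sub_conj_mul_ne_zero (h.norm_lt_one ha) (h.norm_le_one hx)

theorem harmonicOnNhd_regularPart (h : IsDiscChart Ω φ) {a : ℂ} (ha : a ∈ Ω) (s c : ℝ) :
    HarmonicOnNhd (regularPart φ a s c) Ω := by
  have h1 : HarmonicOnNhd (fun x => Real.log ‖dslope φ a x‖) Ω := fun x hx => by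
    refine AnalyticAt.harmonicAt_log_norm ?_ (h.dslope_ne_zero ha (subset_closure hx))
    exact ((Complex.differentiableOn_dslope (h.isOpen.mem_nhds ha)).2
      h.differentiableOn).analyticAt (h.isOpen.mem_nhds hx)
  have h2 : HarmonicOnNhd (fun x => Real.log ‖1 - conj (φ a) * φ x‖) Ω := fun x hx => by
    refine AnalyticAt.harmonicAt_log_norm ?_ (h.one_sub_ne_zero ha (subset_closure hx))
    exact analyticAt_const.sub (analyticAt_const.mul
      (h.differentiableOn.analyticAt (h.isOpen.mem_nhds hx)))
  exact (h1.add (h2.const_smul (c := s))).add (harmonicOnNhd_const c)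

theorem continuousOn_log_one_sub (h : IsDiscChart Ω φ) {a : ℂ} (ha : a ∈ Ω) :
    ContinuousOn (fun x => Real.log ‖1 - conj (φ a) * φ x‖) (closure Ω) :=
  (continuousOn_const.sub (continuousOn_const.mul h.continuousOn)).norm.log
    fun _ hx => norm_ne_zero_iff.2 (h.one_sub_ne_zero ha hx)

theorem continuousOn_regularPart (h : IsDiscChart Ω φ) {a : ℂ} (ha : a ∈ Ω) (s c : ℝ) :
    ContinuousOn (regularPart φ a s c) (closure Ω) := by
  have h1 : ContinuousOn (dslope φ a) (closure Ω) :=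
    (continuousOn_dslope (mem_of_superset (h.isOpen.mem_nhds ha) subset_closure)).2
      ⟨h.continuousOn, (h.hasDerivAt ha).differentiableAt⟩
  exact ((h1.norm.log fun x hx => norm_ne_zero_iff.2 (h.dslope_ne_zero ha hx)).add
    (continuousOn_const.mul (h.continuousOn_log_one_sub ha))).add continuousOn_const

/-- The divided slope `dslope φ a` is `(φ x - φ a) / (x - a)` filled in by `φ' a` at the pole, so
its logarithm is smooth at `a` and absorbs `log |x - a|` elsewhere. -/
theorem withPole_regularPart (h : IsDiscChart Ω φ) {a x : ℂ} (ha : a ∈ Ω) (hx : x ∈ closure Ω)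
    (hne : x ≠ a) (s c : ℝ) : withPole a (regularPart φ a s c) x
      = Real.log ‖φ x - φ a‖ + s * Real.log ‖1 - conj (φ a) * φ x‖ + c := by
  have h1 : ‖φ x - φ a‖ ≠ 0 := norm_ne_zero_iff.2 (sub_ne_zero.2 (h.map_ne ha hx hne))
  have h2 : ‖x - a‖ ≠ 0 := norm_ne_zero_iff.2 (sub_ne_zero.2 hne)
  rw [withPole, regularPart, dslope_of_ne _ hne, slope_def_field, norm_div, Real.log_div h1 h2]
  ring

theorem norm_sub_eq_on_frontier (h : IsDiscChart Ω φ) (a : ℂ) {p : ℂ} (hp : p ∈ frontier Ω) :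
    ‖φ p - φ a‖ = ‖1 - conj (φ a) * φ p‖ := by
  have h1 := norm_sq_one_sub_conj_mul_sub (φ a) (φ p)
  rw [h.norm_eq_one p hp] at h1
  refine (sq_eq_sq₀ (norm_nonneg _) (norm_nonneg _)).1 ?_
  linarith

theorem ne_of_mem_frontier (h : IsDiscChart Ω φ) {a p : ℂ} (ha : a ∈ Ω) (hp : p ∈ frontier Ω) :
    p ≠ a := by
  rintro rfl
  rw [h.isOpen.frontier_eq] at hp
  exact hp.2 ha

/-- On the boundary the two logarithms agree: `s = -1` cancels them, `s = 1` doubles them. -/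
theorem withPole_regularPart_on_frontier (h : IsDiscChart Ω φ) {a p : ℂ} (ha : a ∈ Ω)
    (hp : p ∈ frontier Ω) (s c : ℝ) : withPole a (regularPart φ a s c) p
      = (1 + s) * Real.log ‖1 - conj (φ a) * φ p‖ + c := by
  rw [h.withPole_regularPart ha (frontier_subset_closure hp) (h.ne_of_mem_frontier ha hp),
    h.norm_sub_eq_on_frontier a hp]
  ring

theorem regularPart_self (h : IsDiscChart Ω φ) {a : ℂ} (ha : a ∈ Ω) (s c : ℝ) :
    regularPart φ a s c a = Real.log ‖deriv φ a‖ + s * Real.log (1 - ‖φ a‖ ^ 2) + c := by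
  have h1 : (1 : ℂ) - conj (φ a) * φ a = ((1 - ‖φ a‖ ^ 2 : ℝ) : ℂ) := by
    rw [Complex.conj_mul']
    push_cast
    rfl
  have h2 : 0 ≤ 1 - ‖φ a‖ ^ 2 := by nlinarith [norm_nonneg (φ a), h.norm_lt_one ha]
  rw [regularPart, dslope_same, h1, Complex.norm_real, Real.norm_of_nonneg h2]

theorem isDirichletRegularPart (h : IsDiscChart Ω φ) {a : ℂ} (ha : a ∈ Ω) :
    IsDirichletRegularPart Ω a (regularPart φ a (-1) 0) :=
  ⟨h.harmonicOnNhd_regularPart ha _ _, h.continuousOn_regularPart ha _ _, fun p hp => by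
    rw [h.withPole_regularPart_on_frontier ha hp]
    ring⟩

end IsDiscChart

/-- The maximum principle for harmonic functions that are continuous up to the boundary. -/
theorem le_zero_of_harmonicOnNhd {Ω : Set ℂ} (hΩ : IsOpen Ω) (hb : Bornology.IsBounded Ω)
    {D : ℂ → ℝ} (hD : HarmonicOnNhd D Ω) (hc : ContinuousOn D (closure Ω))
    (h0 : ∀ p ∈ frontier Ω, D p = 0) : ∀ x ∈ closure Ω, D x ≤ 0 := by
  intro x hx
  by_contra! hpos
  have hcpt : IsCompact (closure Ω) := hb.isCompact_closure
  obtain ⟨z, hz, hzmax⟩ := hcpt.exists_isMaxOn ⟨x, hx⟩ hc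
  have hDz : 0 < D z := hpos.trans_le (hzmax hx)
  -- The set where a positive maximum is attained stays inside `Ω`; it is closed and, by the local
  -- maximum principle, open, hence the whole plane, against boundedness.
  set S : Set ℂ := closure Ω ∩ D ⁻¹' {D z} with hS
  have hScl : IsClosed S := hc.preimage_isClosed_of_isClosed isClosed_closure isClosed_singleton
  have hSΩ : S ⊆ Ω := by
    intro y hy
    by_contra hyΩ
    have h1 := h0 y (by rw [hΩ.frontier_eq]; exact ⟨hy.1, hyΩ⟩)
    have h2 : D y = D z := hy.2
    linarith
  have hSop : IsOpen S := by
    rw [isOpen_iff_mem_nhds]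
    intro y hy
    obtain ⟨r, hr, hrΩ⟩ := Metric.isOpen_iff.1 hΩ y (hSΩ hy)
    -- Locally `D = Re F`, so `|exp F| = exp D` reduces the claim to the maximum modulus principle.
    obtain ⟨F, hF, hFD⟩ := (hD.mono hrΩ).exists_analyticOnNhd_ball_re_eq
    have hyz : D y = D z := hy.2
    have hnorm : ∀ w ∈ ball y r, ‖Complex.exp (F w)‖ = Real.exp (D w) := fun w hw => by
      rw [Complex.norm_exp]
      congr 1
      exact hFD hw
    have hmax : IsLocalMax (norm ∘ fun w => Complex.exp (F w)) y := by
      filter_upwards [ball_mem_nhds y hr] with w hw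
      simp only [Function.comp_apply]
      rw [hnorm w hw, hnorm y (mem_ball_self hr), Real.exp_le_exp, hyz]
      exact hzmax (subset_closure (hrΩ hw))
    have hdiff : ∀ᶠ w in 𝓝 y, DifferentiableAt ℂ (fun w => Complex.exp (F w)) w := by
      filter_upwards [ball_mem_nhds y hr] with w hw
      exact (hF w hw).differentiableAt.cexp
    filter_upwards [Complex.norm_eventually_eq_of_isLocalMax hdiff hmax, ball_mem_nhds y hr]
      with w hw1 hw2
    rw [hnorm w hw2, hnorm y (mem_ball_self hr), Real.exp_eq_exp, hyz] at hw1
    exact ⟨subset_closure (hrΩ hw2), hw1⟩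
  have huniv : S = univ := IsClopen.eq_univ ⟨hScl, hSop⟩ ⟨z, hz, rfl⟩
  have hbS : Bornology.IsBounded (univ : Set ℂ) := huniv ▸ hb.subset hSΩ
  exact NormedSpace.unbounded_univ ℝ ℂ hbS

/-- Uniqueness is what makes the function chosen by `Classical.epsilon` in `hatR` computable. -/
theorem eqOn_closure_of_isDirichletRegularPart {Ω : Set ℂ} (hΩ : IsOpen Ω)
    (hb : Bornology.IsBounded Ω) {a : ℂ} {R₁ R₂ : ℂ → ℝ} (h₁ : IsDirichletRegularPart Ω a R₁)
    (h₂ : IsDirichletRegularPart Ω a R₂) : EqOn R₁ R₂ (closure Ω) := by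
  have key : ∀ {R₁ R₂ : ℂ → ℝ}, IsDirichletRegularPart Ω a R₁ → IsDirichletRegularPart Ω a R₂ →
      ∀ x ∈ closure Ω, R₁ x ≤ R₂ x := by
    intro R₁ R₂ h₁ h₂ x hx
    refine sub_nonpos.1 (le_zero_of_harmonicOnNhd hΩ hb (h₁.harmonic.sub h₂.harmonic)
      (h₁.continuousOn.sub h₂.continuousOn) (fun p hp => ?_) x hx)
    have e1 := h₁.boundary p hp
    have e2 := h₂.boundary p hp
    rw [withPole] at e1 e2
    simp only [Pi.sub_apply]
    linarith
  exact fun x hx => le_antisymm (key h₁ h₂ x hx) (key h₂ h₁ x hx)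

namespace IsDiscChart

variable {Ω : Set ℂ} {φ : ℂ → ℂ}

theorem isDirichletRegularPart_hatR (h : IsDiscChart Ω φ) {a : ℂ} (ha : a ∈ Ω) :
    IsDirichletRegularPart Ω a (hatR Ω a) :=
  Classical.epsilon_spec (p := IsDirichletRegularPart Ω a) ⟨_, h.isDirichletRegularPart ha⟩

theorem hatR_eqOn (h : IsDiscChart Ω φ) {a : ℂ} (ha : a ∈ Ω) :
    EqOn (hatR Ω a) (regularPart φ a (-1) 0) (closure Ω) :=
  eqOn_closure_of_isDirichletRegularPart h.isOpen h.isBounded (h.isDirichletRegularPart_hatR ha)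
    (h.isDirichletRegularPart ha)

theorem hatW_eq (h : IsDiscChart Ω φ) {a : ℂ} (ha : a ∈ Ω) :
    hatW Ω a = -Real.pi * (Real.log ‖deriv φ a‖ - Real.log (1 - ‖φ a‖ ^ 2)) := by
  rw [hatW, h.hatR_eqOn ha (subset_closure ha), h.regularPart_self ha]
  ring

/-! ### Conformal invariance of the Dirichlet form -/

theorem invFunOn_mem (h : IsDiscChart Ω φ) {w : ℂ} (hw : w ∈ ball (0 : ℂ) 1) :
    Function.invFunOn φ Ω w ∈ Ω := h.bijOn.surjOn.mapsTo_invFunOn hw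

theorem map_invFunOn (h : IsDiscChart Ω φ) {w : ℂ} (hw : w ∈ ball (0 : ℂ) 1) :
    φ (Function.invFunOn φ Ω w) = w := h.bijOn.surjOn.rightInvOn_invFunOn hw

theorem invFunOn_map (h : IsDiscChart Ω φ) {x : ℂ} (hx : x ∈ Ω) :
    Function.invFunOn φ Ω (φ x) = x := h.bijOn.injOn.leftInvOn_invFunOn hx

theorem hasDerivAt_invFunOn (h : IsDiscChart Ω φ) {w : ℂ} (hw : w ∈ ball (0 : ℂ) 1) :
    HasDerivAt (Function.invFunOn φ Ω) (deriv φ (Function.invFunOn φ Ω w))⁻¹ w := by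
  have := RenormalizedEnergy.hasDerivAt_invFunOn h.isOpen h.differentiableOn h.bijOn.injOn
    (h.invFunOn_mem hw)
  rwa [h.map_invFunOn hw] at this

theorem differentiableOn_invFunOn (h : IsDiscChart Ω φ) :
    DifferentiableOn ℂ (Function.invFunOn φ Ω) (ball 0 1) := fun _ hw =>
  (h.hasDerivAt_invFunOn hw).differentiableAt.differentiableWithinAt

theorem image_invFunOn (h : IsDiscChart Ω φ) : Function.invFunOn φ Ω '' ball 0 1 = Ω := by
  ext x
  constructor
  · rintro ⟨w, hw, rfl⟩
    exact h.invFunOn_mem hw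
  · exact fun hx => ⟨φ x, h.bijOn.mapsTo hx, h.invFunOn_map hx⟩

theorem injOn_invFunOn (h : IsDiscChart Ω φ) : InjOn (Function.invFunOn φ Ω) (ball 0 1) :=
  fun x hx y hy hxy => by rw [← h.map_invFunOn hx, ← h.map_invFunOn hy, hxy]

end IsDiscChart

/-- The gradient of a composition with a holomorphic map. -/
theorem gradient_comp_holomorphic {ζ : ℂ → ℝ} {f : ℂ → ℂ} {f' w : ℂ} (hf : HasDerivAt f f' w)
    (hζ : DifferentiableAt ℝ ζ (f w)) :
    gradient (ζ ∘ f) w = conj f' * gradient ζ (f w) := by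
  refine ext_inner_right ℝ fun v => ?_
  have h1 := hζ.hasFDerivAt.comp w (hf.hasFDerivAt.restrictScalars ℝ)
  rw [inner_gradient_left, h1.fderiv]
  have h2 : inner ℝ (conj f' * gradient ζ (f w)) v = inner ℝ (gradient ζ (f w)) (v * f') := by
    rw [inner_eq_re_conj_mul, inner_eq_re_conj_mul]
    congr 1
    simp
    ring
  rw [h2, inner_gradient_left]
  simp

theorem det_restrictScalars_toSpanSingleton (z : ℂ) :
    |((ContinuousLinearMap.toSpanSingleton ℂ z).restrictScalars ℝ).det| = ‖z‖ ^ 2 := by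
  have h : ((ContinuousLinearMap.toSpanSingleton ℂ z).restrictScalars ℝ).det = ‖z‖ ^ 2 := by
    rw [det_clm_complex, Complex.sq_norm, Complex.normSq_apply]
    simp
  rw [h, abs_of_nonneg (by positivity)]

/-- Conformal change of variables. -/
theorem setIntegral_image_holomorphic {f : ℂ → ℂ} {U : Set ℂ} (hU : IsOpen U)
    (hf : DifferentiableOn ℂ f U) (hinj : InjOn f U) (G : ℂ → ℝ) :
    (IntegrableOn G (f '' U) ↔ IntegrableOn (fun w => ‖deriv f w‖ ^ 2 * G (f w)) U) ∧
      ∫ x in f '' U, G x = ∫ w in U, ‖deriv f w‖ ^ 2 * G (f w) := by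
  have hd : ∀ w ∈ U, HasFDerivWithinAt f
      ((ContinuousLinearMap.toSpanSingleton ℂ (deriv f w)).restrictScalars ℝ) U w := fun w hw =>
    ((hf.differentiableAt (hU.mem_nhds hw)).hasDerivAt.hasFDerivAt.restrictScalars
      ℝ).hasFDerivWithinAt
  have h1 := integrableOn_image_iff_integrableOn_abs_det_fderiv_smul volume hU.measurableSet hd hinj G
  have h2 := integral_image_eq_integral_abs_det_fderiv_smul volume hU.measurableSet hd hinj G
  simp only [det_restrictScalars_toSpanSingleton, smul_eq_mul] at h1 h2
  exact ⟨h1, h2⟩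

namespace IsDiscChart

variable {Ω : Set ℂ} {φ : ℂ → ℂ}

theorem gradient_comp_invFunOn (h : IsDiscChart Ω φ) {ζ : ℂ → ℝ} (hζ : ContDiffOn ℝ 1 ζ Ω) {w : ℂ}
    (hw : w ∈ ball (0 : ℂ) 1) : gradient (ζ ∘ Function.invFunOn φ Ω) w
      = conj (deriv (Function.invFunOn φ Ω) w) * gradient ζ (Function.invFunOn φ Ω w) := by
  rw [(h.hasDerivAt_invFunOn hw).deriv]
  exact gradient_comp_holomorphic (h.hasDerivAt_invFunOn hw)
    ((hζ.contDiffAt (h.isOpen.mem_nhds (h.invFunOn_mem hw))).differentiableAt one_ne_zero)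

theorem contDiffOn_comp_invFunOn (h : IsDiscChart Ω φ) {ζ : ℂ → ℝ} (hζ : ContDiffOn ℝ 1 ζ Ω) :
    ContDiffOn ℝ 1 (ζ ∘ Function.invFunOn φ Ω) (ball 0 1) :=
  hζ.comp ((h.differentiableOn_invFunOn.contDiffOn isOpen_ball).restrict_scalars ℝ)
    fun _ hw => h.invFunOn_mem hw

theorem integrableOn_gradient_sq_comp (h : IsDiscChart Ω φ) {ζ : ℂ → ℝ} (hζ : ContDiffOn ℝ 1 ζ Ω)
    (hint : IntegrableOn (fun x => ‖gradient ζ x‖ ^ 2) Ω) :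
    IntegrableOn (fun w => ‖gradient (ζ ∘ Function.invFunOn φ Ω) w‖ ^ 2) (ball 0 1) := by
  have h1 := (setIntegral_image_holomorphic isOpen_ball h.differentiableOn_invFunOn
    h.injOn_invFunOn (fun x => ‖gradient ζ x‖ ^ 2)).1
  rw [h.image_invFunOn] at h1
  refine (h1.1 hint).congr_fun (fun w hw => ?_) measurableSet_ball
  simp only [h.gradient_comp_invFunOn hζ hw, norm_mul, Complex.norm_conj, mul_pow]

/-- Conformal invariance of the pairing of the field `conj K` with gradients. -/
theorem pairing_comp (h : IsDiscChart Ω φ) {ζ : ℂ → ℝ} (hζ : ContDiffOn ℝ 1 ζ Ω) (K : ℂ → ℂ) :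
    (IntegrableOn (fun x => inner ℝ (conj (K (φ x) * deriv φ x)) (gradient ζ x)) Ω ↔
      IntegrableOn (fun w => inner ℝ (conj (K w)) (gradient (ζ ∘ Function.invFunOn φ Ω) w))
        (ball 0 1)) ∧
      ∫ x in Ω, inner ℝ (conj (K (φ x) * deriv φ x)) (gradient ζ x)
        = ∫ w in ball 0 1, inner ℝ (conj (K w)) (gradient (ζ ∘ Function.invFunOn φ Ω) w) := by
  have h1 := setIntegral_image_holomorphic isOpen_ball h.differentiableOn_invFunOn
    h.injOn_invFunOn (fun x => inner ℝ (conj (K (φ x) * deriv φ x)) (gradient ζ x))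
  rw [h.image_invFunOn] at h1
  -- The Jacobian is `|f'|² = f' · conj f'` with `f' = 1/φ'`: the first factor cancels the `φ'` of
  -- the field, the second is the one produced by the gradient of the composition.
  have h2 : EqOn (fun w => ‖deriv (Function.invFunOn φ Ω) w‖ ^ 2 *
      inner ℝ (conj (K (φ (Function.invFunOn φ Ω w)) * deriv φ (Function.invFunOn φ Ω w)))
        (gradient ζ (Function.invFunOn φ Ω w)))
      (fun w => inner ℝ (conj (K w)) (gradient (ζ ∘ Function.invFunOn φ Ω) w)) (ball 0 1) := by
    intro w hw
    have hd := h.deriv_ne_zero (h.invFunOn_mem hw)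
    simp only [h.gradient_comp_invFunOn hζ hw, h.map_invFunOn hw,
      (h.hasDerivAt_invFunOn hw).deriv]
    set z := deriv φ (Function.invFunOn φ Ω w)
    have hz : conj z ≠ 0 := by simpa using hd
    have h3 : ((‖z⁻¹‖ ^ 2 : ℝ) : ℂ) = z⁻¹ * conj (z⁻¹) := by
      rw [Complex.mul_conj']
      push_cast
      rfl
    rw [inner_eq_re_conj_mul, inner_eq_re_conj_mul, ← Complex.re_ofReal_mul, h3]
    congr 1
    simp only [Complex.conj_conj, map_inv₀]
    field_simp
  rw [h1.1, h1.2, integrableOn_congr_fun h2 measurableSet_ball,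
    setIntegral_congr_fun measurableSet_ball h2]
  exact ⟨Iff.rfl, rfl⟩

end IsDiscChart

/-! ### The Neumann problem for the canonical datum -/

theorem HarmonicOnNhd.contDiffOn_one {D : ℂ → ℝ} {Ω : Set ℂ} (hD : HarmonicOnNhd D Ω) :
    ContDiffOn ℝ 1 D Ω := fun x hx =>
  ((hD x hx).1.of_le (by norm_num)).contDiffWithinAt

theorem gradient_eq_zero_iff_fderiv {D : ℂ → ℝ} {x : ℂ} (h : gradient D x = 0) :
    fderiv ℝ D x = 0 := by
  rw [gradient] at h
  exact (map_eq_zero_iff _ (toDual ℝ ℂ).symm.injective).1 h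

theorem hasGradientAt_withPole {a x : ℂ} (hne : x ≠ a) {D : ℂ → ℝ} (hD : DifferentiableAt ℝ D x) :
    HasGradientAt (withPole a D) (conj ((x - a)⁻¹) + gradient D x) x := by
  have h1 := hasGradientAt_log_norm ((hasDerivAt_id x).sub_const a) (sub_ne_zero.2 hne)
  have h2 := hD.hasGradientAt
  rw [hasGradientAt_iff_hasFDerivAt] at h1 h2 ⊢
  have h3 := h1.add h2
  rw [← map_add] at h3
  rw [one_div] at h3
  exact h3

theorem ae_restrict_ne (Ω : Set ℂ) (a : ℂ) : ∀ᵐ x ∂(volume.restrict Ω), x ≠ a :=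
  ae_restrict_of_ae (measure_eq_zero_iff_ae_notMem.1 (measure_singleton a))

theorem integrable_norm_add_sq {μ : Measure ℂ} {u v : ℂ → ℂ} (hu : Measurable u) (hv : Measurable v)
    (hu2 : Integrable (fun x => ‖u x‖ ^ 2) μ) (hv2 : Integrable (fun x => ‖v x‖ ^ 2) μ) :
    Integrable (fun x => ‖u x + v x‖ ^ 2) μ := by
  refine ((hu2.add hv2).const_mul 2).mono' ((hu.add hv).norm.pow_const 2).aestronglyMeasurable
    (Eventually.of_forall fun x => ?_)
  rw [Real.norm_of_nonneg (by positivity)]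
  simp only [Pi.add_apply]
  have h1 := norm_add_le (u x) (v x)
  have h2 : ‖u x + v x‖ ^ 2 ≤ (‖u x‖ + ‖v x‖) ^ 2 := by gcongr
  nlinarith [sq_nonneg (‖u x‖ - ‖v x‖)]

/-- Uniqueness for the Neumann problem. -/
theorem eqOn_closure_of_isNeumannRegularPart {Ω : Set ℂ} (hΩ : IsOpen Ω)
    (hc : IsPreconnected Ω) {a : ℂ} {k : ℂ → ℝ}
    [IsFiniteMeasure (arclength Ω)] (hσ : arclength Ω ≠ 0) {R₁ R₂ : ℂ → ℝ}
    (h₁ : IsNeumannRegularPart Ω a k R₁) (h₂ : IsNeumannRegularPart Ω a k R₂)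
    (hint₁ : Integrable (withPole a R₁) (arclength Ω))
    (hint₂ : Integrable (withPole a R₂) (arclength Ω)) :
    EqOn R₁ R₂ (closure Ω) := by
  set D : ℂ → ℝ := R₁ - R₂ with hD
  have hcd₁ := HarmonicOnNhd.contDiffOn_one h₁.harmonic
  have hcd₂ := HarmonicOnNhd.contDiffOn_one h₂.harmonic
  have hcd : ContDiffOn ℝ 1 D Ω := hcd₁.sub hcd₂
  have hd₁ : ∀ x ∈ Ω, DifferentiableAt ℝ R₁ x := fun x hx =>
    (hcd₁.contDiffAt (hΩ.mem_nhds hx)).differentiableAt one_ne_zero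
  have hd₂ : ∀ x ∈ Ω, DifferentiableAt ℝ R₂ x := fun x hx =>
    (hcd₂.contDiffAt (hΩ.mem_nhds hx)).differentiableAt one_ne_zero
  have hgr : ∀ x ∈ Ω, gradient D x = gradient R₁ x + -gradient R₂ x := fun x hx => by
    rw [gradient, gradient, gradient, hD, fderiv_sub (hd₁ x hx) (hd₂ x hx), map_sub, sub_eq_add_neg]
  have hsq : IntegrableOn (fun x => ‖gradient D x‖ ^ 2) Ω := by
    refine IntegrableOn.congr_fun (integrable_norm_add_sq (measurable_gradient R₁)
      (measurable_gradient R₂).neg h₁.normalDeriv.gradient_sq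
      (by simpa only [Pi.neg_apply, norm_neg] using! h₂.normalDeriv.gradient_sq)) (fun x hx => ?_) hΩ.measurableSet
    simp only [hgr x hx]
    rfl
  have htest : IsTestFunction Ω D := ⟨h₁.continuousOn.sub h₂.continuousOn, hcd, hsq⟩
  -- The difference is itself an admissible test function. Subtracting the two Green formulas tested
  -- on it cancels the data, and the poles cancel in the gradients.
  have hzero : ∫ x in Ω, ‖gradient D x‖ ^ 2 = 0 := by
    have e1 := h₁.normalDeriv.green D htest
    have e2 := h₂.normalDeriv.green D htest
    have e3 := integral_sub (h₁.normalDeriv.integrable_inner D htest)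
      (h₂.normalDeriv.integrable_inner D htest)
    rw [e1, e2, sub_self] at e3
    rw [← e3]
    refine integral_congr_ae ?_
    filter_upwards [ae_restrict_ne Ω a, ae_restrict_mem hΩ.measurableSet] with x hne hx
    rw [← inner_sub_left, (hasGradientAt_withPole hne (hd₁ x hx)).gradient,
      (hasGradientAt_withPole hne (hd₂ x hx)).gradient, ← real_inner_self_eq_norm_sq]
    congr 1
    rw [hgr x hx]
    ring
  have hgz : ∀ x ∈ Ω, gradient D x = 0 := by
    have h1 := (setIntegral_eq_zero_iff_of_nonneg_ae
      (Eventually.of_forall fun x => by positivity) hsq).1 hzero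
    have h2 : EqOn (gradient D) (fun _ => (0 : ℂ)) Ω := by
      refine Measure.eqOn_open_of_ae_eq (μ := volume) ?_ hΩ (continuousOn_gradient hΩ hcd)
        continuousOn_const
      filter_upwards [h1] with x hx
      simpa using hx
    exact h2
  obtain ⟨m, hm⟩ := hΩ.exists_is_const_of_fderiv_eq_zero hc
    (fun x hx => ((hd₁ x hx).sub (hd₂ x hx)).differentiableWithinAt)
    (fun x hx => gradient_eq_zero_iff_fderiv (hgz x hx))
  have hm' : EqOn D (fun _ => m) (closure Ω) :=
    EqOn.of_subset_closure (fun x hx => hm x hx) htest.continuousOn continuousOn_const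
      subset_closure subset_rfl
  -- The normalization by zero mean, with arclength of nonzero mass, removes the constant.
  have hm0 : m = 0 := by
    have e1 := integral_sub hint₁ hint₂
    rw [h₁.mean_zero, h₂.mean_zero, sub_self] at e1
    have e2 : ∫ p, (withPole a R₁ p - withPole a R₂ p) ∂(arclength Ω)
        = ∫ _, m ∂(arclength Ω) := by
      refine setIntegral_congr_fun isClosed_frontier.measurableSet fun p hp => ?_
      have := hm' (frontier_subset_closure hp)
      simp only [hD, Pi.sub_apply] at this
      simp only [withPole]
      linarith
    rw [e2, integral_const, smul_eq_mul, mul_eq_zero] at e1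
    refine e1.resolve_left ?_
    rwa [measureReal_eq_zero_iff, Measure.measure_univ_eq_zero]
  intro x hx
  have := hm' hx
  rw [hm0] at this
  exact sub_eq_zero.1 this

theorem integrable_arclength_of_continuousOn {Ω : Set ℂ} (hb : Bornology.IsBounded Ω)
    {k u : ℂ → ℝ} (hk : Integrable k (arclength Ω)) (hu : ContinuousOn u (closure Ω)) :
    Integrable (fun p => u p * k p) (arclength Ω) := by
  have hcpt : IsCompact (frontier Ω) :=
    hb.isCompact_closure.of_isClosed_subset isClosed_frontier frontier_subset_closure
  exact IntegrableOn.continuousOn_mul (hu.mono frontier_subset_closure) hk hcpt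

namespace IsDiscChart

variable {Ω : Set ℂ} {φ : ℂ → ℂ}

theorem gradient_withPole_regularPart (h : IsDiscChart Ω φ) {a x : ℂ} (ha : a ∈ Ω) (hx : x ∈ Ω)
    (hne : x ≠ a) (s c : ℝ) : gradient (withPole a (regularPart φ a s c)) x
      = conj (((φ x - φ a)⁻¹ - s * (conj (φ a) * (1 - conj (φ a) * φ x)⁻¹)) * deriv φ x) := by
  have hxc := subset_closure hx
  have h1 := hasGradientAt_log_norm ((h.hasDerivAt hx).sub_const (φ a))
    (sub_ne_zero.2 (h.map_ne ha hxc hne))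
  have h2 := hasGradientAt_log_norm (((h.hasDerivAt hx).const_mul (conj (φ a))).const_sub 1)
    (h.one_sub_ne_zero ha hxc)
  rw [hasGradientAt_iff_hasFDerivAt] at h1 h2
  have h3 := (h1.add (h2.const_mul s)).add_const c
  rw [← LinearIsometryEquiv.map_smul, ← map_add, ← hasGradientAt_iff_hasFDerivAt] at h3
  have h4 : withPole a (regularPart φ a s c) =ᶠ[𝓝 x]
      fun y => Real.log ‖φ y - φ a‖ + s * Real.log ‖1 - conj (φ a) * φ y‖ + c := by
    filter_upwards [h.isOpen.mem_nhds hx, isOpen_ne.mem_nhds hne] with y hy hya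
    exact h.withPole_regularPart ha (subset_closure hy) hya s c
  refine (h3.congr_of_eventuallyEq h4).gradient.trans ?_
  rw [Complex.real_smul, ← Complex.conj_ofReal s, ← map_mul, ← map_add, Complex.conj_ofReal]
  congr 1
  rw [div_eq_mul_inv, div_eq_mul_inv]
  ring

/-- The integral is the area of the disc; this is the only control on `φ'` up to the boundary that
is used. -/
theorem integrableOn_norm_deriv_sq (h : IsDiscChart Ω φ) :
    IntegrableOn (fun x => ‖deriv φ x‖ ^ 2) Ω := by
  have h1 := (setIntegral_image_holomorphic h.isOpen h.differentiableOn h.bijOn.injOn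
    (fun _ => (1 : ℝ))).1
  rw [h.bijOn.image_eq] at h1
  simpa using h1.1 (integrableOn_const (by simp))

theorem isTestFunction_log_one_sub (h : IsDiscChart Ω φ) {a : ℂ} (ha : a ∈ Ω) :
    IsTestFunction Ω (fun x => Real.log ‖1 - conj (φ a) * φ x‖) := by
  have hgr : ∀ x ∈ Ω, gradient (fun x => Real.log ‖1 - conj (φ a) * φ x‖) x
      = conj (-(conj (φ a) * deriv φ x) / (1 - conj (φ a) * φ x)) := fun x hx =>
    (hasGradientAt_log_norm (((h.hasDerivAt hx).const_mul (conj (φ a))).const_sub 1)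
      (h.one_sub_ne_zero ha (subset_closure hx))).gradient
  have hα := h.norm_lt_one ha
  refine ⟨h.continuousOn_log_one_sub ha, ?_, ?_⟩
  · refine HarmonicOnNhd.contDiffOn_one fun x hx => ?_
    exact AnalyticAt.harmonicAt_log_norm (analyticAt_const.sub (analyticAt_const.mul
      (h.differentiableOn.analyticAt (h.isOpen.mem_nhds hx))))
      (h.one_sub_ne_zero ha (subset_closure hx))
  · refine (h.integrableOn_norm_deriv_sq.const_mul (((1 - ‖φ a‖)⁻¹) ^ 2)).mono'
      ((measurable_gradient _).norm.pow_const 2).aestronglyMeasurable ?_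
    filter_upwards [ae_restrict_mem h.isOpen.measurableSet] with x hx
    rw [Real.norm_of_nonneg (by positivity), hgr x hx, Complex.norm_conj, norm_div, norm_neg,
      norm_mul, Complex.norm_conj, ← mul_pow]
    have h1 : 1 - ‖φ a‖ ≤ ‖1 - conj (φ a) * φ x‖ := by
      have h2 := norm_sub_norm_le (1 : ℂ) (conj (φ a) * φ x)
      rw [norm_one, norm_mul, Complex.norm_conj] at h2
      nlinarith [norm_nonneg (φ a), (h.norm_lt_one hx).le]
    have h0 : 0 < 1 - ‖φ a‖ := by linarith
    gcongr
    rw [mul_comm, div_eq_mul_inv, mul_comm]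
    gcongr
    exact mul_le_of_le_one_right (norm_nonneg (deriv φ x)) hα.le

/-- On `|φ| ≥ ρ > |φ a|` one stays off the poles up to the boundary, a compact region on which both
expressions are continuous. -/
theorem exists_bound_poleField (h : IsDiscChart Ω φ) {a a₀ : ℂ} (ha : a ∈ Ω)
    (h0 : φ a₀ = 0) {ρ : ℝ} (hρ0 : 0 < ρ) (hρ : ‖φ a‖ < ρ) :
    ∃ C, ∀ x ∈ Ω, ρ ≤ ‖φ x‖ →
      ‖poleField (φ a) (φ x)‖ ≤ C ∧ ‖(x - a₀)⁻¹ - (x - a)⁻¹‖ ≤ C := by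
  set S : Set ℂ := closure Ω ∩ φ ⁻¹' {w | ρ ≤ ‖w‖} with hS
  have hScpt : IsCompact S :=
    h.isBounded.isCompact_closure.of_isClosed_subset
      (h.continuousOn.preimage_isClosed_of_isClosed isClosed_closure
        (isClosed_le continuous_const continuous_norm)) inter_subset_left
  have hφ : ContinuousOn φ S := h.continuousOn.mono inter_subset_left
  have hn : ∀ x ∈ S, ρ ≤ ‖φ x‖ := fun x hx => hx.2
  have hφ0 : ∀ x ∈ S, φ x ≠ 0 := fun x hx => norm_pos_iff.1 (hρ0.trans_le (hn x hx))
  have hφa : ∀ x ∈ S, φ x ≠ φ a := fun x hx he => by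
    have := hn x hx
    rw [he] at this
    linarith
  have h1 : ContinuousOn (fun x => poleField (φ a) (φ x)) S :=
    (((hφ.sub continuousOn_const).inv₀ fun x hx => sub_ne_zero.2 (hφa x hx)).sub
      (continuousOn_const.mul ((continuousOn_const.sub (continuousOn_const.mul hφ)).inv₀
        fun x hx => h.one_sub_ne_zero ha hx.1))).sub (hφ.inv₀ hφ0)
  have h2 : ContinuousOn (fun x : ℂ => (x - a₀)⁻¹ - (x - a)⁻¹) S :=
    ((continuousOn_id.sub continuousOn_const).inv₀ fun x hx => sub_ne_zero.2 fun he =>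
      hφ0 x hx (by rw [show x = a₀ from he, h0])).sub
    ((continuousOn_id.sub continuousOn_const).inv₀ fun x hx => sub_ne_zero.2 fun he =>
      hφa x hx (by rw [show x = a from he]))
  obtain ⟨C₁, hC₁⟩ := hScpt.exists_bound_of_continuousOn h1
  obtain ⟨C₂, hC₂⟩ := hScpt.exists_bound_of_continuousOn h2
  exact ⟨max C₁ C₂, fun x hx hxρ => ⟨(hC₁ x ⟨subset_closure hx, hxρ⟩).trans (le_max_left _ _),
    (hC₂ x ⟨subset_closure hx, hxρ⟩).trans (le_max_right _ _)⟩⟩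

/-- The gradients of the Neumann function with pole `a` and of the Dirichlet function with pole
`a₀` differ by the pullback of `poleField`. -/
theorem gradient_withPole_eq_add (h : IsDiscChart Ω φ) {a a₀ x : ℂ} (ha : a ∈ Ω) (ha₀ : a₀ ∈ Ω)
    (h0 : φ a₀ = 0) (hx : x ∈ Ω) (hxa : x ≠ a) (hxa₀ : x ≠ a₀) (c : ℝ) :
    gradient (withPole a (regularPart φ a 1 c)) x
      = gradient (withPole a₀ (hatR Ω a₀)) x + conj (poleField (φ a) (φ x) * deriv φ x) := by
  have h1 : withPole a₀ (hatR Ω a₀) =ᶠ[𝓝 x] withPole a₀ (regularPart φ a₀ (-1) 0) := by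
    filter_upwards [h.isOpen.mem_nhds hx] with y hy
    rw [withPole, withPole, h.hatR_eqOn ha₀ (subset_closure hy)]
  rw [show gradient (withPole a₀ (hatR Ω a₀)) x = gradient (withPole a₀ (regularPart φ a₀ (-1) 0)) x
    by rw [gradient, gradient, h1.fderiv_eq], h.gradient_withPole_regularPart ha hx hxa,
    h.gradient_withPole_regularPart ha₀ hx hxa₀, h0, ← map_add]
  congr 1
  simp [poleField]
  ring

theorem differentiableAt_regularPart (h : IsDiscChart Ω φ) {a x : ℂ} (ha : a ∈ Ω) (hx : x ∈ Ω)
    (s c : ℝ) : DifferentiableAt ℝ (regularPart φ a s c) x :=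
  ((h.harmonicOnNhd_regularPart ha s c) x hx).1.differentiableAt (by norm_num)

/-- On the compact set `|φ| ≤ ρ` the gradient is continuous. Off it, the gradient is that of `hatR`,
square integrable by hypothesis, plus a bounded multiple of `φ'` and a bounded term. -/
theorem integrableOn_gradient_regularPart_sq (h : IsDiscChart Ω φ) {a a₀ : ℂ} (ha : a ∈ Ω)
    (ha₀ : a₀ ∈ Ω) (h0 : φ a₀ = 0) (c : ℝ)
    (hsq : IntegrableOn (fun x => ‖gradient (hatR Ω a₀) x‖ ^ 2) Ω) :
    IntegrableOn (fun x => ‖gradient (regularPart φ a 1 c) x‖ ^ 2) Ω := by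
  obtain ⟨ρ, hρ, hρ1⟩ := exists_between (h.norm_lt_one ha)
  have hρ0 : 0 < ρ := (norm_nonneg _).trans_lt hρ
  obtain ⟨C, hC⟩ := h.exists_bound_poleField ha h0 hρ0 hρ
  set K : Set ℂ := Function.invFunOn φ Ω '' closedBall 0 ρ with hK
  have hcb : closedBall (0 : ℂ) ρ ⊆ ball 0 1 := closedBall_subset_ball hρ1
  have hKΩ : K ⊆ Ω := by
    rintro _ ⟨w, hw, rfl⟩
    exact h.invFunOn_mem (hcb hw)
  have hKcpt : IsCompact K := (isCompact_closedBall 0 ρ).image_of_continuousOn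
    (h.differentiableOn_invFunOn.continuousOn.mono hcb)
  have hcont : ContinuousOn (gradient (regularPart φ a 1 c)) Ω := continuousOn_gradient h.isOpen
    (HarmonicOnNhd.contDiffOn_one (h.harmonicOnNhd_regularPart ha 1 c))
  have h1 : IntegrableOn (fun x => ‖gradient (regularPart φ a 1 c) x‖ ^ 2) K :=
    ((hcont.mono hKΩ).norm.pow 2).integrableOn_compact hKcpt
  have h2 : IntegrableOn (fun x => ‖gradient (regularPart φ a 1 c) x‖ ^ 2) (Ω \ K) := by
    have hb : IntegrableOn (fun x => 3 * (‖gradient (hatR Ω a₀) x‖ ^ 2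
        + C ^ 2 * ‖deriv φ x‖ ^ 2 + C ^ 2)) Ω :=
      ((hsq.add (h.integrableOn_norm_deriv_sq.const_mul (C ^ 2))).add
        (integrableOn_const (C := C ^ 2) h.isBounded.measure_lt_top.ne)).const_mul 3
    refine (hb.mono_set sdiff_subset).mono'
      ((measurable_gradient _).norm.pow_const 2).aestronglyMeasurable ?_
    filter_upwards [ae_restrict_mem (h.isOpen.measurableSet.diff hKcpt.isClosed.measurableSet),
      ae_restrict_ne _ a, ae_restrict_ne _ a₀] with x hx hxa hxa₀
    have hxρ : ρ ≤ ‖φ x‖ := by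
      by_contra! hlt
      exact hx.2 ⟨φ x, mem_closedBall_zero_iff.2 hlt.le, h.invFunOn_map hx.1⟩
    obtain ⟨hC1, hC2⟩ := hC x hx.1 hxρ
    have e1 := h.gradient_withPole_eq_add ha ha₀ h0 hx.1 hxa hxa₀ c
    rw [(hasGradientAt_withPole hxa (h.differentiableAt_regularPart ha hx.1 1 c)).gradient,
      (hasGradientAt_withPole hxa₀ (((h.isDirichletRegularPart_hatR ha₀).harmonic x
        hx.1).1.differentiableAt (by norm_num))).gradient] at e1
    have e2 : gradient (regularPart φ a 1 c) x = gradient (hatR Ω a₀) x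
        + conj (poleField (φ a) (φ x) * deriv φ x) + conj ((x - a₀)⁻¹ - (x - a)⁻¹) := by
      rw [map_sub]
      linear_combination e1
    rw [Real.norm_of_nonneg (by positivity), e2]
    have e3 : ‖gradient (hatR Ω a₀) x + conj (poleField (φ a) (φ x) * deriv φ x)
        + conj ((x - a₀)⁻¹ - (x - a)⁻¹)‖
        ≤ ‖gradient (hatR Ω a₀) x‖ + C * ‖deriv φ x‖ + C := by
      refine norm_add₃_le.trans ?_
      rw [Complex.norm_conj, Complex.norm_conj, norm_mul]
      gcongr
    calc _ ≤ (‖gradient (hatR Ω a₀) x‖ + C * ‖deriv φ x‖ + C) ^ 2 := by gcongr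
      _ ≤ _ := by
        nlinarith [sq_nonneg (‖gradient (hatR Ω a₀) x‖ - C * ‖deriv φ x‖),
          sq_nonneg (‖gradient (hatR Ω a₀) x‖ - C), sq_nonneg (C * ‖deriv φ x‖ - C)]
  have h3 := h1.union h2
  rwa [union_sdiff_cancel hKΩ] at h3

/-- Neumann data with flux `k` for every pole `a`: the correction field, transported to the disc,
contributes `2π (ζ a₀ - ζ a)` and nothing on the boundary. It thus moves the point mass from `a₀` to
`a` and leaves the flux unchanged. -/
theorem hasNormalDeriv_regularPart (h : IsDiscChart Ω φ) {a a₀ : ℂ} (ha : a ∈ Ω) (ha₀ : a₀ ∈ Ω)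
    (h0 : φ a₀ = 0) {k : ℂ → ℝ} (hk : HasNormalDeriv Ω a₀ (hatR Ω a₀) k) (c : ℝ) :
    HasNormalDeriv Ω a (regularPart φ a 1 c) k := by
  have hα := h.norm_lt_one ha
  have key : ∀ ζ : ℂ → ℝ, (fun x => inner ℝ (gradient (withPole a (regularPart φ a 1 c)) x)
      (gradient ζ x)) =ᵐ[volume.restrict Ω]
      fun x => inner ℝ (gradient (withPole a₀ (hatR Ω a₀)) x) (gradient ζ x)
        + inner ℝ (conj (poleField (φ a) (φ x) * deriv φ x)) (gradient ζ x) := fun ζ => by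
    filter_upwards [ae_restrict_mem h.isOpen.measurableSet, ae_restrict_ne _ a,
      ae_restrict_ne _ a₀] with x hx hxa hxa₀
    rw [h.gradient_withPole_eq_add ha ha₀ h0 hx hxa hxa₀, inner_add_left]
  have hpair : ∀ ζ : ℂ → ℝ, IsTestFunction Ω ζ →
      IntegrableOn (fun x => inner ℝ (conj (poleField (φ a) (φ x) * deriv φ x)) (gradient ζ x)) Ω
      := fun ζ hζ => (h.pairing_comp hζ.contDiffOn (poleField (φ a))).1.2
    (integrableOn_inner_poleField hα (h.contDiffOn_comp_invFunOn hζ.contDiffOn)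
      (h.integrableOn_gradient_sq_comp hζ.contDiffOn hζ.integrable))
  refine ⟨h.integrableOn_gradient_regularPart_sq ha ha₀ h0 c hk.gradient_sq, hk.integrable,
    fun ζ hζ => ((hk.integrable_inner ζ hζ).add (hpair ζ hζ)).congr (key ζ).symm, fun ζ hζ => ?_⟩
  obtain ⟨M, hM⟩ := h.isBounded.isCompact_closure.exists_bound_of_continuousOn hζ.continuousOn
  rw [integral_congr_ae (key ζ), integral_add (hk.integrable_inner ζ hζ) (hpair ζ hζ),
    hk.green ζ hζ, (h.pairing_comp hζ.contDiffOn (poleField (φ a))).2,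
    setIntegral_inner_poleField hα (h.contDiffOn_comp_invFunOn hζ.contDiffOn)
      (h.integrableOn_gradient_sq_comp hζ.contDiffOn hζ.integrable)
      (fun w hw => hM _ (subset_closure (h.invFunOn_mem hw)))]
  rw [Function.comp_apply, Function.comp_apply, h.invFunOn_map ha, ← h0, h.invFunOn_map ha₀]
  ring

theorem integrable_withPole_regularPart (h : IsDiscChart Ω φ) [IsFiniteMeasure (arclength Ω)]
    {a : ℂ} (ha : a ∈ Ω) {r : ℂ → ℝ} (hr : ContinuousOn r (closure Ω)) :
    Integrable (withPole a r) (arclength Ω) := by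
  have hcpt : IsCompact (frontier Ω) :=
    h.isBounded.isCompact_closure.of_isClosed_subset isClosed_frontier frontier_subset_closure
  have h1 : ContinuousOn (withPole a r) (frontier Ω) :=
    ((continuousOn_id.sub continuousOn_const).norm.log fun p hp =>
      norm_ne_zero_iff.2 (sub_ne_zero.2 (h.ne_of_mem_frontier ha hp))).add
      (hr.mono frontier_subset_closure)
  have h2 := IntegrableOn.continuousOn_mul h1
    (integrable_const (1 : ℝ) : Integrable _ (arclength Ω)) hcpt
  simpa only [mul_one] using! h2

theorem exists_isNeumannRegularPart (h : IsDiscChart Ω φ) [IsFiniteMeasure (arclength Ω)]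
    (hσ : arclength Ω ≠ 0) {a a₀ : ℂ} (ha : a ∈ Ω) (ha₀ : a₀ ∈ Ω)
    (h0 : φ a₀ = 0) {k : ℂ → ℝ} (hk : HasNormalDeriv Ω a₀ (hatR Ω a₀) k) :
    ∃ c, IsNeumannRegularPart Ω a k (regularPart φ a 1 c) := by
  have hm : (arclength Ω).real univ ≠ 0 := by
    rwa [Ne, measureReal_eq_zero_iff, Measure.measure_univ_eq_zero]
  set I := ∫ p, withPole a (regularPart φ a 1 0) p ∂(arclength Ω) with hI
  refine ⟨-(I / (arclength Ω).real univ), h.harmonicOnNhd_regularPart ha _ _,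
    h.continuousOn_regularPart ha _ _, h.hasNormalDeriv_regularPart ha ha₀ h0 hk _, ?_⟩
  have h1 : ∀ c p, withPole a (regularPart φ a 1 c) p
      = withPole a (regularPart φ a 1 0) p + c := fun c p => by
    simp only [withPole, regularPart]
    ring
  rw [integral_congr_ae (Eventually.of_forall (h1 _)), integral_add (h.integrable_withPole_regularPart ha (h.continuousOn_regularPart ha _ _))
    (integrable_const _), integral_const, smul_eq_mul, ← hI]
  field_simp
  ring

/-- The Green function with pole `a₀` is orthogonal to `log |1 - conj (φ a) φ|`. -/
theorem integral_current_mul_log (h : IsDiscChart Ω φ) {a a₀ : ℂ} (ha : a ∈ Ω) (ha₀ : a₀ ∈ Ω)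
    (h0 : φ a₀ = 0) {k : ℂ → ℝ} (hk : HasNormalDeriv Ω a₀ (hatR Ω a₀) k) :
    ∫ p, k p * Real.log ‖1 - conj (φ a) * φ p‖ ∂(arclength Ω) = 0 := by
  set ζ : ℂ → ℝ := fun x => Real.log ‖1 - conj (φ a) * φ x‖ with hζdef
  have hζ := h.isTestFunction_log_one_sub ha
  have hα := h.norm_lt_one ha
  have h1 := hk.green ζ hζ
  -- Since `φ a₀ = 0`, the test function vanishes at the pole and Green's formula reduces to the
  -- interior integral.
  have h2 : ζ a₀ = 0 := by simp [hζdef, h0]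
  have h3 : ∫ x in Ω, inner ℝ (gradient (withPole a₀ (hatR Ω a₀)) x) (gradient ζ x)
      = ∫ x in Ω, inner ℝ (conj ((φ x)⁻¹ * deriv φ x)) (gradient ζ x) := by
    refine integral_congr_ae ?_
    filter_upwards [ae_restrict_mem h.isOpen.measurableSet, ae_restrict_ne _ a₀] with x hx hxa₀
    have e1 : withPole a₀ (hatR Ω a₀) =ᶠ[𝓝 x] withPole a₀ (regularPart φ a₀ (-1) 0) := by
      filter_upwards [h.isOpen.mem_nhds hx] with y hy
      rw [withPole, withPole, h.hatR_eqOn ha₀ (subset_closure hy)]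
    rw [show gradient (withPole a₀ (hatR Ω a₀)) x
      = gradient (withPole a₀ (regularPart φ a₀ (-1) 0)) x by
        rw [gradient, gradient, e1.fderiv_eq], h.gradient_withPole_regularPart ha₀ hx hxa₀, h0]
    simp
  have hne : ∀ w ∈ ball (0 : ℂ) 1, 1 - conj (φ a) * w ≠ 0 := fun w hw =>
    one_sub_conj_mul_ne_zero hα (mem_ball_zero_iff.1 hw).le
  have h4 : ∀ w ∈ ball (0 : ℂ) 1, gradient (ζ ∘ Function.invFunOn φ Ω) w
      = conj (-conj (φ a) / (1 - conj (φ a) * w)) := fun w hw => by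
    have e1 := hasGradientAt_log_norm (((hasDerivAt_id w).const_mul (conj (φ a))).const_sub 1)
      (hne w hw)
    have e2 : ζ ∘ Function.invFunOn φ Ω =ᶠ[𝓝 w] fun w => Real.log ‖1 - conj (φ a) * w‖ := by
      filter_upwards [isOpen_ball.mem_nhds hw] with v hv
      simp only [hζdef, Function.comp_apply, h.map_invFunOn hv]
    have e3 := (e1.congr_of_eventuallyEq e2).gradient
    simpa using e3
  -- On the disc the Green function has gradient that of `log |w|`, and the test function is the
  -- real part of a holomorphic function, so the orthogonality on circles applies.
  have h5 : ∫ w in ball 0 1, inner ℝ (conj (w⁻¹)) (gradient (ζ ∘ Function.invFunOn φ Ω) w) = 0 := by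
    rw [← setIntegral_inner_inv_conj (K := fun w => -conj (φ a) / (1 - conj (φ a) * w))
      (C := ‖φ a‖ / (1 - ‖φ a‖)) ?_ ?_]
    · exact setIntegral_congr_fun measurableSet_ball fun w hw => by simp only [h4 w hw]
    · intro w hw
      have hd : DifferentiableAt ℂ (fun w => 1 - conj (φ a) * w) w := by fun_prop
      exact ((differentiableAt_const _).div hd (hne w hw)).differentiableWithinAt
    · intro w hw
      rw [norm_div, norm_neg, Complex.norm_conj]
      have h0 : 0 < 1 - ‖φ a‖ := by linarith
      gcongr
      have h2 := norm_sub_norm_le (1 : ℂ) (conj (φ a) * w)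
      rw [norm_one, norm_mul, Complex.norm_conj] at h2
      nlinarith [norm_nonneg (φ a), mem_ball_zero_iff.1 hw]
  rw [h3, (h.pairing_comp hζ.contDiffOn fun w => w⁻¹).2, h5, h2] at h1
  linarith

/-- On the boundary `Φ = 2 log |1 - conj (φ a) φ| + c`. The logarithm integrates to `0` against the
current, and the current has mass `2π` by the degree condition, so half the boundary integral is `π
c`, exactly cancelled by the `c` in `-π R(a)`. -/
theorem W_eq (h : IsDiscChart Ω φ) [IsFiniteMeasure (arclength Ω)] (hc : IsPreconnected Ω)
    {a a₀ : ℂ} (ha : a ∈ Ω) (ha₀ : a₀ ∈ Ω)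
    (h0 : φ a₀ = 0) {g : ℂ → ℂ} (hg : IsCanonicalDatum Ω a₀ g) :
    W Ω a g = -Real.pi * (Real.log ‖deriv φ a‖ + Real.log (1 - ‖φ a‖ ^ 2)) := by
  have hmass : ∫ p, current Ω g p ∂(arclength Ω) = 2 * Real.pi := by
    have := hg.isBoundaryDatum.degree_eq_one
    field_simp at this
    linarith
  -- Nonvanishing of the boundary measure comes from the degree: a null measure would give current
  -- mass `0`.
  have hσ : arclength Ω ≠ 0 := by
    intro hz
    rw [hz, integral_zero_measure] at hmass
    linarith [Real.pi_pos]
  obtain ⟨c, hcN⟩ := h.exists_isNeumannRegularPart hσ ha ha₀ h0 hg.normalDeriv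
  have hR : IsNeumannRegularPart Ω a (current Ω g) (R Ω a g) :=
    Classical.epsilon_spec (p := IsNeumannRegularPart Ω a (current Ω g)) ⟨_, hcN⟩
  have heq := eqOn_closure_of_isNeumannRegularPart h.isOpen hc hσ hR hcN
    (h.integrable_withPole_regularPart ha hR.continuousOn)
    (h.integrable_withPole_regularPart ha hcN.continuousOn)
  have h1 : ∫ p, Phi Ω a g p * current Ω g p ∂(arclength Ω) = 2 * Real.pi * c := by
    have e1 : ∫ p, Phi Ω a g p * current Ω g p ∂(arclength Ω)
        = ∫ p, (2 * (current Ω g p * Real.log ‖1 - conj (φ a) * φ p‖) + c * current Ω g p)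
          ∂(arclength Ω) := by
      refine setIntegral_congr_fun isClosed_frontier.measurableSet fun p hp => ?_
      have e2 := h.withPole_regularPart_on_frontier ha hp 1 c
      simp only [Phi, withPole] at e2 ⊢
      rw [heq (frontier_subset_closure hp), e2]
      ring
    have e3 : Integrable (fun p => current Ω g p * Real.log ‖1 - conj (φ a) * φ p‖)
        (arclength Ω) := by
      simpa only [mul_comm] using integrable_arclength_of_continuousOn h.isBounded
        hg.normalDeriv.integrable (h.continuousOn_log_one_sub ha)
    rw [e1, integral_add (e3.const_mul 2) (hg.normalDeriv.integrable.const_mul c),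
      integral_const_mul, integral_const_mul,
      h.integral_current_mul_log ha ha₀ h0 hg.normalDeriv, hmass]
    ring
  rw [W, h1, heq (subset_closure ha), h.regularPart_self ha]
  ring

end IsDiscChart

/-! ### Hessians -/

theorem hessian_congr {F G : ℂ → ℝ} {z : ℂ} (h : F =ᶠ[𝓝 z] G) : hessian F z = hessian G z := by
  rw [hessian, hessian, (h.fderiv (𝕜 := ℝ)).fderiv_eq]

theorem differentiableAt_fderiv_of_contDiffAt {F : ℂ → ℝ} {z : ℂ} (hF : ContDiffAt ℝ 2 F z) :
    DifferentiableAt ℝ (fderiv ℝ F) z :=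
  (hF.fderiv_right (m := 1) (by norm_num)).differentiableAt one_ne_zero

theorem eventually_differentiableAt_of_contDiffAt {F : ℂ → ℝ} {z : ℂ} (hF : ContDiffAt ℝ 2 F z) :
    ∀ᶠ w in 𝓝 z, DifferentiableAt ℝ F w := by
  filter_upwards [hF.eventually (by simp)] with w hw
  exact hw.differentiableAt (by norm_num)

theorem hessian_add {F G : ℂ → ℝ} {z : ℂ} (hF : ContDiffAt ℝ 2 F z) (hG : ContDiffAt ℝ 2 G z) :
    hessian (fun w => F w + G w) z = hessian F z + hessian G z := by
  have h1 : fderiv ℝ (fun w => F w + G w) =ᶠ[𝓝 z] fun w => fderiv ℝ F w + fderiv ℝ G w := by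
    filter_upwards [eventually_differentiableAt_of_contDiffAt hF,
      eventually_differentiableAt_of_contDiffAt hG] with w h1 h2
    exact fderiv_fun_add h1 h2
  ext i j
  simp only [hessian, Matrix.of_apply, Matrix.add_apply]
  rw [h1.fderiv_eq, fderiv_fun_add (differentiableAt_fderiv_of_contDiffAt hF)
    (differentiableAt_fderiv_of_contDiffAt hG)]
  rfl

theorem hessian_const_mul {F : ℂ → ℝ} {z : ℂ} (hF : ContDiffAt ℝ 2 F z) (s : ℝ) :
    hessian (fun w => s * F w) z = s • hessian F z := by
  have h1 : fderiv ℝ (fun w => s * F w) =ᶠ[𝓝 z] fun w => s • fderiv ℝ F w := by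
    filter_upwards [eventually_differentiableAt_of_contDiffAt hF] with w h1
    exact fderiv_const_mul h1 s
  ext i j
  simp only [hessian, Matrix.of_apply, Matrix.smul_apply]
  rw [h1.fderiv_eq, fderiv_fun_const_smul (differentiableAt_fderiv_of_contDiffAt hF)]
  rfl

/-- Second derivatives are derivatives of directional derivatives. -/
theorem fderiv_fderiv_apply {F : ℂ → ℝ} {z : ℂ} (hF : ContDiffAt ℝ 2 F z) (u v : ℂ) {L : ℂ →L[ℝ] ℝ}
    {D : ℂ → ℝ} (hD : ∀ᶠ w in 𝓝 z, fderiv ℝ F w v = D w) (hL : HasFDerivAt D L z) :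
    fderiv ℝ (fderiv ℝ F) z u v = L u := by
  have h1 := (differentiableAt_fderiv_of_contDiffAt hF).hasFDerivAt.clm_apply
    (hasFDerivAt_const v z)
  have h2 := (hL.congr_of_eventuallyEq hD).unique h1
  rw [h2]
  simp

theorem contDiffAt_log_norm {F : ℂ → ℂ} {z : ℂ} (hF : AnalyticAt ℂ F z) (h0 : F z ≠ 0) :
    ContDiffAt ℝ 2 (fun w => Real.log ‖F w‖) z :=
  (AnalyticAt.harmonicAt_log_norm hF h0).1

theorem fderiv_log_norm {F : ℂ → ℂ} {z : ℂ} (hF : DifferentiableAt ℂ F z) (h0 : F z ≠ 0) (v : ℂ) :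
    fderiv ℝ (fun w => Real.log ‖F w‖) z v = (deriv F z / F z * v).re := by
  have h1 := hasGradientAt_log_norm hF.hasDerivAt h0
  rw [← inner_gradient_left, h1.gradient, inner_eq_re_conj_mul, Complex.conj_conj]

/-- The first derivative along `v` is `Re ((F'/F) v)` with `F'/F` holomorphic, so the second is `Re
(u q' v)`, evaluated on the basis `1, i`. -/
theorem hessian_log_norm {F : ℂ → ℂ} {z : ℂ} (hF : AnalyticAt ℂ F z) (h0 : F z ≠ 0) :
    hessian (fun w => Real.log ‖F w‖) z
      = conjMulMatrix (deriv (fun w => deriv F w / F w) z) := by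
  have hq : HasDerivAt (fun w => deriv F w / F w) (deriv (fun w => deriv F w / F w) z) z :=
    (hF.deriv.div hF h0).differentiableAt.hasDerivAt
  set q' := deriv (fun w => deriv F w / F w) z
  have key : ∀ u v : ℂ, fderiv ℝ (fderiv ℝ (fun w => Real.log ‖F w‖)) z u v
      = (u * q' * v).re := fun u v => by
    have h1 : ∀ᶠ w in 𝓝 z, fderiv ℝ (fun w => Real.log ‖F w‖) w v = (deriv F w / F w * v).re := by
      filter_upwards [hF.eventually_analyticAt, hF.continuousAt.eventually_ne h0] with w h1 h2
      exact fderiv_log_norm h1.differentiableAt h2 v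
    have h2 := Complex.reCLM.hasFDerivAt.comp z
      ((hq.mul_const v).hasFDerivAt.restrictScalars ℝ)
    rw [fderiv_fderiv_apply (contDiffAt_log_norm hF h0) u v h1 h2]
    simp [mul_assoc]
  ext i j
  simp only [hessian, Matrix.of_apply, key, conjMulMatrix]
  fin_cases i <;> fin_cases j <;> simp

theorem one_sub_norm_sq_pos {w : ℂ} (hw : w ∈ ball (0 : ℂ) 1) : 0 < 1 - ‖w‖ ^ 2 := by
  nlinarith [norm_nonneg w, mem_ball_zero_iff.1 hw]

theorem contDiffAt_log_one_sub_norm_sq {w : ℂ} (hw : w ∈ ball (0 : ℂ) 1) :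
    ContDiffAt ℝ 2 (fun w : ℂ => Real.log (1 - ‖w‖ ^ 2)) w :=
  (contDiffAt_const.sub (contDiff_norm_sq ℝ).contDiffAt).log (one_sub_norm_sq_pos hw).ne'

theorem fderiv_log_one_sub_norm_sq {w : ℂ} (hw : w ∈ ball (0 : ℂ) 1) (v : ℂ) :
    fderiv ℝ (fun w : ℂ => Real.log (1 - ‖w‖ ^ 2)) w v
      = (1 - ‖w‖ ^ 2)⁻¹ * (-2 * inner ℝ v w) := by
  have h1 := ((hasStrictFDerivAt_norm_sq w).hasFDerivAt.const_sub 1).log (one_sub_norm_sq_pos hw).ne'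
  rw [h1.fderiv, smul_apply, neg_apply, smul_apply, innerSL_apply_apply, real_inner_comm,
    smul_eq_mul, nsmul_eq_mul]
  ring

theorem hessian_log_one_sub_norm_sq :
    hessian (fun w : ℂ => Real.log (1 - ‖w‖ ^ 2)) 0 = (-2 : ℝ) • (1 : Matrix (Fin 2) (Fin 2) ℝ) := by
  have h0 : (0 : ℂ) ∈ ball (0 : ℂ) 1 := mem_ball_self one_pos
  have key : ∀ u v : ℂ, fderiv ℝ (fderiv ℝ (fun w : ℂ => Real.log (1 - ‖w‖ ^ 2))) 0 u v
      = -2 * inner ℝ v u := fun u v => by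
    have h1 : ∀ᶠ w in 𝓝 (0 : ℂ), fderiv ℝ (fun w : ℂ => Real.log (1 - ‖w‖ ^ 2)) w v
        = (1 - ‖w‖ ^ 2)⁻¹ * (-2 * innerSL ℝ v w) := by
      filter_upwards [isOpen_ball.mem_nhds h0] with w hw
      exact fderiv_log_one_sub_norm_sq hw v
    have h2 : DifferentiableAt ℝ (fun w : ℂ => (1 - ‖w‖ ^ 2)⁻¹) 0 :=
      ((contDiffAt_const.sub (contDiff_norm_sq ℝ (n := 1)).contDiffAt).inv
        (one_sub_norm_sq_pos h0).ne').differentiableAt one_ne_zero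
    -- At `0` the inner product vanishes, so the derivative of the first factor drops out.
    have h3 := h2.hasFDerivAt.mul ((innerSL ℝ v).hasFDerivAt.const_mul (-2))
    rw [fderiv_fderiv_apply (contDiffAt_log_one_sub_norm_sq h0) u v h1 h3]
    simp
  ext i j
  simp only [hessian, Matrix.of_apply, key, inner_eq_re_conj_mul]
  fin_cases i <;> fin_cases j <;> simp

/-- The Hessian of a composition with a holomorphic map, at a critical point. -/
theorem fderiv_fderiv_comp {F : ℂ → ℝ} {f : ℂ → ℂ} {z : ℂ} (hf : AnalyticAt ℂ f z)
    (hF : ContDiffAt ℝ 2 F (f z)) (h0 : fderiv ℝ F (f z) = 0) (u v : ℂ) :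
    fderiv ℝ (fderiv ℝ (fun w => F (f w))) z u v
      = fderiv ℝ (fderiv ℝ F) (f z) (deriv f z * u) (deriv f z * v) := by
  have hcd : ContDiffAt ℝ 2 (fun w => F (f w)) z :=
    hF.comp z (hf.contDiffAt.restrict_scalars ℝ)
  have h1 : ∀ᶠ w in 𝓝 z, fderiv ℝ (fun w => F (f w)) w v = fderiv ℝ F (f w) (deriv f w * v) := by
    filter_upwards [hf.eventually_analyticAt,
      hf.continuousAt.eventually (eventually_differentiableAt_of_contDiffAt hF)] with w h1 h2
    have h3 := h2.hasFDerivAt.comp w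
      (h1.differentiableAt.hasDerivAt.hasFDerivAt.restrictScalars ℝ)
    rw [show (fun w => F (f w)) = F ∘ f from rfl, h3.fderiv]
    simp [mul_comm]
  have h2 := ((differentiableAt_fderiv_of_contDiffAt hF).hasFDerivAt.comp z
    (hf.differentiableAt.hasDerivAt.hasFDerivAt.restrictScalars ℝ)).clm_apply
    ((hf.deriv.differentiableAt.hasDerivAt.mul_const v).hasFDerivAt.restrictScalars ℝ)
  rw [fderiv_fderiv_apply hcd u v h1 h2]
  -- The term containing `f''` is multiplied by the differential of `F`, zero at a critical point.
  simp [h0, mul_comm]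

/-- At a critical point the Hessian is congruent to the pulled-back one through multiplication by `c
= f' z`, a real matrix of determinant `|c|²`. -/
theorem det_hessian_comp {F : ℂ → ℝ} {f : ℂ → ℂ} {z : ℂ} (hf : AnalyticAt ℂ f z)
    (hF : ContDiffAt ℝ 2 F (f z)) (h0 : fderiv ℝ F (f z) = 0) :
    (hessian (fun w => F (f w)) z).det = (‖deriv f z‖ ^ 2) ^ 2 * (hessian F (f z)).det := by
  set B := fderiv ℝ (fderiv ℝ F) (f z) with hB
  set c := deriv f z with hc
  have e0 : c * 1 = c.re • (1 : ℂ) + c.im • Complex.I := by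
    apply Complex.ext <;> simp
  have e1 : c * Complex.I = (-c.im) • (1 : ℂ) + c.re • Complex.I := by
    apply Complex.ext <;> simp
  rw [Matrix.det_fin_two, Matrix.det_fin_two]
  simp only [hessian, Matrix.of_apply, fderiv_fderiv_comp hf hF h0, ← hB, ← hc]
  simp only [Matrix.cons_val_zero, Matrix.cons_val_one, e0, e1, map_add, map_smul, add_apply,
    smul_apply, smul_eq_mul]
  rw [Complex.sq_norm, Complex.normSq_apply]
  ring

/-- The matrix is traceless, so no term linear in `t` survives; this is why opposite multiples of
the identity give equal determinants. -/
theorem det_conjMulMatrix_add (z : ℂ) (s t : ℝ) :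
    (s • conjMulMatrix z + t • (1 : Matrix (Fin 2) (Fin 2) ℝ)).det
      = t ^ 2 - s ^ 2 * (z.re ^ 2 + z.im ^ 2) := by
  rw [Matrix.det_fin_two]
  simp [conjMulMatrix]
  ring

/-! ### Conformal representations and the associated disc charts -/

theorem exists_isDiscChart_leftInverse {β : ℝ≥0} {Ω : Set ℂ} (hΩ : IsC1HolderDomain β Ω) {f : ℂ → ℂ}
    (hf : IsConformalRepresentation f Ω) :
    ∃ φ, IsDiscChart Ω φ ∧ ∀ w ∈ ball (0 : ℂ) 1, φ (f w) = w := by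
  have hinv : ∀ w ∈ ball (0 : ℂ) 1, Function.invFunOn f (ball 0 1) (f w) = w :=
    fun w hw => hf.bijOn.injOn.leftInvOn_invFunOn hw
  have hd : DifferentiableOn ℂ (Function.invFunOn f (ball 0 1)) Ω := by
    intro x hx
    obtain ⟨w, hw, rfl⟩ := hf.bijOn.surjOn hx
    exact (hasDerivAt_invFunOn isOpen_ball hf.differentiableOn hf.bijOn.injOn
      hw).differentiableAt.differentiableWithinAt
  have hb : BijOn (Function.invFunOn f (ball 0 1)) Ω (ball 0 1) := by
    refine ⟨hf.bijOn.surjOn.mapsTo_invFunOn, ?_, fun w hw => ⟨f w, hf.bijOn.mapsTo hw, hinv w hw⟩⟩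
    intro x hx y hy hxy
    rw [← hf.bijOn.surjOn.rightInvOn_invFunOn hx, ← hf.bijOn.surjOn.rightInvOn_invFunOn hy, hxy]
  obtain ⟨φ, h1, h2⟩ := exists_isDiscChart hΩ hd hb
  exact ⟨φ, h1, fun w hw => (h2 (hf.bijOn.mapsTo hw)).trans (hinv w hw)⟩

/-- Boundedness gives `Ω ≠ ℂ`, and the representation is the inverse of the Riemann map centred at
`a`. -/
theorem exists_isConformalRepresentation {β : ℝ≥0} {Ω : Set ℂ} (hΩ : IsC1HolderDomain β Ω) {a : ℂ}
    (ha : a ∈ Ω) : ∃ f, IsConformalRepresentation f Ω ∧ f 0 = a := by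
  have hne : Ω ≠ univ := by
    rintro rfl
    exact NormedSpace.unbounded_univ ℝ ℂ hΩ.isBounded
  obtain ⟨F, h1, h2, h3⟩ := exists_bijOn_ball hΩ.isOpen hΩ.isSimplyConnected hne ha
  obtain ⟨φ, h, hφ⟩ := exists_isDiscChart hΩ h1 h2
  have h0 : φ a = 0 := (hφ ha).trans h3
  refine ⟨Function.invFunOn φ Ω, ⟨h.differentiableOn_invFunOn, fun w hw => h.invFunOn_mem hw,
    h.injOn_invFunOn, h.image_invFunOn.ge⟩, ?_⟩
  rw [← h0, h.invFunOn_map ha]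

/-! ### The two energies in a conformal coordinate -/

section Conformal

variable {β : ℝ≥0} {Ω : Set ℂ} {f : ℂ → ℂ}

theorem IsConformalRepresentation.analyticAt (hf : IsConformalRepresentation f Ω) {w : ℂ}
    (hw : w ∈ ball (0 : ℂ) 1) : AnalyticAt ℂ f w :=
  hf.differentiableOn.analyticAt (isOpen_ball.mem_nhds hw)

theorem IsConformalRepresentation.deriv_ne_zero (hf : IsConformalRepresentation f Ω) {w : ℂ}
    (hw : w ∈ ball (0 : ℂ) 1) : deriv f w ≠ 0 :=
  deriv_ne_zero_of_injOn isOpen_ball hf.differentiableOn hf.bijOn.injOn hw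

theorem IsConformalRepresentation.hatW_comp (hΩ : IsC1HolderDomain β Ω)
    (hf : IsConformalRepresentation f Ω) {w : ℂ} (hw : w ∈ ball (0 : ℂ) 1) :
    hatW Ω (f w) = Real.pi * Real.log ‖deriv f w‖ + Real.pi * Real.log (1 - ‖w‖ ^ 2) := by
  obtain ⟨φ, h, hφ⟩ := exists_isDiscChart_leftInverse hΩ hf
  have hfw := hf.bijOn.mapsTo hw
  have h1 : deriv φ (f w) * deriv f w = 1 := by
    have e1 := (h.hasDerivAt hfw).comp w (hf.analyticAt hw).differentiableAt.hasDerivAt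
    have e2 : φ ∘ f =ᶠ[𝓝 w] id := by
      filter_upwards [isOpen_ball.mem_nhds hw] with v hv
      exact hφ v hv
    exact (e1.congr_of_eventuallyEq e2.symm).unique (hasDerivAt_id w)
  rw [h.hatW_eq hfw, hφ w hw, eq_inv_of_mul_eq_one_left h1, norm_inv, Real.log_inv]
  ring

theorem IsConformalRepresentation.hessian_hatW_comp (hΩ : IsC1HolderDomain β Ω)
    (hf : IsConformalRepresentation f Ω) (hcd : ContDiffAt ℝ 2 (hatW Ω) (f 0))
    (hc : fderiv ℝ (hatW Ω) (f 0) = 0) :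
    hessian (fun w => hatW Ω (f w)) 0
      = Real.pi • conjMulMatrix (iteratedDeriv 3 f 0 / deriv f 0)
        + (-(2 * Real.pi)) • (1 : Matrix (Fin 2) (Fin 2) ℝ) := by
  have h0 : (0 : ℂ) ∈ ball (0 : ℂ) 1 := mem_ball_self one_pos
  have han := hf.analyticAt h0
  have hd0 := hf.deriv_ne_zero h0
  have heq : (fun w => hatW Ω (f w)) =ᶠ[𝓝 0]
      fun w => Real.pi * Real.log ‖deriv f w‖ + Real.pi * Real.log (1 - ‖w‖ ^ 2) := by
    filter_upwards [isOpen_ball.mem_nhds h0] with w hw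
    exact hf.hatW_comp hΩ hw
  have c1 := contDiffAt_log_norm han.deriv hd0
  have c2 := contDiffAt_log_one_sub_norm_sq h0
  -- The differential of `log (1 - |w|²)` is zero at `0`, so criticality of the energy is
  -- criticality of `log |f'|`, that is `f''/f' = 0`.
  have hcrit : deriv (deriv f) 0 = 0 := by
    have e1 : fderiv ℝ (fun w => hatW Ω (f w)) 0 = 0 := by
      have e2 := (hcd.differentiableAt (by norm_num)).hasFDerivAt.comp (0 : ℂ)
        (han.differentiableAt.hasDerivAt.hasFDerivAt.restrictScalars ℝ)
      rw [hc, ContinuousLinearMap.zero_comp] at e2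
      exact e2.fderiv
    have e3 : ∀ v : ℂ, (deriv (deriv f) 0 / deriv f 0 * v).re = 0 := fun v => by
      have e4 : fderiv ℝ (fun w => hatW Ω (f w)) 0 v
          = Real.pi * (deriv (deriv f) 0 / deriv f 0 * v).re + Real.pi * 0 := by
        rw [heq.fderiv_eq, fderiv_fun_add ((c1.differentiableAt (by norm_num)).const_mul _)
          ((c2.differentiableAt (by norm_num)).const_mul _),
          fderiv_const_mul (c1.differentiableAt (by norm_num)),
          fderiv_const_mul (c2.differentiableAt (by norm_num)), add_apply, smul_apply, smul_apply,
          fderiv_log_norm han.deriv.differentiableAt hd0, fderiv_log_one_sub_norm_sq h0]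
        simp
      rw [e1, mul_zero, add_zero, zero_apply] at e4
      exact (mul_eq_zero.1 e4.symm).resolve_left Real.pi_ne_zero
    have e5 : deriv (deriv f) 0 / deriv f 0 = 0 := by
      apply Complex.ext
      · simpa using e3 1
      · simpa using e3 Complex.I
    exact (div_eq_zero_iff.1 e5).resolve_right hd0
  -- With `f''(0) = 0` the quotient rule for `f''/f'` leaves only `f'''/f'`.
  have hq : deriv (fun w => deriv (deriv f) w / deriv f w) 0
      = iteratedDeriv 3 f 0 / deriv f 0 := by
    rw [deriv_fun_div han.deriv.deriv.differentiableAt han.deriv.differentiableAt hd0, hcrit,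
      iteratedDeriv_succ, iteratedDeriv_succ, iteratedDeriv_one]
    field_simp
    ring
  rw [hessian_congr heq, hessian_add (contDiffAt_const.mul c1) (contDiffAt_const.mul c2),
    hessian_const_mul c1, hessian_const_mul c2, hessian_log_norm han.deriv hd0, hq,
    hessian_log_one_sub_norm_sq, smul_smul]
  congr 2
  ring

/-- The comparison behind the theorem: the terms `log |φ'|` cancel, and the remaining difference is
a function of `|φ|` alone, of class `C²` and critical where `φ = 0`. -/
theorem W_eq_hatW_sub (hΩ : IsC1HolderDomain β Ω) {φ : ℂ → ℂ} (h : IsDiscChart Ω φ) {a a₀ : ℂ}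
    (ha : a ∈ Ω) (ha₀ : a₀ ∈ Ω) (h0 : φ a₀ = 0) {g : ℂ → ℂ} (hg : IsCanonicalDatum Ω a₀ g) :
    W Ω a g = hatW Ω a + -(2 * Real.pi) * Real.log (1 - ‖φ a‖ ^ 2) := by
  have := isFiniteMeasure_arclength hΩ
  have hc : IsPreconnected Ω := hΩ.isSimplyConnected.isPathConnected.isConnected.isPreconnected
  rw [h.W_eq hc ha ha₀ h0 hg, h.hatW_eq ha]
  ring

/-- At a critical point of `hatW`, the energy `W` with canonical datum is of class `C²` and
critical. -/
theorem contDiffAt_W_and_fderiv_eq_zero (hΩ : IsC1HolderDomain β Ω) {a₀ : ℂ} (ha₀ : a₀ ∈ Ω)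
    (hf : IsConformalRepresentation f Ω) (hf0 : f 0 = a₀) (hcd : ContDiffAt ℝ 2 (hatW Ω) a₀)
    (hc : fderiv ℝ (hatW Ω) a₀ = 0) {g : ℂ → ℂ} (hg : IsCanonicalDatum Ω a₀ g) :
    ContDiffAt ℝ 2 (fun a => W Ω a g) a₀ ∧ fderiv ℝ (fun a => W Ω a g) a₀ = 0 := by
  have h0 : (0 : ℂ) ∈ ball (0 : ℂ) 1 := mem_ball_self one_pos
  obtain ⟨φ, h, hφ⟩ := exists_isDiscChart_leftInverse hΩ hf
  have hφ0 : φ a₀ = 0 := by rw [← hf0, hφ 0 h0]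
  have heq : (fun a => W Ω a g) =ᶠ[𝓝 a₀]
      fun a => hatW Ω a + -(2 * Real.pi) * Real.log (1 - ‖φ a‖ ^ 2) := by
    filter_upwards [hΩ.isOpen.mem_nhds ha₀] with a ha
    exact W_eq_hatW_sub hΩ h ha ha₀ hφ0 hg
  have c1 := contDiffAt_log_one_sub_norm_sq (h.bijOn.mapsTo ha₀)
  have c2 : ContDiffAt ℝ 2 (fun a => Real.log (1 - ‖φ a‖ ^ 2)) a₀ :=
    c1.comp a₀ ((h.differentiableOn.analyticAt
      (h.isOpen.mem_nhds ha₀)).contDiffAt.restrict_scalars ℝ)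
  refine ⟨(hcd.add (contDiffAt_const.mul c2)).congr_of_eventuallyEq heq, ?_⟩
  have e1 : fderiv ℝ (fun a => Real.log (1 - ‖φ a‖ ^ 2)) a₀ = 0 := by
    have e2 := (c1.differentiableAt (by norm_num)).hasFDerivAt.comp a₀
      ((h.hasDerivAt ha₀).hasFDerivAt.restrictScalars ℝ)
    refine e2.fderiv.trans ?_
    ext v
    rw [ContinuousLinearMap.comp_apply, fderiv_log_one_sub_norm_sq (h.bijOn.mapsTo ha₀), hφ0]
    simp
  rw [heq.fderiv_eq, fderiv_fun_add (hcd.differentiableAt (by norm_num))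
    ((c2.differentiableAt (by norm_num)).const_mul _),
    fderiv_const_mul (c2.differentiableAt (by norm_num)), hc, e1]
  simp

/-- The difference of the energies contributes `-2π · (-2 I) = 4π I`, which turns `-2π I` into `2π
I`. -/
theorem IsConformalRepresentation.hessian_W_comp (hΩ : IsC1HolderDomain β Ω)
    (hf : IsConformalRepresentation f Ω) (hcd : ContDiffAt ℝ 2 (hatW Ω) (f 0))
    (hc : fderiv ℝ (hatW Ω) (f 0) = 0) {g : ℂ → ℂ} (hg : IsCanonicalDatum Ω (f 0) g) :
    hessian (fun w => W Ω (f w) g) 0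
      = Real.pi • conjMulMatrix (iteratedDeriv 3 f 0 / deriv f 0)
        + (2 * Real.pi) • (1 : Matrix (Fin 2) (Fin 2) ℝ) := by
  have h0 : (0 : ℂ) ∈ ball (0 : ℂ) 1 := mem_ball_self one_pos
  obtain ⟨φ, h, hφ⟩ := exists_isDiscChart_leftInverse hΩ hf
  have heq : (fun w => W Ω (f w) g) =ᶠ[𝓝 0]
      fun w => hatW Ω (f w) + -(2 * Real.pi) * Real.log (1 - ‖w‖ ^ 2) := by
    filter_upwards [isOpen_ball.mem_nhds h0] with w hw
    rw [W_eq_hatW_sub hΩ h (hf.bijOn.mapsTo hw) (hf.bijOn.mapsTo h0) (hφ 0 h0) hg, hφ w hw]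
  have c1 : ContDiffAt ℝ 2 (fun w => hatW Ω (f w)) 0 :=
    hcd.comp (0 : ℂ) ((hf.analyticAt h0).contDiffAt.restrict_scalars ℝ)
  have c2 := contDiffAt_log_one_sub_norm_sq h0
  rw [hessian_congr heq, hessian_add c1 (contDiffAt_const.mul c2), hessian_const_mul c2,
    hf.hessian_hatW_comp hΩ hcd hc, hessian_log_one_sub_norm_sq, smul_smul, add_assoc, ← add_smul]
  congr 2
  ring

end Conformal

end RenormalizedEnergy

/-! ### The main theorem -/

theorem mainTheorem8 (β : NNReal) (hβ0 : 0 < β) (hβ1 : β < 1)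
    (Ω : Set ℂ) (hΩ : RenormalizedEnergy.IsC1HolderDomain β Ω)
    (a₀ : ℂ) (ha₀ : a₀ ∈ Ω)
    (hcrit : RenormalizedEnergy.IsNondegenerateCriticalPoint (RenormalizedEnergy.hatW Ω) a₀)
    (g : ℂ → ℂ) (hg : RenormalizedEnergy.IsCanonicalDatum Ω a₀ g) :
    RenormalizedEnergy.IsNondegenerateCriticalPoint (fun a => RenormalizedEnergy.W Ω a g) a₀ ∧
    (RenormalizedEnergy.hessian (fun a => RenormalizedEnergy.W Ω a g) a₀).det =
      (RenormalizedEnergy.hessian (RenormalizedEnergy.hatW Ω) a₀).det ∧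
    ∀ f : ℂ → ℂ, RenormalizedEnergy.IsConformalRepresentation f Ω → f 0 = a₀ →
      RenormalizedEnergy.hessian (fun α => RenormalizedEnergy.hatW Ω (f α)) 0 =
          Real.pi • RenormalizedEnergy.conjMulMatrix (iteratedDeriv 3 f 0 / deriv f 0) -
            (2 * Real.pi) • (1 : Matrix (Fin 2) (Fin 2) ℝ) ∧
      RenormalizedEnergy.hessian (fun α => RenormalizedEnergy.W Ω (f α) g) 0 =
          Real.pi • RenormalizedEnergy.conjMulMatrix (iteratedDeriv 3 f 0 / deriv f 0) +
            (2 * Real.pi) • (1 : Matrix (Fin 2) (Fin 2) ℝ) ∧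
      (RenormalizedEnergy.hessian (fun α => RenormalizedEnergy.hatW Ω (f α)) 0).det =
        (RenormalizedEnergy.hessian (fun α => RenormalizedEnergy.W Ω (f α) g) 0).det := by
  have hhat : ∀ f : ℂ → ℂ, RenormalizedEnergy.IsConformalRepresentation f Ω → f 0 = a₀ →
      RenormalizedEnergy.hessian (fun α => RenormalizedEnergy.hatW Ω (f α)) 0 =
          Real.pi • RenormalizedEnergy.conjMulMatrix (iteratedDeriv 3 f 0 / deriv f 0) +
            (-(2 * Real.pi)) • (1 : Matrix (Fin 2) (Fin 2) ℝ) := fun f hf hf0 =>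
    hf.hessian_hatW_comp hΩ (hf0 ▸ hcrit.contDiffAt) (hf0 ▸ hcrit.critical)
  have hW : ∀ f : ℂ → ℂ, RenormalizedEnergy.IsConformalRepresentation f Ω → f 0 = a₀ →
      RenormalizedEnergy.hessian (fun α => RenormalizedEnergy.W Ω (f α) g) 0 =
          Real.pi • RenormalizedEnergy.conjMulMatrix (iteratedDeriv 3 f 0 / deriv f 0) +
            (2 * Real.pi) • (1 : Matrix (Fin 2) (Fin 2) ℝ) := fun f hf hf0 =>
    hf.hessian_W_comp hΩ (hf0 ▸ hcrit.contDiffAt) (hf0 ▸ hcrit.critical) (hf0 ▸ hg)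
  have hdet : ∀ f : ℂ → ℂ, RenormalizedEnergy.IsConformalRepresentation f Ω → f 0 = a₀ →
      (RenormalizedEnergy.hessian (fun α => RenormalizedEnergy.hatW Ω (f α)) 0).det =
        (RenormalizedEnergy.hessian (fun α => RenormalizedEnergy.W Ω (f α) g) 0).det := by
    intro f hf hf0
    rw [hhat f hf hf0, hW f hf hf0, RenormalizedEnergy.det_conjMulMatrix_add,
      RenormalizedEnergy.det_conjMulMatrix_add, neg_sq]
  -- The statements at `a₀` mention no coordinate, so one Riemann map is chosen to prove them.
  obtain ⟨f, hf, hf0⟩ := RenormalizedEnergy.exists_isConformalRepresentation hΩ ha₀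
  obtain ⟨hcd, hc⟩ := RenormalizedEnergy.contDiffAt_W_and_fderiv_eq_zero hΩ ha₀ hf hf0
    hcrit.contDiffAt hcrit.critical hg
  have h0 : (0 : ℂ) ∈ Metric.ball (0 : ℂ) 1 := Metric.mem_ball_self one_pos
  have hdet₀ : (RenormalizedEnergy.hessian (fun a => RenormalizedEnergy.W Ω a g) a₀).det =
      (RenormalizedEnergy.hessian (RenormalizedEnergy.hatW Ω) a₀).det := by
    -- Both energies are critical at `a₀`, so both determinants carry the same nonzero factor
    -- `|f'(0)|⁴`, which cancels.
    have h1 := hdet f hf hf0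
    rw [RenormalizedEnergy.det_hessian_comp (F := RenormalizedEnergy.hatW Ω) (hf.analyticAt h0)
        (by rw [hf0]; exact hcrit.contDiffAt) (by rw [hf0]; exact hcrit.critical),
      RenormalizedEnergy.det_hessian_comp (F := fun a => RenormalizedEnergy.W Ω a g)
        (hf.analyticAt h0) (by rw [hf0]; exact hcd) (by rw [hf0]; exact hc), hf0] at h1
    have h2 : (‖deriv f 0‖ ^ 2) ^ 2 ≠ 0 :=
      pow_ne_zero 2 (pow_ne_zero 2 (norm_ne_zero_iff.2 (hf.deriv_ne_zero h0)))
    exact (mul_left_cancel₀ h2 h1).symm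
  refine ⟨⟨hcd, hc, hdet₀ ▸ hcrit.nondegenerate⟩, hdet₀, fun f hf hf0 => ⟨?_, hW f hf hf0,
    hdet f hf hf0⟩⟩
  rw [hhat f hf hf0, neg_smul, sub_eq_add_neg]
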